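/- Let $d\ge 1$ and let $\mathbb{H}^d$ be the $d$-dimensional hyperbolic space of curvature $-1$, realised as the upper half-space $\{x\in\mathbb{R}^d: x_d>0\}$ with distance $d_1(x,y)=\operatorname{arcosh}\big(1+\tfrac{|x-y|^2}{2x_dy_d}\big)$ and with its $d$-dimensional Hausdorff measure (the Riemannian volume) $\mathcal{H}^d_1(\mathrm{d}x)=x_d^{-d}\,\mathrm{d}x$. Let $\partial\mathbb{H}^d=\{x_d=0\}\cup\{\infty\}$ be the set of ideal points. Fix $o\in\mathbb{H}^d$, write $B^d(o,R)$ for the open hyperbolic ball and $V_1(R)=\mathcal{H}^d_1(B^d(o,R))$. Let $\eta$ be a Poisson process on $\mathbb{H}^d$ with intensity measure $\gamma\mathcal{H}^d_1$, where $\gamma>0$, regarded as a random locally finite set. For $x\in\eta$ let $\ell(x,\eta)$ be the distance from $x$ to its radial nearest neighbour, i.e. to the nearest point among all $y\in\eta\cup\{o\}$ with $d_1(o,y)<d_1(o,x)$, and for $\alpha>0$ and $R>0$ let $$\mathcal{L}_R^{(\alpha)}=\sum_{x\in\eta\cap B^d(o,R)}\ell(x,\eta)^\alpha .$$ For an ideal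 point $e\in\partial\mathbb{H}^d$ and $y\in\mathbb{H}^d$ let ${\rm HB}_e(y)$ be the closed horoball around $e$ whose boundary passes through $y$, i.e. $\{z: B_\tau(z)\ge B_\tau(y)\}$, where $B_\tau(p)=\lim_{s\to\infty}(s-d_1(p,\tau(s)))$ is the Busemann function of a unit-speed geodesic ray $\tau$ tending to $e$ (the set does not depend on the choice of $\tau$). Let $\ell_e(y)$ be the distance from $y$ to the nearest point of $\eta\setminus\{y\}$ in ${\rm HB}_e(y)$, and for $x\in\mathbb{H}^d$ let $\ell_e^{(x)}(y)$ be the distance from $y$ to the nearest point of $(\eta\cup\{x\})\setminus\{y\}$ in ${\rm HB}_e(y)$; these are the lengths of the edges starting at $y$ in the hyperbolic directed spanning forests toward $e$ on $\eta\cup\{y\}$ and on $\eta\cup\{x,y\}$, respectively. Then for all $\alpha>0$, $\gamma>0$ and every ideal point $e\in\partial\mathbb{H}^d$, all the variances, expectations and integrals below are well defined and finite, and the limit $\lim_{R\to\infty}\operatorname{Var}[\mathcal{L}_R^{(\alpha)}]/V_1(R)$ exists and equals $$\gamma\,\mathbb{E}[\ell_e(o)^{2\alpha}]+2\gamma^2\int_{{\rm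 HB}_e(o)}\Big(\mathbb{E}\big[\ell_e^{(y)}(o)^\alpha\,\ell_e^{(o)}(y)^\alpha\big]-\mathbb{E}[\ell_e(o)^\alpha]\,\mathbb{E}[\ell_e(y)^\alpha]\Big)\,\mathcal{H}^d_1(\mathrm{d}y).$$ -/

import Mathlib

open MeasureTheory ProbabilityTheory Filter Topology
open scoped ENNReal

noncomputable section

namespace HypRST

/-- The upper half-space model of the hyperbolic space `ℍ^d` of constant curvature `-1`, in dimension
`d = n + 1`: the points of `ℝ^(n+1)` with positive last coordinate. The topology and the Borel
`σ`-field are those induced from `ℝ^(n+1)`; the Euclidean metric is *not* the hyperbolic one, which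
is `hdist` below. -/
abbrev HSpace (n : ℕ) : Type :=
  {x : EuclideanSpace ℝ (Fin (n + 1)) // 0 < x (Fin.last n)}

/-- The last coordinate of a point of the upper half-space. -/
def height {n : ℕ} (x : HSpace n) : ℝ := x.1 (Fin.last n)

/-- The hyperbolic distance. -/
def hdist {n : ℕ} (x y : HSpace n) : ℝ :=
  Real.arcosh (1 + ‖x.1 - y.1‖ ^ 2 / (2 * height x * height y))

/-- The open hyperbolic ball. -/
def hball {n : ℕ} (x : HSpace n) (r : ℝ) : Set (HSpace n) := {y | hdist x y < r}

/-- The Riemannian volume `x_d^{-d} dx` of `ℍ^d`, `d = n + 1`; it is the `d`-dimensional Hausdorff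
measure of the hyperbolic metric in its usual normalisation. -/
def hvol (n : ℕ) : Measure (HSpace n) :=
  ((volume : Measure (EuclideanSpace ℝ (Fin (n + 1)))).comap Subtype.val).withDensity
    fun x => ENNReal.ofReal (1 / height x ^ (n + 1))

/-- Geodesic rays `[0, ∞) → ℍ^d` parametrised by arc length (values at negative times are
irrelevant). -/
def IsGeodesicRay {n : ℕ} (τ : ℝ → HSpace n) : Prop :=
  ∀ s t : ℝ, 0 ≤ s → 0 ≤ t → hdist (τ s) (τ t) = |s - t|

/-- The boundary `∂ℍ^d`: the hyperplane `{x_d = 0}` together with a point at infinity. -/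
abbrev IdealPoint (n : ℕ) : Type :=
  OnePoint {x : EuclideanSpace ℝ (Fin (n + 1)) // x (Fin.last n) = 0}

/-- The curve `τ` tends to the ideal point `e`. -/
def TendsToIdeal {n : ℕ} (τ : ℝ → HSpace n) : IdealPoint n → Prop
  | none => Tendsto (fun t => ‖(τ t).1‖) atTop atTop
  | some b => Tendsto (fun t => (τ t).1) atTop (𝓝 b.1)

/-- The Busemann function `B_τ(p) = lim_{s → ∞} (s - d(p, τ(s)))` of a geodesic ray. -/
def busemann {n : ℕ} (τ : ℝ → HSpace n) (p : HSpace n) : ℝ :=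
  limUnder atTop fun s : ℝ => s - hdist p (τ s)

/-- The (closed) horoball `HB_e(y)` around the ideal point `e` whose boundary passes through `y`: the
superlevel set through `y` of the Busemann function of a geodesic ray tending to `e` (the Busemann
functions of two such rays differ by a constant). -/
def horoball {n : ℕ} (e : IdealPoint n) (y : HSpace n) : Set (HSpace n) :=
  {z | ∀ τ : ℝ → HSpace n, IsGeodesicRay τ → TendsToIdeal τ e → busemann τ y ≤ busemann τ z}

/-- The Poisson distribution with mean `m ∈ [0, ∞]`; mean `∞` means that the value is `∞`
almost surely. -/
def poissonLaw (m : ℝ≥0∞) : Measure ℕ∞ :=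
  if m = ∞ then Measure.dirac ⊤ else (poissonMeasure m.toNNReal).map (Nat.cast : ℕ → ℕ∞)

/-- `η` is a Poisson process on `ℍ^d` with intensity measure `μ`, viewed as a random locally finite
subset. -/
structure IsPoissonProcess {n : ℕ} {Ω : Type*} [MeasurableSpace Ω] (P : Measure Ω)
    (η : Ω → Set (HSpace n)) (μ : Measure (HSpace n)) : Prop where
  locallyFinite : ∀ ω x r, (η ω ∩ hball x r).Finite
  measurable_count : ∀ B, MeasurableSet B → Measurable fun ω => (η ω ∩ B).encard
  map_count : ∀ B, MeasurableSet B → P.map (fun ω => (η ω ∩ B).encard) = poissonLaw (μ B)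
  indep_count : ∀ (k : ℕ) (B : Fin k → Set (HSpace n)), (∀ i, MeasurableSet (B i)) →
    Pairwise (fun i j => Disjoint (B i) (B j)) →
    iIndepFun (fun i ω => (η ω ∩ B i).encard) P

/-- The distance from `x` to its nearest point in `S`, the minimum of `hdist x` over `S`
(which exists if `S` is non-empty and locally finite). -/
def nearestDist {n : ℕ} (x : HSpace n) (S : Set (HSpace n)) : ℝ := sInf (hdist x '' S)

/-- `ℓ(x, ξ)`: the length of the edge from `x` to its radial nearest neighbour in the radial spanning
tree on `ξ ∪ {o}` with base point `o`. -/
def radialLength {n : ℕ} (o : HSpace n) (ξ : Set (HSpace n)) (x : HSpace n) : ℝ :=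
  nearestDist x {y | y ∈ ξ ∪ {o} ∧ hdist o y < hdist o x}

/-- The edge-length functional `L_R^(α) = ∑_{x ∈ ξ ∩ B(o, R)} ℓ(x, ξ)^α`. -/
def edgeLengthFunctional {n : ℕ} (o : HSpace n) (α R : ℝ) (ξ : Set (HSpace n)) : ℝ :=
  ∑ᶠ x ∈ ξ ∩ hball o R, radialLength o ξ x ^ α

/-- The length of the edge that starts at the vertex `y` in the directed spanning forest on `ξ`
toward `e`: the distance from `y` to its nearest neighbour among the points `z ≠ y` of `ξ` in the
horoball `HB_e(y)`. -/
def directedLength {n : ℕ} (e : IdealPoint n) (ξ : Set (HSpace n)) (y : HSpace n) : ℝ :=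
  nearestDist y {z | z ∈ ξ ∧ z ≠ y ∧ z ∈ horoball e y}

/-- `ℓ_e(y)`, in the directed spanning forest on `ξ ∪ {y}`. -/
def ell {n : ℕ} (e : IdealPoint n) (ξ : Set (HSpace n)) (y : HSpace n) : ℝ :=
  directedLength e (ξ ∪ {y}) y

/-- `ℓ_e^(x)(y)`, in the directed spanning forest on `ξ ∪ {y, x}`. -/
def ellWith {n : ℕ} (e : IdealPoint n) (ξ : Set (HSpace n)) (x y : HSpace n) : ℝ :=
  directedLength e (ξ ∪ {y, x}) y

/-- The covariance term
`E[ℓ_e^(y)(o)^α ℓ_e^(o)(y)^α] - E[ℓ_e(o)^α] E[ℓ_e(y)^α]`. -/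
def covTerm {n : ℕ} {Ω : Type*} [MeasurableSpace Ω] (P : Measure Ω) (η : Ω → Set (HSpace n))
    (e : IdealPoint n) (α : ℝ) (o y : HSpace n) : ℝ :=
  (∫ ω, ellWith e (η ω) y o ^ α * ellWith e (η ω) o y ^ α ∂P)
    - (∫ ω, ell e (η ω) o ^ α ∂P) * ∫ ω, ell e (η ω) y ^ α ∂P

end HypRST

end

/-! Both structures are handled at once through a level function `b`: minus the distance to the root
(`radLev o`) for the radial tree, the Busemann function up to a constant (`lev e`) for the directed
forest. Off null sets, the edge at `x` has length at least `s > 0` iff `region b x s`, the part of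
the ball around `x` of radius `s` on strictly higher levels, contains no vertex. Hence all moments
of edge lengths are integrals of void probabilities (`momOne`, `momTwo`), that is, of explicit
functions of volumes of regions, and no convergence of random objects is needed.

Variance. The Mecke formulas `mecke_one` and `mecke_two` write the variance as the double integral
of the covariance kernel `covKer` over the ball plus a diagonal term. The kernel is symmetric, and a
point closer to `o` than `x` lies in `B(o, R)` as soon as `x` does. So the variance is exactly the
integral over `B(o, R)` of a function `varDensity` that does not depend on `R`
(`variance_edgeLengthFunctional`). After division by the volume it is a ball average, and since the
volume of balls tends to infinity it suffices that `varDensity` is bounded almost everywhere and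
converges at infinity (`tendsto_ball_average`).

Convergence. By two-point homogeneity (`exists_isom_of_hdist_eq`) the density depends only on the
distance between centre and point. So the point can be kept at `o` while the centre escapes to `e`
along a geodesic ray (`tendsto_of_isom_invariant`); any `e` serves, so the limit cannot depend on
`e`. Along the ray, differences of distances converge to differences of Busemann functions
(`tendsto_hdist_sub`), radial regions converge to directed ones off null horospheres, and dominated
convergence gives `tendsto_momOne`, `tendsto_momTwo` and `tendsto_covInt`.

Domination. The lens `B(x, s) ∩ B(c, d(c, x))` contains a ball of radius `s / 2`, which bounds the
tails uniformly (`tailBound_radLev`). If `s + t ≤ d(x, y)`, the two regions are disjoint and the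
void probability factorises; otherwise `max s t > d(x, y) / 2` and everything is small. Thus
`covKer` is bounded by a constant times `exp (-(γ / 2) V(d(x, y) / 4))` (`abs_covKer_le`). This is
integrable in every dimension, because `V(4 r + 4) ≤ C V(r) ^ 4` for `r ≥ 1` and `V` grows at least
linearly. -/

noncomputable section

namespace HypRST

variable {n : ℕ}

/-! ### The hyperbolic distance -/

/-- The unit vector in the direction of the last coordinate. -/
def vert (n : ℕ) : EuclideanSpace ℝ (Fin (n + 1)) := EuclideanSpace.single (Fin.last n) 1

lemma norm_vert : ‖vert n‖ = 1 := by simp [vert]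

lemma inner_vert (z : EuclideanSpace ℝ (Fin (n + 1))) : inner ℝ z (vert n) = z (Fin.last n) := by
  simp [vert, EuclideanSpace.inner_single_right]

lemma vert_last : vert n (Fin.last n) = 1 := by simp [vert]

lemma height_pos (x : HSpace n) : 0 < height x := x.2

lemma height_def (x : HSpace n) : height x = x.1 (Fin.last n) := rfl

lemma continuous_height : Continuous (height (n := n)) := by
  unfold height
  fun_prop

lemma one_le_arg (x y : HSpace n) : 1 ≤ 1 + ‖x.1 - y.1‖ ^ 2 / (2 * height x * height y) := by
  have := height_pos x
  have := height_pos y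
  have : 0 ≤ ‖x.1 - y.1‖ ^ 2 / (2 * height x * height y) := by positivity
  linarith

lemma cosh_hdist (x y : HSpace n) :
    Real.cosh (hdist x y) = 1 + ‖x.1 - y.1‖ ^ 2 / (2 * height x * height y) :=
  Real.cosh_arcosh (one_le_arg x y)

lemma hdist_nonneg (x y : HSpace n) : 0 ≤ hdist x y := Real.arcosh_nonneg (one_le_arg x y)

lemma hdist_comm (x y : HSpace n) : hdist x y = hdist y x := by
  unfold hdist
  rw [norm_sub_rev, mul_right_comm]

@[simp] lemma hdist_self (x : HSpace n) : hdist x x = 0 := by simp [hdist]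

lemma hdist_eq_zero_iff {x y : HSpace n} : hdist x y = 0 ↔ x = y := by
  have := height_pos x
  have := height_pos y
  rw [hdist, Real.arcosh_eq_zero_iff (one_le_arg x y)]
  constructor
  · intro h
    have h1 : ‖x.1 - y.1‖ ^ 2 / (2 * height x * height y) = 0 := by linarith
    rw [div_eq_zero_iff] at h1
    rcases h1 with h1 | h1
    · have := pow_eq_zero_iff (two_ne_zero) |>.1 h1
      exact Subtype.ext (sub_eq_zero.1 (norm_eq_zero.1 this))
    · exact absurd h1 (by positivity)
  · rintro rfl
    simp

lemma hdist_pos {x y : HSpace n} (h : x ≠ y) : 0 < hdist x y :=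
  lt_of_le_of_ne (hdist_nonneg x y) fun h' => h (hdist_eq_zero_iff.1 h'.symm)

lemma hdist_lt_iff {x y : HSpace n} {r : ℝ} (hr : 0 ≤ r) :
    hdist x y < r ↔ 1 + ‖x.1 - y.1‖ ^ 2 / (2 * height x * height y) < Real.cosh r := by
  rw [← cosh_hdist, Real.cosh_lt_cosh, abs_of_nonneg (hdist_nonneg x y), abs_of_nonneg hr]

lemma continuous_hdist : Continuous fun p : HSpace n × HSpace n => hdist p.1 p.2 := by
  unfold hdist
  refine Real.continuousOn_arcosh.comp_continuous ?_ fun p => one_le_arg p.1 p.2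
  have h1 : Continuous fun p : HSpace n × HSpace n => height p.1 :=
    continuous_height.comp continuous_fst
  have h2 : Continuous fun p : HSpace n × HSpace n => height p.2 :=
    continuous_height.comp continuous_snd
  refine continuous_const.add (Continuous.div (by fun_prop) (by fun_prop) fun p => ?_)
  have := height_pos p.1
  have := height_pos p.2
  positivity

lemma measurable_hdist : Measurable fun p : HSpace n × HSpace n => hdist p.1 p.2 :=
  continuous_hdist.measurable

lemma continuous_hdist_right (x : HSpace n) : Continuous (hdist x) :=
  continuous_hdist.comp (f := fun y => (x, y)) (by fun_prop)

lemma isOpen_hball (x : HSpace n) (r : ℝ) : IsOpen (hball x r) :=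
  isOpen_lt (continuous_hdist_right x) continuous_const

lemma measurableSet_hball (x : HSpace n) (r : ℝ) : MeasurableSet (hball x r) :=
  (isOpen_hball x r).measurableSet

/-- The mirror image of a point in the boundary hyperplane. -/
def mirror (w : HSpace n) : EuclideanSpace ℝ (Fin (n + 1)) := w.1 - (2 * height w) • vert n

lemma norm_sub_mirror_sq (z w : HSpace n) :
    ‖z.1 - mirror w‖ ^ 2 = ‖z.1 - w.1‖ ^ 2 + 4 * height z * height w := by
  have : z.1 - mirror w = (z.1 - w.1) + (2 * height w) • vert n := by
    unfold mirror; abel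
  rw [this, norm_add_sq_real, inner_smul_right, inner_vert, norm_smul, norm_vert]
  have h3 : (z.1 - w.1) (Fin.last n) = height z - height w := rfl
  rw [h3, mul_one, Real.norm_eq_abs, sq_abs]
  ring

/-- At half the distance the metric becomes a quotient of a Euclidean distance by square roots of
heights. The cosine analogue has the same shape with `w` reflected in the boundary hyperplane, which
makes the addition formula for `sinh` a Euclidean statement. -/
lemma sinh_half_hdist (z w : HSpace n) :
    Real.sinh (hdist z w / 2) = dist z.1 w.1 / (2 * √(height z * height w)) := by
  have hz := height_pos z
  have hw := height_pos w
  rw [← sq_eq_sq₀ (Real.sinh_nonneg_iff.2 (by linarith [hdist_nonneg z w])) (by positivity)]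
  have h := cosh_hdist z w
  have h2 : Real.cosh (hdist z w) = 1 + 2 * Real.sinh (hdist z w / 2) ^ 2 := by
    have := Real.cosh_two_mul (hdist z w / 2)
    rw [show 2 * (hdist z w / 2) = hdist z w by ring] at this
    rw [this, Real.cosh_sq]; ring
  rw [div_pow, mul_pow, Real.sq_sqrt (by positivity), dist_eq_norm]
  have h4 : 2 * Real.sinh (hdist z w / 2) ^ 2 = ‖z.1 - w.1‖ ^ 2 / (2 * height z * height w) := by
    linarith
  have h5 : Real.sinh (hdist z w / 2) ^ 2 = ‖z.1 - w.1‖ ^ 2 / (2 * height z * height w) / 2 := by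
    linarith
  rw [h5]
  field_simp

lemma cosh_half_hdist (z w : HSpace n) :
    Real.cosh (hdist z w / 2) = dist z.1 (mirror w) / (2 * √(height z * height w)) := by
  have hz := height_pos z
  have hw := height_pos w
  rw [← sq_eq_sq₀ (Real.cosh_pos _).le (by positivity), Real.cosh_sq', sinh_half_hdist, div_pow,
    div_pow, mul_pow, Real.sq_sqrt (by positivity), dist_eq_norm, dist_eq_norm, norm_sub_mirror_sq]
  field_simp
  ring

lemma dist_mirror_comm (z w : HSpace n) : dist z.1 (mirror w) = dist w.1 (mirror z) := by
  rw [dist_eq_norm, dist_eq_norm, ← sq_eq_sq₀ (norm_nonneg _) (norm_nonneg _),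
    norm_sub_mirror_sq, norm_sub_mirror_sq, norm_sub_rev w.1 z.1]
  ring

lemma dist_self_mirror (w : HSpace n) : dist w.1 (mirror w) = 2 * height w := by
  have := height_pos w
  rw [dist_eq_norm, ← sq_eq_sq₀ (norm_nonneg _) (by positivity), norm_sub_mirror_sq]
  simp
  ring

/-- After the addition formula for `sinh`, the claim is Ptolemy's inequality for the four points
`a`, `b`, `c` and the mirror image of `b`. -/
lemma hdist_triangle (a b c : HSpace n) : hdist a c ≤ hdist a b + hdist b c := by
  have ha := height_pos a
  have hb := height_pos b
  have hc := height_pos c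
  suffices h : Real.sinh (hdist a c / 2) ≤ Real.sinh (hdist a b / 2 + hdist b c / 2) by
    have := Real.sinh_le_sinh.1 h
    linarith
  rw [Real.sinh_add, sinh_half_hdist, sinh_half_hdist, sinh_half_hdist, cosh_half_hdist,
    cosh_half_hdist, dist_mirror_comm b c]
  have key := EuclideanGeometry.mul_dist_le_mul_dist_add_mul_dist a.1 b.1 c.1 (mirror b)
  rw [dist_self_mirror] at key
  rw [Real.sqrt_mul ha.le, Real.sqrt_mul ha.le, Real.sqrt_mul hb.le]
  have h1 := Real.sqrt_pos.2 ha
  have h2 := Real.sqrt_pos.2 hb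
  have h3 := Real.sqrt_pos.2 hc
  have h4 := Real.mul_self_sqrt hb.le
  have h5 : dist a.1 b.1 / (2 * (√(height a) * √(height b))) *
        (dist c.1 (mirror b) / (2 * (√(height b) * √(height c)))) +
      dist a.1 (mirror b) / (2 * (√(height a) * √(height b))) *
        (dist b.1 c.1 / (2 * (√(height b) * √(height c)))) =
      (dist a.1 b.1 * dist c.1 (mirror b) + dist b.1 c.1 * dist a.1 (mirror b)) /
        (2 * height b) / (2 * (√(height a) * √(height c))) := by
    have h6 : ∀ A B C D : ℝ, A / (2 * (√(height a) * √(height b))) *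
        (B / (2 * (√(height b) * √(height c)))) + C / (2 * (√(height a) * √(height b))) *
        (D / (2 * (√(height b) * √(height c)))) = (A * B + D * C) /
        (2 * (√(height b) * √(height b))) / (2 * (√(height a) * √(height c))) := by
      intro A B C D
      field_simp
    rw [h6, h4]
  rw [h5]
  gcongr
  rw [le_div_iff₀ (by positivity)]
  exact key

lemma mem_hball {x y : HSpace n} {r : ℝ} : y ∈ hball x r ↔ hdist x y < r := Iff.rfl

lemma hball_subset_hball {x y : HSpace n} {r s : ℝ} (h : hdist y x + r ≤ s) :
    hball x r ⊆ hball y s := fun z hz => by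
  have := hdist_triangle y x z
  rw [mem_hball] at *
  linarith

lemma disjoint_hball {x y : HSpace n} {r s : ℝ} (h : r + s ≤ hdist x y) :
    Disjoint (hball x r) (hball y s) := by
  rw [Set.disjoint_left]
  intro z hz hz'
  have := hdist_triangle x z y
  rw [hdist_comm z y] at this
  rw [mem_hball] at *
  linarith

/-- A point with given horizontal part and height. -/
def vpt (a : EuclideanSpace ℝ (Fin (n + 1))) (h : ℝ) (ha : a (Fin.last n) = 0) (hh : 0 < h) :
    HSpace n := ⟨a + h • vert n, by simp [ha, vert_last, hh]⟩

lemma height_vpt (a : EuclideanSpace ℝ (Fin (n + 1))) (h : ℝ) (ha : a (Fin.last n) = 0)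
    (hh : 0 < h) : height (vpt a h ha hh) = h := by
  simp [height, vpt, ha, vert_last]

lemma hdist_vpt (a : EuclideanSpace ℝ (Fin (n + 1))) (s t : ℝ) (ha : a (Fin.last n) = 0) :
    hdist (vpt a (Real.exp s) ha (Real.exp_pos s)) (vpt a (Real.exp t) ha (Real.exp_pos t)) =
      |s - t| := by
  have h : Real.cosh (hdist (vpt a (Real.exp s) ha (Real.exp_pos s))
      (vpt a (Real.exp t) ha (Real.exp_pos t))) = Real.cosh |s - t| := by
    rw [cosh_hdist, height_vpt, height_vpt, Real.cosh_abs, Real.cosh_eq]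
    have : (vpt a (Real.exp s) ha (Real.exp_pos s)).1 - (vpt a (Real.exp t) ha (Real.exp_pos t)).1
        = (Real.exp s - Real.exp t) • vert n := by
      simp [vpt, sub_smul]
    rw [this, norm_smul, norm_vert, mul_one, Real.norm_eq_abs, sq_abs, neg_sub, Real.exp_sub,
      Real.exp_sub]
    have := Real.exp_pos s
    have := Real.exp_pos t
    field_simp
    ring
  exact Real.cosh_injOn (hdist_nonneg _ _) (Set.mem_Ici.2 (abs_nonneg _)) h

/-! ### Volume-preserving isometries -/

lemma measurableSet_upperHalf :
    MeasurableSet {x : EuclideanSpace ℝ (Fin (n + 1)) | 0 < x (Fin.last n)} :=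
  measurableSet_lt measurable_const (by fun_prop)

lemma hvol_apply {B : Set (HSpace n)} (hB : MeasurableSet B) :
    hvol n B = ∫⁻ x in Subtype.val '' B, ENNReal.ofReal (1 / x (Fin.last n) ^ (n + 1)) := by
  rw [hvol, withDensity_apply _ hB]
  exact setLIntegral_subtype measurableSet_upperHalf B
    fun x => ENNReal.ofReal (1 / x (Fin.last n) ^ (n + 1))

/-- Measurable automorphisms of the hyperbolic space preserving distance and volume. -/
structure IsIsom (φ : HSpace n ≃ᵐ HSpace n) : Prop where
  measurePreserving : MeasurePreserving φ (hvol n) (hvol n)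
  hdist_map : ∀ x y, hdist (φ x) (φ y) = hdist x y

lemma IsIsom.trans {φ ψ : HSpace n ≃ᵐ HSpace n} (h : IsIsom φ) (h' : IsIsom ψ) :
    IsIsom (φ.trans ψ) where
  measurePreserving := h'.measurePreserving.comp h.measurePreserving
  hdist_map x y := by simp [h.hdist_map, h'.hdist_map]

/-- An involution of `ℝ^(n+1)` preserving the upper half-space that is conformal with the factor
required by the hyperbolic metric induces an isometry. -/
lemma exists_isom_of_involutive
    (F : EuclideanSpace ℝ (Fin (n + 1)) → EuclideanSpace ℝ (Fin (n + 1)))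
    (F' : EuclideanSpace ℝ (Fin (n + 1)) →
      EuclideanSpace ℝ (Fin (n + 1)) →L[ℝ] EuclideanSpace ℝ (Fin (n + 1)))
    (hpos : ∀ x, 0 < x (Fin.last n) → 0 < F x (Fin.last n))
    (hinv : ∀ x, 0 < x (Fin.last n) → F (F x) = x)
    (hder : ∀ x, 0 < x (Fin.last n) → HasFDerivAt F (F' x) x)
    (hdet : ∀ x, 0 < x (Fin.last n) →
      |(F' x).det| = (F x (Fin.last n) / x (Fin.last n)) ^ (n + 1))
    (hdist : ∀ x y, 0 < x (Fin.last n) → 0 < y (Fin.last n) →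
      ‖F x - F y‖ ^ 2 / (F x (Fin.last n) * F y (Fin.last n)) =
        ‖x - y‖ ^ 2 / (x (Fin.last n) * y (Fin.last n))) :
    ∃ φ : HSpace n ≃ᵐ HSpace n, IsIsom φ ∧ ∀ x, (φ x).1 = F x.1 := by
  let f : HSpace n → HSpace n := fun x => ⟨F x.1, hpos x.1 x.2⟩
  have hff : Function.Involutive f := fun x => Subtype.ext (hinv x.1 x.2)
  have hcont : Continuous f := by
    refine Continuous.subtype_mk (continuous_iff_continuousAt.2 fun x => ?_) _
    exact (hder x.1 x.2).continuousAt.comp continuous_subtype_val.continuousAt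
  have hmf : Measurable f := hcont.measurable
  let φ : HSpace n ≃ᵐ HSpace n := ⟨hff.toPerm f, hmf, hmf⟩
  refine ⟨φ, ⟨⟨hmf, ?_⟩, ?_⟩, fun x => rfl⟩
  · ext B hB
    rw [Measure.map_apply φ.measurable hB]
    have h1 : φ ⁻¹' B = f '' B := (congrFun hff.image_eq_preimage_symm B).symm
    have h2 : Subtype.val '' (f '' B) = F '' (Subtype.val '' B) := by
      rw [Set.image_image, Set.image_image]
    have hsub : ∀ x ∈ (Subtype.val '' B : Set (EuclideanSpace ℝ (Fin (n + 1)))),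
        0 < x (Fin.last n) := by
      rintro _ ⟨x, -, rfl⟩
      exact x.2
    have hmeas : MeasurableSet (Subtype.val '' B : Set (EuclideanSpace ℝ (Fin (n + 1)))) :=
      (MeasurableEmbedding.subtype_coe measurableSet_upperHalf).measurableSet_image.2 hB
    -- Change of variables: the Jacobian is the height ratio to the power `n + 1`, which turns the
    -- density at the image point into the density at the original one.
    rw [hvol_apply (φ.measurable hB), h1, h2, hvol_apply hB,
      lintegral_image_eq_lintegral_abs_det_fderiv_mul volume hmeas
        (fun x hx => (hder x (hsub x hx)).hasFDerivWithinAt)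
        (fun x hx y hy hxy => by rw [← hinv x (hsub x hx), hxy, hinv y (hsub y hy)])]
    refine setLIntegral_congr_fun hmeas fun x hx => ?_
    have hx0 := hsub x hx
    have hx1 := hpos x hx0
    simp only
    rw [hdet x hx0, ← ENNReal.ofReal_mul (by positivity)]
    congr 1
    rw [div_pow]
    field_simp
  · intro x y
    have := hdist x.1 y.1 x.2 y.2
    have hx := x.2
    have hy := y.2
    have hx' := hpos x.1 x.2
    have hy' := hpos y.1 y.2
    show HypRST.hdist (f x) (f y) = HypRST.hdist x y
    unfold HypRST.hdist height
    congr 2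
    have e1 : ∀ a b c : ℝ, a / (2 * b * c) = a / (b * c) / 2 := by
      intro a b c
      rw [div_div]; congr 1; ring
    rw [e1, e1]
    congr 1

lemma abs_det_smul_reflection {F : Type*} [NormedAddCommGroup F] [InnerProductSpace ℝ F]
    [FiniteDimensional ℝ F] (a : ℝ) (v : F) :
    |(a • ((ℝ ∙ v)ᗮ.reflection : F →L[ℝ] F)).det| = |a| ^ Module.finrank ℝ F := by
  have h2 : LinearMap.det (((ℝ ∙ v)ᗮ.reflection : F →L[ℝ] F) : F →ₗ[ℝ] F) =
      LinearMap.det (ℝ ∙ v)ᗮ.reflection.toLinearMap := rfl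
  rw [ContinuousLinearMap.det, ContinuousLinearMap.toLinearMap_smul, LinearMap.det_smul, abs_mul,
    h2, Submodule.det_reflection, abs_pow, abs_pow]
  simp

lemma abs_det_reflection {F : Type*} [NormedAddCommGroup F] [InnerProductSpace ℝ F]
    [FiniteDimensional ℝ F] (v : F) : |((ℝ ∙ v)ᗮ.reflection : F →L[ℝ] F).det| = 1 := by
  simpa using abs_det_smul_reflection 1 v

/-- With centre on the boundary hyperplane, an inversion multiplies heights by the same factor `(ρ /
dist x c) ^ 2` by which its derivative scales a reflection, so it is conformal with the required
factor. -/
lemma exists_isom_inversion (c : EuclideanSpace ℝ (Fin (n + 1))) (hc : c (Fin.last n) = 0)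
    (ρ : ℝ) (hρ : 0 < ρ) :
    ∃ φ : HSpace n ≃ᵐ HSpace n, IsIsom φ ∧ ∀ x, (φ x).1 = EuclideanGeometry.inversion c ρ x.1 := by
  have hne : ∀ x : EuclideanSpace ℝ (Fin (n + 1)), 0 < x (Fin.last n) → x ≠ c := by
    rintro x hx rfl
    exact hx.ne' hc
  have hd : ∀ x : EuclideanSpace ℝ (Fin (n + 1)), 0 < x (Fin.last n) → 0 < dist x c :=
    fun x hx => dist_pos.2 (hne x hx)
  have hlast : ∀ x : EuclideanSpace ℝ (Fin (n + 1)),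
      EuclideanGeometry.inversion c ρ x (Fin.last n) = (ρ / dist x c) ^ 2 * x (Fin.last n) := by
    intro x
    simp [EuclideanGeometry.inversion, hc]
  refine exists_isom_of_involutive _
    (fun x => (ρ / dist x c) ^ 2 • ((ℝ ∙ (x - c))ᗮ.reflection :
      EuclideanSpace ℝ (Fin (n + 1)) →L[ℝ] EuclideanSpace ℝ (Fin (n + 1)))) ?_ ?_ ?_ ?_ ?_
  · intro x hx
    rw [hlast]
    have := hd x hx
    positivity
  · intro x _
    exact EuclideanGeometry.inversion_inversion c hρ.ne' x
  · intro x hx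
    exact EuclideanGeometry.hasFDerivAt_inversion (hne x hx)
  · intro x hx
    rw [abs_det_smul_reflection, hlast, abs_of_nonneg (by positivity), finrank_euclideanSpace_fin]
    congr 1
    field_simp
  · intro x y hx hy
    have h1 := hd x hx
    have h2 := hd y hy
    rw [← dist_eq_norm, ← dist_eq_norm,
      EuclideanGeometry.dist_inversion_inversion (hne x hx) (hne y hy), hlast, hlast]
    field_simp

lemma exists_isom_reflection (m u : EuclideanSpace ℝ (Fin (n + 1))) (hu : u (Fin.last n) = 0) :
    ∃ φ : HSpace n ≃ᵐ HSpace n, IsIsom φ ∧ ∀ x, (φ x).1 = (ℝ ∙ u)ᗮ.reflection (x.1 - m) + m := by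
  have hlast : ∀ x : EuclideanSpace ℝ (Fin (n + 1)),
      ((ℝ ∙ u)ᗮ.reflection (x - m) + m) (Fin.last n) = x (Fin.last n) := by
    intro x
    rw [Submodule.reflection_orthogonal_apply, Submodule.reflection_singleton_apply]
    simp [hu]
  refine exists_isom_of_involutive (fun x => (ℝ ∙ u)ᗮ.reflection (x - m) + m)
    (fun _ => ((ℝ ∙ u)ᗮ.reflection :
      EuclideanSpace ℝ (Fin (n + 1)) →L[ℝ] EuclideanSpace ℝ (Fin (n + 1)))) ?_ ?_ ?_ ?_ ?_
  · intro x hx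
    simp only [hlast]
    exact hx
  · intro x _
    simp
  · intro x _
    have := ((ℝ ∙ u)ᗮ.reflection : EuclideanSpace ℝ (Fin (n + 1)) →L[ℝ]
      EuclideanSpace ℝ (Fin (n + 1))).hasFDerivAt (x := x - m)
    exact (this.comp x ((hasFDerivAt_id x).sub_const m)).add_const m
  · intro x hx
    rw [abs_det_reflection, hlast, div_self hx.ne', one_pow]
  · intro x y _ _
    simp only [hlast]
    rw [add_sub_add_right_eq_sub, ← map_sub, LinearIsometryEquiv.norm_map,
      sub_sub_sub_cancel_right]

/-- The bisector of two points is the fixed set of an isometry exchanging them. -/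
lemma exists_isom_swap (p q : HSpace n) : ∃ φ : HSpace n ≃ᵐ HSpace n, IsIsom φ ∧ φ p = q ∧
    ∀ z, hdist z p = hdist z q → φ z = z := by
  have hp := height_pos p
  have hq := height_pos q
  have hz : ∀ z, hdist z p = hdist z q →
      ‖z.1 - p.1‖ ^ 2 * height q = ‖z.1 - q.1‖ ^ 2 * height p := by
    intro z h
    have h' := congrArg Real.cosh h
    rw [cosh_hdist, cosh_hdist] at h'
    have := height_pos z
    field_simp at h'
    linarith
  -- The bisector is a vertical hyperplane when the heights agree, and otherwise a hemisphere
  -- centred on the boundary; the isometry is the reflection or the inversion in it.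
  by_cases hh : height p = height q
  · obtain ⟨φ, hφ, hφx⟩ := exists_isom_reflection ((1 / 2 : ℝ) • (p.1 + q.1)) (p.1 - q.1)
      (show height p - height q = 0 by linarith)
    refine ⟨φ, hφ, Subtype.ext ?_, fun z h => Subtype.ext ?_⟩
    · rw [hφx]
      have : p.1 - (1 / 2 : ℝ) • (p.1 + q.1) = (1 / 2 : ℝ) • (p.1 - q.1) := by module
      rw [this, map_smul, Submodule.reflection_orthogonalComplement_singleton_eq_neg]
      module
    · rw [hφx, ← eq_sub_iff_add_eq, Submodule.reflection_eq_self_iff,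
        Submodule.mem_orthogonal_singleton_iff_inner_right]
      have h1 := hz z h
      rw [hh] at h1
      have h2 := mul_right_cancel₀ hq.ne' h1
      have e1 : p.1 - q.1 = (z.1 - q.1) - (z.1 - p.1) := by abel
      have e2 : z.1 - (1 / 2 : ℝ) • (p.1 + q.1) = (1 / 2 : ℝ) • ((z.1 - q.1) + (z.1 - p.1)) := by
        module
      rw [e1, e2, inner_smul_right, inner_add_right,
        inner_sub_left (z.1 - q.1) (z.1 - p.1), inner_sub_left (z.1 - q.1) (z.1 - p.1),
        real_inner_self_eq_norm_sq, real_inner_self_eq_norm_sq, h2,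
        real_inner_comm (z.1 - q.1) (z.1 - p.1)]
      ring
  · have hne : height p - height q ≠ 0 := sub_ne_zero.2 hh
    have hpq : p.1 ≠ q.1 := fun h => hh (by rw [height_def, h, height_def])
    have hd : 0 < ‖p.1 - q.1‖ := norm_pos_iff.2 (sub_ne_zero.2 hpq)
    set δ := (height p - height q)⁻¹ with hδ
    have hδ1 : δ * (height p - height q) = 1 := inv_mul_cancel₀ hne
    -- The point at height zero on the Euclidean line through `p` and `q`.
    set c : EuclideanSpace ℝ (Fin (n + 1)) := δ • (height p • q.1 - height q • p.1) with hc
    have hc0 : c (Fin.last n) = 0 := by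
      have : c (Fin.last n) = δ * (height p * height q - height q * height p) := rfl
      rw [this]; ring
    have hpc : p.1 - c = (δ * height p) • (p.1 - q.1) := by
      have : p.1 = (δ * (height p - height q)) • p.1 := by rw [hδ1, one_smul]
      rw [hc]; nth_rewrite 1 [this]
      module
    have hzc : ∀ z : HSpace n, z.1 - c = δ • (height p • (z.1 - q.1) - height q • (z.1 - p.1)) := by
      intro z
      have : z.1 = (δ * (height p - height q)) • z.1 := by rw [hδ1, one_smul]
      rw [hc]; nth_rewrite 1 [this]
      module
    -- The radius is the geometric mean of the Euclidean distances from `c` to `p` and to `q`, so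
    -- the inversion exchanges them.
    set ρ := √(δ ^ 2 * height p * height q * ‖p.1 - q.1‖ ^ 2) with hρ
    have hδ0 : δ ≠ 0 := inv_ne_zero hne
    have hρ0 : 0 < ρ := Real.sqrt_pos.2 (by positivity)
    have hρ2 : ρ ^ 2 = δ ^ 2 * height p * height q * ‖p.1 - q.1‖ ^ 2 :=
      Real.sq_sqrt (by positivity)
    obtain ⟨φ, hφ, hφx⟩ := exists_isom_inversion c hc0 ρ hρ0
    refine ⟨φ, hφ, Subtype.ext ?_, fun z h => Subtype.ext ?_⟩
    · rw [hφx, EuclideanGeometry.inversion, vsub_eq_sub, vadd_eq_add, dist_eq_norm, div_pow, hρ2,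
        hpc, norm_smul, mul_pow, Real.norm_eq_abs, sq_abs, smul_smul]
      have : δ ^ 2 * height p * height q * ‖p.1 - q.1‖ ^ 2 /
          ((δ * height p) ^ 2 * ‖p.1 - q.1‖ ^ 2) * (δ * height p) = δ * height q := by
        field_simp
      rw [this]
      have e : q.1 = (δ * (height p - height q)) • q.1 := by rw [hδ1, one_smul]
      nth_rewrite 2 [e]
      rw [hc]
      module
    · rw [hφx]
      apply EuclideanGeometry.inversion_of_mem_sphere
      rw [Metric.mem_sphere, dist_eq_norm, ← sq_eq_sq₀ (norm_nonneg _) hρ0.le, hρ2, hzc, norm_smul,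
        mul_pow, Real.norm_eq_abs, sq_abs, norm_sub_sq_real, inner_smul_left, inner_smul_right,
        norm_smul, norm_smul, mul_pow, mul_pow, Real.norm_eq_abs, Real.norm_eq_abs, sq_abs, sq_abs]
      have h1 := hz z h
      have h2 : ‖p.1 - q.1‖ ^ 2 = ‖z.1 - q.1‖ ^ 2 - 2 * inner ℝ (z.1 - q.1) (z.1 - p.1) +
          ‖z.1 - p.1‖ ^ 2 := by
        rw [← norm_sub_sq_real]
        congr 2
        abel
      rw [h2]
      simp only [conj_trivial]
      linear_combination (δ ^ 2 * height q - δ ^ 2 * height p) * h1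

/-- Two-point homogeneity. -/
lemma exists_isom_of_hdist_eq {a b a' b' : HSpace n} (h : hdist a b = hdist a' b') :
    ∃ φ : HSpace n ≃ᵐ HSpace n, IsIsom φ ∧ φ a = a' ∧ φ b = b' := by
  obtain ⟨φ, hφ, ha, -⟩ := exists_isom_swap a a'
  -- The second swap moves `φ b` to `b'` and keeps `a'` in place, because `a'` is equidistant from
  -- the two.
  obtain ⟨ψ, hψ, hb, hfix⟩ := exists_isom_swap (φ b) b'
  refine ⟨φ.trans ψ, hφ.trans hψ, ?_, hb⟩
  show ψ (φ a) = a'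
  rw [ha]
  refine hfix a' ?_
  rw [← h, ← hφ.hdist_map a b, ha]

/-! ### Geodesics and volume growth -/

/-- The point above `a` at height `exp t`. -/
def vline (a : EuclideanSpace ℝ (Fin (n + 1))) (ha : a (Fin.last n) = 0) (t : ℝ) : HSpace n :=
  vpt a (Real.exp t) ha (Real.exp_pos t)

lemma hdist_vline (a : EuclideanSpace ℝ (Fin (n + 1))) (ha : a (Fin.last n) = 0) (s t : ℝ) :
    hdist (vline a ha s) (vline a ha t) = |s - t| := hdist_vpt a s t ha

lemma zero_last : (0 : EuclideanSpace ℝ (Fin (n + 1))) (Fin.last n) = 0 := rfl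

/-- A base point. -/
def basePt (n : ℕ) : HSpace n := vline 0 zero_last 0

/-- Vertical lines are geodesics by direct computation; homogeneity transports one of them to the
given pair. -/
lemma exists_between (x c : HSpace n) {s : ℝ} (hs : 0 ≤ s) (hs' : s ≤ hdist x c) :
    ∃ m, hdist x m = s ∧ hdist m c = hdist x c - s := by
  have h : hdist (vline (n := n) 0 zero_last 0) (vline 0 zero_last (hdist x c)) = hdist x c := by
    rw [hdist_vline, zero_sub, abs_neg, abs_of_nonneg (hdist_nonneg x c)]
  obtain ⟨φ, hφ, h1, h2⟩ := exists_isom_of_hdist_eq (n := n) h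
  refine ⟨φ (vline 0 zero_last s), ?_, ?_⟩
  · rw [← h1, hφ.hdist_map, hdist_vline, zero_sub, abs_neg, abs_of_nonneg hs]
  · nth_rewrite 1 [← h2]
    rw [hφ.hdist_map, hdist_vline, abs_sub_comm, abs_of_nonneg (by linarith)]

lemma exists_hdist_eq (x : HSpace n) {t : ℝ} (ht : 0 ≤ t) : ∃ m, hdist x m = t := by
  obtain ⟨φ, hφ, h1, -⟩ := exists_isom_of_hdist_eq (n := n) (a := vline 0 zero_last 0)
    (b := vline 0 zero_last 0) (a' := x) (b' := x) (by simp)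
  refine ⟨φ (vline 0 zero_last t), ?_⟩
  rw [← h1, hφ.hdist_map, hdist_vline, zero_sub, abs_neg, abs_of_nonneg ht]

/-! ### Finiteness, positivity, homogeneity and growth of ball volumes. -/

lemma hvol_eq_zero_of_image {B : Set (HSpace n)}
    (h : volume (Subtype.val '' B : Set (EuclideanSpace ℝ (Fin (n + 1)))) = 0) :
    hvol n B = 0 := by
  refine withDensity_absolutelyContinuous _ _ ?_
  rw [(MeasurableEmbedding.subtype_coe measurableSet_upperHalf).comap_apply]
  exact h

instance : NullSingletonClass (hvol n) := ⟨fun x => hvol_eq_zero_of_image (by simp)⟩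

/-- On the ball, heights stay within a factor `2 * cosh r` of that of the centre and Euclidean
distances stay bounded, so a bounded density is integrated over a Euclidean-bounded set. -/
lemma hvol_hball_lt_top (x : HSpace n) (r : ℝ) : hvol n (hball x r) < ∞ := by
  rw [hvol_apply (measurableSet_hball x r)]
  have hx := height_pos x
  have hC : 1 ≤ Real.cosh r := Real.one_le_cosh r
  have hr : ∀ z ∈ hball x r, ‖x.1 - z.1‖ ^ 2 ≤ 2 * height x * height z * Real.cosh r ∧
      height x ≤ 2 * Real.cosh r * height z ∧ height z ≤ 2 * Real.cosh r * height x := by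
    intro z hz
    have hz0 := height_pos z
    have hr0 : 0 ≤ r := (hdist_nonneg x z).trans (le_of_lt hz)
    have h1 : 1 + ‖x.1 - z.1‖ ^ 2 / (2 * height x * height z) < Real.cosh r :=
      (hdist_lt_iff hr0).1 hz
    have h2 : ‖x.1 - z.1‖ ^ 2 < (Real.cosh r - 1) * (2 * height x * height z) := by
      rw [← div_lt_iff₀ (by positivity)]
      linarith
    have h3 : (height x - height z) ^ 2 ≤ ‖x.1 - z.1‖ ^ 2 := by
      have := PiLp.norm_apply_le (x.1 - z.1) (Fin.last n)
      rw [← sq_abs]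
      exact pow_le_pow_left₀ (abs_nonneg _) this 2
    have hp : 0 < height x * height z := mul_pos hx hz0
    refine ⟨by nlinarith, ?_, ?_⟩
    · by_contra! hlt
      nlinarith
    · by_contra! hlt
      nlinarith
  have hsub : (Subtype.val '' hball x r : Set (EuclideanSpace ℝ (Fin (n + 1)))) ⊆
      Metric.closedBall x.1 (√(4 * (height x * Real.cosh r) ^ 2)) := by
    rintro _ ⟨z, hz, rfl⟩
    obtain ⟨h1, h2, h3⟩ := hr z hz
    have hz0 := height_pos z
    rw [Metric.mem_closedBall, dist_comm, dist_eq_norm]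
    refine Real.le_sqrt_of_sq_le (h1.trans ?_)
    have : 0 < height x * Real.cosh r := by positivity
    nlinarith
  have hfin : volume (Subtype.val '' hball x r : Set (EuclideanSpace ℝ (Fin (n + 1)))) < ∞ :=
    (measure_mono hsub).trans_lt measure_closedBall_lt_top
  have hmeas := (MeasurableEmbedding.subtype_coe (measurableSet_upperHalf (n := n))
    ).measurableSet_image.2 (measurableSet_hball x r)
  calc _ ≤ ∫⁻ _ in (Subtype.val '' hball x r : Set (EuclideanSpace ℝ (Fin (n + 1)))),
        ENNReal.ofReal (1 / (height x / (2 * Real.cosh r)) ^ (n + 1)) := by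
        refine setLIntegral_mono' hmeas ?_
        rintro _ ⟨z, hz, rfl⟩
        obtain ⟨h1, h2, h3⟩ := hr z hz
        refine ENNReal.ofReal_le_ofReal ?_
        refine one_div_le_one_div_of_le (by positivity) ?_
        refine pow_le_pow_left₀ (by positivity) ?_ _
        rw [div_le_iff₀ (by positivity)]
        show height x ≤ height z * (2 * Real.cosh r)
        linarith
    _ < ∞ := by
        rw [setLIntegral_const]
        exact ENNReal.mul_lt_top ENNReal.ofReal_lt_top hfin

lemma hvol_hball_pos (x : HSpace n) {r : ℝ} (hr : 0 < r) : 0 < hvol n (hball x r) := by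
  rw [pos_iff_ne_zero]
  intro h0
  rw [hvol_apply (measurableSet_hball x r)] at h0
  have hmeas := (MeasurableEmbedding.subtype_coe (measurableSet_upperHalf (n := n))
    ).measurableSet_image.2 (measurableSet_hball x r)
  have h0 := (setLIntegral_eq_zero_iff hmeas (f := fun x : EuclideanSpace ℝ (Fin (n + 1)) =>
    ENNReal.ofReal (1 / x (Fin.last n) ^ (n + 1))) (by fun_prop)).1 h0
  have h1 : volume (Subtype.val '' hball x r : Set (EuclideanSpace ℝ (Fin (n + 1)))) = 0 := by
    refine measure_mono_null ?_ h0
    intro z hz hz'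
    have h2 := hz' hz
    obtain ⟨w, hw, rfl⟩ := hz
    have := w.2
    rw [ENNReal.ofReal_eq_zero] at h2
    have : 0 < 1 / w.1 (Fin.last n) ^ (n + 1) := by positivity
    linarith
  have hopen : IsOpen (Subtype.val '' hball x r : Set (EuclideanSpace ℝ (Fin (n + 1)))) := by
    have hU : IsOpen {x : EuclideanSpace ℝ (Fin (n + 1)) | 0 < x (Fin.last n)} :=
      isOpen_lt continuous_const (by fun_prop)
    exact hU.isOpenMap_subtype_val _ (isOpen_hball x r)
  exact (hopen.measure_pos volume ⟨x.1, x, by simpa [mem_hball] using hr, rfl⟩).ne' h1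

lemma iUnion_hball (x : HSpace n) : ⋃ k : ℕ, hball x k = Set.univ := by
  refine Set.eq_univ_of_forall fun z => ?_
  obtain ⟨k, hk⟩ := exists_nat_gt (hdist x z)
  exact Set.mem_iUnion.2 ⟨k, hk⟩

instance : SigmaFinite (hvol n) :=
  ⟨⟨{ set := fun k => hball (basePt n) k
      set_mem := fun _ => trivial
      finite := fun _ => hvol_hball_lt_top _ _
      spanning := iUnion_hball _ }⟩⟩

lemma IsIsom.preimage_hball {φ : HSpace n ≃ᵐ HSpace n} (hφ : IsIsom φ) (x : HSpace n) (r : ℝ) :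
    φ ⁻¹' hball (φ x) r = hball x r := by
  ext z
  simp [mem_hball, hφ.hdist_map]

lemma IsIsom.hvol_preimage {φ : HSpace n ≃ᵐ HSpace n} (hφ : IsIsom φ) (B : Set (HSpace n)) :
    hvol n (φ ⁻¹' B) = hvol n B :=
  hφ.measurePreserving.measure_preimage_equiv B

/-- The volume of a ball of radius `r`. -/
def ballVol (n : ℕ) (r : ℝ) : ℝ := (hvol n (hball (basePt n) r)).toReal

lemma hvol_hball (x : HSpace n) (r : ℝ) : hvol n (hball x r) = ENNReal.ofReal (ballVol n r) := by
  rw [ballVol, ENNReal.ofReal_toReal (hvol_hball_lt_top _ _).ne]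
  obtain ⟨φ, hφ, h1, -⟩ := exists_isom_of_hdist_eq (n := n) (a := x) (b := x) (a' := basePt n)
    (b' := basePt n) (by simp)
  rw [← h1, ← hφ.hvol_preimage (hball (φ x) r), hφ.preimage_hball]

lemma ballVol_nonneg (r : ℝ) : 0 ≤ ballVol n r := ENNReal.toReal_nonneg

lemma ballVol_mono : Monotone (ballVol n) := fun _ _ h =>
  ENNReal.toReal_mono (hvol_hball_lt_top _ _).ne
    (measure_mono (hball_subset_hball (by simpa using h)))

lemma ballVol_pos {r : ℝ} (hr : 0 < r) : 0 < ballVol n r :=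
  ENNReal.toReal_pos (hvol_hball_pos _ hr).ne' (hvol_hball_lt_top _ _).ne

/-- A unit ball centred at distance `t + 1` fits beside the ball of radius `t`, inside the ball of
radius `t + 2`. -/
lemma ballVol_add_two {t : ℝ} (ht : 0 ≤ t) : ballVol n t + ballVol n 1 ≤ ballVol n (t + 2) := by
  obtain ⟨m, hm⟩ := exists_hdist_eq (basePt n) (t := t + 1) (by linarith)
  have h : hvol n (hball (basePt n) t) + hvol n (hball m 1) ≤ hvol n (hball (basePt n) (t + 2)) := by
    rw [← measure_union (disjoint_hball hm.ge) (measurableSet_hball _ _)]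
    refine measure_mono (Set.union_subset (hball_subset_hball ?_) (hball_subset_hball ?_))
    · simp
    · rw [hm]; linarith
  rw [hvol_hball, hvol_hball, hvol_hball,
    ← ENNReal.ofReal_add (ballVol_nonneg _) (ballVol_nonneg _)] at h
  exact (ENNReal.ofReal_le_ofReal_iff (ballVol_nonneg _)).1 h

/-- Linear growth is all that is needed, and all that holds uniformly in the dimension: for `n = 0`
the space is a line. -/
lemma ballVol_linear (t : ℝ) : ballVol n 1 / 2 * (t - 1) ≤ ballVol n t := by
  have h1 := ballVol_pos (n := n) one_pos
  have key : ∀ k : ℕ, (k + 1) * ballVol n 1 ≤ ballVol n (2 * k + 1) := by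
    intro k
    induction k with
    | zero => simp
    | succ k ih =>
      have := ballVol_add_two (n := n) (t := 2 * k + 1) (by positivity)
      push_cast
      rw [show (2 : ℝ) * (k + 1) + 1 = 2 * k + 1 + 2 by ring]
      linarith
  rcases lt_or_ge t 1 with h | h
  · have := ballVol_nonneg (n := n) t
    nlinarith
  · have h2 := Nat.floor_le (a := (t - 1) / 2) (by linarith)
    have h3 := Nat.lt_floor_add_one ((t - 1) / 2)
    have h4 := key ⌊(t - 1) / 2⌋₊
    have h5 : ballVol n (2 * ⌊(t - 1) / 2⌋₊ + 1) ≤ ballVol n t := ballVol_mono (by linarith)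
    nlinarith

/-- Double counting of pairs `(u, z)` with `u ∈ B(p, s + 1)` and `d(u, z) < t + 1`. Each `z ∈ B(p, s
+ t)` has a point `m` within `s` of `p` and within `t` of `z`, and every `u` in the unit ball around
`m` is counted. -/
lemma ballVol_submul {s t : ℝ} (hs : 0 ≤ s) (ht : 0 ≤ t) :
    ballVol n 1 * ballVol n (s + t) ≤ ballVol n (s + 1) * ballVol n (t + 1) := by
  set p := basePt n
  have hmeas : MeasurableSet {q : HSpace n × HSpace n | hdist q.1 q.2 < t + 1} :=
    measurableSet_lt measurable_hdist measurable_const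
  have key : ENNReal.ofReal (ballVol n 1) * hvol n (hball p (s + t)) ≤
      hvol n (hball p (s + 1)) * ENNReal.ofReal (ballVol n (t + 1)) := by
    calc _ = ∫⁻ _ in hball p (s + t), ENNReal.ofReal (ballVol n 1) ∂hvol n := by
          rw [setLIntegral_const]
      _ ≤ ∫⁻ z in hball p (s + t), (∫⁻ u in hball p (s + 1),
            {q : HSpace n × HSpace n | hdist q.1 q.2 < t + 1}.indicator 1 (u, z) ∂hvol n)
              ∂hvol n := by
          refine setLIntegral_mono' (measurableSet_hball _ _) fun z hz => ?_
          have hz' : hdist p z < s + t := hz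
          obtain ⟨m, hm1, hm2⟩ : ∃ m, hdist p m ≤ s ∧ hdist m z ≤ t := by
            rcases le_total s (hdist p z) with h | h
            · obtain ⟨m, h1, h2⟩ := exists_between p z hs h
              exact ⟨m, h1.le, by linarith⟩
            · exact ⟨z, h, by simpa using ht⟩
          rw [← hvol_hball m 1, ← setLIntegral_one,
            ← lintegral_indicator (measurableSet_hball _ _),
            ← lintegral_indicator (measurableSet_hball _ _)]
          refine lintegral_mono fun u => ?_
          refine Set.indicator_le (s := hball m 1) (fun u hu => ?_) u
          have hu' : hdist m u < 1 := hu
          have h1 := hdist_triangle p m u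
          have h2 := hdist_triangle u m z
          rw [hdist_comm u m] at h2
          rw [Set.indicator_of_mem (show u ∈ hball p (s + 1) from
            mem_hball.2 (by linarith)), Set.indicator_of_mem (show (u, z) ∈ {q : HSpace n × HSpace n |
              hdist q.1 q.2 < t + 1} from show hdist u z < t + 1 by linarith)]
          rfl
      _ ≤ ∫⁻ z, (∫⁻ u in hball p (s + 1),
            {q : HSpace n × HSpace n | hdist q.1 q.2 < t + 1}.indicator 1 (u, z) ∂hvol n)
              ∂hvol n := setLIntegral_le_lintegral _ _
      _ = ∫⁻ u in hball p (s + 1), (∫⁻ z,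
            {q : HSpace n × HSpace n | hdist q.1 q.2 < t + 1}.indicator 1 (u, z) ∂hvol n)
              ∂hvol n := by
          refine lintegral_lintegral_swap ?_
          exact ((measurable_one.indicator hmeas).comp measurable_swap).aemeasurable
      _ = ∫⁻ _ in hball p (s + 1), ENNReal.ofReal (ballVol n (t + 1)) ∂hvol n := by
          congr 1
          ext u
          rw [← hvol_hball u (t + 1), ← lintegral_indicator_one (measurableSet_hball _ _)]
          rfl
      _ = _ := by rw [setLIntegral_const, mul_comm]
  rw [hvol_hball, hvol_hball, ← ENNReal.ofReal_mul (ballVol_nonneg _),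
    ← ENNReal.ofReal_mul (ballVol_nonneg _)] at key
  exact (ENNReal.ofReal_le_ofReal_iff
    (mul_nonneg (ballVol_nonneg _) (ballVol_nonneg _))).1 key

/-- Submultiplicativity halves the radius twice, to `2 j + 3` and to `j + 5 / 2`, and then trades
the remaining shift for the constant factor `w / v`. This replaces any explicit volume formula. -/
lemma ballVol_quadruple : ∃ C : ℝ, 0 ≤ C ∧
    ∀ j : ℝ, 1 ≤ j → ballVol n (4 * j + 4) ≤ C * ballVol n j ^ 4 := by
  set v := ballVol n 1 with hv
  have hv0 : 0 < v := ballVol_pos one_pos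
  set w := ballVol n (9 / 2) with hw
  have hw0 : 0 ≤ w := ballVol_nonneg _
  refine ⟨(w / v) ^ 4 / v ^ 3, by positivity, fun j hj => ?_⟩
  have hj0 := ballVol_nonneg (n := n) j
  have a1 : ballVol n (4 * j + 4) ≤ ballVol n (2 * j + 3) ^ 2 / v := by
    have := ballVol_submul (n := n) (s := 2 * j + 2) (t := 2 * j + 2) (by linarith) (by linarith)
    rw [show 2 * j + 2 + (2 * j + 2) = 4 * j + 4 by ring,
      show 2 * j + 2 + 1 = 2 * j + 3 by ring] at this
    rw [le_div_iff₀ hv0]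
    linarith
  have a2 : ballVol n (2 * j + 3) ≤ ballVol n (j + 5 / 2) ^ 2 / v := by
    have := ballVol_submul (n := n) (s := j + 3 / 2) (t := j + 3 / 2) (by linarith) (by linarith)
    rw [show j + 3 / 2 + (j + 3 / 2) = 2 * j + 3 by ring,
      show j + 3 / 2 + 1 = j + 5 / 2 by ring] at this
    rw [le_div_iff₀ hv0]
    linarith
  have a3 : ballVol n (j + 5 / 2) ≤ w / v * ballVol n j := by
    have := ballVol_submul (n := n) (s := j - 1) (t := 7 / 2) (by linarith) (by norm_num)
    rw [show j - 1 + 7 / 2 = j + 5 / 2 by ring, show j - 1 + 1 = j by ring,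
      show (7 / 2 + 1 : ℝ) = 9 / 2 by norm_num] at this
    rw [div_mul_eq_mul_div, le_div_iff₀ hv0]
    linarith
  calc _ ≤ ballVol n (2 * j + 3) ^ 2 / v := a1
    _ ≤ ((w / v * ballVol n j) ^ 2 / v) ^ 2 / v := by
        have := ballVol_nonneg (n := n) (2 * j + 3)
        have := ballVol_nonneg (n := n) (j + 5 / 2)
        gcongr
        exact a2.trans (by gcongr)
    _ = _ := by
        field_simp

lemma pow_four_mul_exp_le {c v : ℝ} (hc : 0 < c) (hv : 0 ≤ v) :
    v ^ 4 * Real.exp (-c * v) ≤ 24 * (2 / c) ^ 4 * Real.exp (-(c / 2) * v) := by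
  have h := Real.pow_div_factorial_le_exp (c / 2 * v) (by positivity) 4
  have e : Real.exp (-c * v) = Real.exp (-(c / 2) * v) * Real.exp (-(c / 2 * v)) := by
    rw [← Real.exp_add]; congr 1; ring
  rw [e]
  have h2 : v ^ 4 ≤ 24 * (2 / c) ^ 4 * Real.exp (c / 2 * v) := by
    have : v ^ 4 = 24 * (2 / c) ^ 4 * ((c / 2 * v) ^ 4 / (Nat.factorial 4 : ℝ)) := by
      simp [Nat.factorial]
      field_simp
    rw [this]
    gcongr
  calc _ ≤ 24 * (2 / c) ^ 4 * Real.exp (c / 2 * v) *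
        (Real.exp (-(c / 2) * v) * Real.exp (-(c / 2 * v))) := by gcongr
    _ = 24 * (2 / c) ^ 4 * Real.exp (-(c / 2) * v) *
        (Real.exp (c / 2 * v) * Real.exp (-(c / 2 * v))) := by ring
    _ = _ := by rw [← Real.exp_add]; simp

/-- Exponentials of minus the ball volume are integrable, whatever the growth of the volume. -/
lemma lintegral_exp_neg_ballVol_lt_top (x : HSpace n) {c : ℝ} (hc : 0 < c) :
    ∫⁻ y, ENNReal.ofReal (Real.exp (-c * ballVol n (hdist x y / 4))) ∂hvol n < ∞ := by
  set g : ℕ → ℝ := fun j => ballVol n (4 * j + 4) * Real.exp (-c * ballVol n j) with hg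
  have hv0 : 0 < ballVol n 1 := ballVol_pos one_pos
  have hg0 : ∀ j, 0 ≤ g j := fun j => mul_nonneg (ballVol_nonneg _) (Real.exp_pos _).le
  have hsum : Summable g := by
    obtain ⟨C, hC, hq⟩ := ballVol_quadruple (n := n)
    set q := Real.exp (-(c / 2) * (ballVol n 1 / 2)) with hq'
    have hq1 : q < 1 := Real.exp_lt_one_iff.2 (by have := mul_pos hc hv0; nlinarith)
    have hgeo : Summable fun j : ℕ =>
        C * (24 * (2 / c) ^ 4 * (q ^ j * Real.exp (c / 2 * (ballVol n 1 / 2)))) :=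
      (((summable_geometric_of_lt_one (Real.exp_pos _).le hq1).mul_right _).mul_left _).mul_left _
    -- The term `j = 0` is split off because the quadrupling estimate needs radius at least `1`.
    refine (summable_nat_add_iff 1).1 (Summable.of_nonneg_of_le (fun j => hg0 _) (fun j => ?_)
      ((summable_nat_add_iff 1).2 hgeo))
    have hj : (1 : ℝ) ≤ ((j + 1 : ℕ) : ℝ) := by simp
    have b0 := ballVol_nonneg (n := n) ((j + 1 : ℕ) : ℝ)
    calc g (j + 1) ≤ C * ballVol n ((j + 1 : ℕ) : ℝ) ^ 4 *
          Real.exp (-c * ballVol n ((j + 1 : ℕ) : ℝ)) := by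
          simp only [hg]
          gcongr
          exact hq _ hj
      _ ≤ C * (24 * (2 / c) ^ 4 * Real.exp (-(c / 2) * ballVol n ((j + 1 : ℕ) : ℝ))) := by
          rw [mul_assoc]
          refine mul_le_mul_of_nonneg_left ?_ hC
          exact pow_four_mul_exp_le hc b0
      _ ≤ _ := by
          gcongr
          rw [hq', ← Real.exp_nat_mul, ← Real.exp_add]
          refine Real.exp_le_exp.2 ?_
          have := ballVol_linear (n := n) ((j + 1 : ℕ) : ℝ)
          nlinarith
  calc _ ≤ ∫⁻ y, ∑' j : ℕ, (hball x (4 * j + 4)).indicator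
        (fun _ => ENNReal.ofReal (Real.exp (-c * ballVol n j))) y ∂hvol n := by
        refine lintegral_mono fun y => ?_
        -- For this `j` the point `y` lies in the ball of radius `4 j + 4`, while the volume in the
        -- exponent is at least that of radius `j`.
        set j := ⌊hdist x y / 4⌋₊ with hj
        have h1 := Nat.floor_le (a := hdist x y / 4) (by linarith [hdist_nonneg x y])
        have h2 := Nat.lt_floor_add_one (hdist x y / 4)
        refine le_trans ?_ (ENNReal.le_tsum j)
        rw [Set.indicator_of_mem (show y ∈ hball x (4 * j + 4) from by
          rw [mem_hball]; linarith)]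
        refine ENNReal.ofReal_le_ofReal (Real.exp_le_exp.2 ?_)
        have := ballVol_mono (n := n) h1
        nlinarith
    _ = ∑' j : ℕ, ENNReal.ofReal (g j) := by
        rw [lintegral_tsum fun j =>
          (measurable_const.indicator (measurableSet_hball _ _)).aemeasurable]
        congr 1
        ext j
        rw [lintegral_indicator (measurableSet_hball _ _), setLIntegral_const, hvol_hball,
          ← ENNReal.ofReal_mul (Real.exp_pos _).le, mul_comm]
    _ < ∞ := by
        rw [← ENNReal.ofReal_tsum_of_nonneg hg0 hsum]
        exact ENNReal.ofReal_lt_top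

lemma tendsto_ballVol : Tendsto (ballVol n) atTop atTop := by
  refine tendsto_atTop_mono ballVol_linear ?_
  have := ballVol_pos (n := n) one_pos
  exact (tendsto_atTop_add_const_right _ (-1) tendsto_id).const_mul_atTop (by positivity)

/-- The lens `B(x, s) ∩ B(c, d(c, x))` contains a ball of radius `s / 2`. -/
lemma ballVol_le_lens {c x : HSpace n} {s : ℝ} (hs : 0 ≤ s) (hs' : s ≤ hdist c x) :
    ENNReal.ofReal (ballVol n (s / 2)) ≤ hvol n {z | hdist c z < hdist c x ∧ hdist x z < s} := by
  obtain ⟨m, h1, h2⟩ := exists_between x c (s := s / 2) (by linarith)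
    (by rw [hdist_comm x c]; linarith)
  rw [← hvol_hball m]
  refine measure_mono fun z hz => ?_
  have hz' : hdist m z < s / 2 := hz
  have t1 := hdist_triangle x m z
  have t2 := hdist_triangle c m z
  rw [hdist_comm c m] at t2
  rw [hdist_comm x c] at h2
  exact ⟨by linarith, by linarith⟩

/-! ### Null sets -/

/-- Completing the square shows that this set lies on a Euclidean sphere. Hyperbolic spheres and the
horospheres at finite ideal points both have this equation. -/
lemma hvol_quadric_eq_zero (a : EuclideanSpace ℝ (Fin (n + 1))) (c : ℝ) :
    hvol n {z | ‖z.1 - a‖ ^ 2 = c * height z} = 0 := by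
  refine hvol_eq_zero_of_image ?_
  set a' := a + (c / 2) • vert n
  set ρ := ‖a'‖ ^ 2 - ‖a‖ ^ 2
  refine measure_mono_null ?_ (Measure.addHaar_sphere volume a' √ρ)
  rintro _ ⟨z, hz, rfl⟩
  have hz' : ‖z.1 - a‖ ^ 2 = c * height z := hz
  rw [Metric.mem_sphere, dist_eq_norm]
  have h1 : ‖z.1 - a'‖ ^ 2 = ρ := by
    have e2 : inner ℝ z.1 a' = inner ℝ z.1 a + c / 2 * height z := by
      simp only [a', inner_add_right, inner_smul_right, inner_vert]
      rfl
    rw [norm_sub_sq_real] at hz' ⊢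
    rw [e2]
    simp only [ρ]
    linarith
  rw [← h1, Real.sqrt_sq (norm_nonneg _)]

lemma hvol_height_eq_zero (c : ℝ) : hvol n {z | height z = c} = 0 := by
  refine hvol_eq_zero_of_image ?_
  have h := Measure.addHaar_affineSubspace (volume : Measure (EuclideanSpace ℝ (Fin (n + 1))))
    (AffineSubspace.mk' (c • vert n) (Submodule.span ℝ {vert n})ᗮ) ?_
  · refine measure_mono_null ?_ h
    rintro _ ⟨z, hz, rfl⟩
    have hz' : z.1 (Fin.last n) = c := hz
    rw [SetLike.mem_coe, AffineSubspace.mem_mk', Submodule.mem_orthogonal_singleton_iff_inner_left,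
      inner_vert]
    simp [hz', vert_last]
  · intro htop
    have : (c • vert n + vert n) ∈
        AffineSubspace.mk' (c • vert n) (Submodule.span ℝ {vert n})ᗮ := by
      rw [htop]; trivial
    rw [AffineSubspace.mem_mk', Submodule.mem_orthogonal_singleton_iff_inner_left,
      inner_vert] at this
    simp [vert_last] at this

lemma hvol_hsphere_eq_zero (o : HSpace n) (r : ℝ) : hvol n {z | hdist o z = r} = 0 := by
  have ho := height_pos o
  refine measure_mono_null ?_
    (hvol_quadric_eq_zero o.1 ((Real.cosh r - 1) * (2 * height o)))
  intro z hz
  have hz' : hdist o z = r := hz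
  have h := cosh_hdist o z
  have hz0 := height_pos z
  rw [hz'] at h
  show ‖z.1 - o.1‖ ^ 2 = _
  rw [norm_sub_rev, h]
  field_simp
  ring

/-! ### Busemann functions and horoballs -/

/-- The Busemann function of the ideal point `e`, up to an additive constant. -/
def lev : IdealPoint n → HSpace n → ℝ
  | none => fun z => Real.log (height z)
  | some b => fun z => Real.log (height z) - Real.log (‖z.1 - b.1‖ ^ 2)

lemma norm_sub_ideal_pos (z : HSpace n) {b : EuclideanSpace ℝ (Fin (n + 1))}
    (hb : b (Fin.last n) = 0) : 0 < ‖z.1 - b‖ := by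
  rw [norm_pos_iff, sub_ne_zero]
  rintro rfl
  exact (height_pos z).ne' hb

lemma measurable_lev (e : IdealPoint n) : Measurable (lev e) := by
  have h : Measurable (height (n := n)) := continuous_height.measurable
  cases e with
  | none => exact Real.measurable_log.comp h
  | some b =>
    refine (Real.measurable_log.comp h).sub (Real.measurable_log.comp ?_)
    fun_prop

lemma hvol_lev_eq_zero (e : IdealPoint n) (c : ℝ) : hvol n {z | lev e z = c} = 0 := by
  cases e with
  | none =>
    refine measure_mono_null (fun z hz => ?_) (hvol_height_eq_zero (Real.exp c))
    have hz' : Real.log (height z) = c := hz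
    show height z = Real.exp c
    rw [← hz', Real.exp_log (height_pos z)]
  | some b =>
    refine measure_mono_null (fun z hz => ?_) (hvol_quadric_eq_zero b.1 (Real.exp (-c)))
    have hz' : Real.log (height z) - Real.log (‖z.1 - b.1‖ ^ 2) = c := hz
    have h0 := norm_sub_ideal_pos z b.2
    have h1 := height_pos z
    show ‖z.1 - b.1‖ ^ 2 = Real.exp (-c) * height z
    rw [← hz', neg_sub, Real.exp_sub, Real.exp_log (by positivity), Real.exp_log h1]
    field_simp

/-- The logarithm of `exp D * (1 - exp (-D)) ^ 2 = (2 * sinh (D / 2)) ^ 2`. The last term vanishes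
as the distance grows, so asymptotically only logarithms of Euclidean quantities remain. -/
lemma hdist_eq_log {p q : HSpace n} (h : p ≠ q) :
    hdist p q = Real.log (‖p.1 - q.1‖ ^ 2) - Real.log (height p) - Real.log (height q)
      - 2 * Real.log (1 - Real.exp (-hdist p q)) := by
  have hp := height_pos p
  have hq := height_pos q
  have hD := hdist_pos h
  have hn : 0 < ‖p.1 - q.1‖ := norm_pos_iff.2 (sub_ne_zero.2 fun h' => h (Subtype.ext h'))
  have h1 : 0 < 1 - Real.exp (-hdist p q) := by
    have : Real.exp (-hdist p q) < 1 := Real.exp_lt_one_iff.2 (by linarith)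
    linarith
  have hs := sinh_half_hdist p q
  have key : Real.exp (hdist p q) * (1 - Real.exp (-hdist p q)) ^ 2 =
      ‖p.1 - q.1‖ ^ 2 / (height p * height q) := by
    have h2 : (2 * Real.sinh (hdist p q / 2)) ^ 2 = ‖p.1 - q.1‖ ^ 2 / (height p * height q) := by
      rw [hs, mul_pow, div_pow, mul_pow, Real.sq_sqrt (by positivity), dist_eq_norm]
      field_simp
    rw [← h2, Real.sinh_eq]
    have e1 : Real.exp (hdist p q) = Real.exp (hdist p q / 2) ^ 2 := by
      rw [← Real.exp_nat_mul]; congr 1; push_cast; ring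
    have e2 : Real.exp (-hdist p q) = Real.exp (-(hdist p q / 2)) ^ 2 := by
      rw [← Real.exp_nat_mul]; congr 1; push_cast; ring
    have e3 : Real.exp (hdist p q / 2) * Real.exp (-(hdist p q / 2)) = 1 := by
      rw [← Real.exp_add]; simp
    rw [e1, e2]
    set a := Real.exp (hdist p q / 2)
    set b := Real.exp (-(hdist p q / 2))
    have e4 : a * (1 - b ^ 2) = a - b := by linear_combination -b * e3
    calc a ^ 2 * (1 - b ^ 2) ^ 2 = (a * (1 - b ^ 2)) ^ 2 := by ring
      _ = _ := by rw [e4]; ring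
  have h3 := congrArg Real.log key
  rw [Real.log_mul (Real.exp_pos _).ne' (by positivity), Real.log_exp, Real.log_pow,
    Real.log_div (by positivity) (by positivity), Real.log_mul hp.ne' hq.ne'] at h3
  push_cast at h3
  linarith

/-- Differences of distances to a point escaping to `e` converge to differences of `lev e`. -/
lemma tendsto_hdist_sub {e : IdealPoint n} {τ : ℝ → HSpace n} (hτ : TendsToIdeal τ e)
    (hinf : ∀ p, Tendsto (fun t => hdist p (τ t)) atTop atTop) (p q : HSpace n) :
    Tendsto (fun t => hdist p (τ t) - hdist q (τ t)) atTop (𝓝 (lev e q - lev e p)) := by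
  have hlog : ∀ p, Tendsto (fun t => Real.log (1 - Real.exp (-hdist p (τ t)))) atTop (𝓝 0) := by
    intro p
    have h1 : Tendsto (fun t => 1 - Real.exp (-hdist p (τ t))) atTop (𝓝 (1 - 0)) :=
      tendsto_const_nhds.sub
        (Real.tendsto_exp_atBot.comp (tendsto_neg_atTop_atBot.comp (hinf p)))
    have h2 := (Real.continuousAt_log (x := 1 - 0) (by norm_num)).tendsto.comp h1
    simpa [Function.comp_def] using h2
  -- The height of `τ t` cancels in the difference of distances. What is left tends to zero for the
  -- ideal point at infinity, since the ratio of norms tends to one, and is continuous at a finite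
  -- ideal point.
  have hA : Tendsto (fun t => Real.log (‖p.1 - (τ t).1‖ ^ 2) - Real.log (‖q.1 - (τ t).1‖ ^ 2))
      atTop (𝓝 (lev e q - lev e p + Real.log (height p) - Real.log (height q))) := by
    cases e with
    | none =>
      have hτ' : Tendsto (fun t => ‖(τ t).1‖) atTop atTop := hτ
      have hz : lev (none : IdealPoint n) q - lev (none : IdealPoint n) p + Real.log (height p)
          - Real.log (height q) = 0 := by
        simp only [lev]; ring
      rw [hz]
      have hq : Tendsto (fun t => ‖q.1 - (τ t).1‖) atTop atTop := by
        refine tendsto_atTop_mono (fun t => ?_) (tendsto_atTop_add_const_right _ (-‖q.1‖) hτ')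
        have := norm_sub_norm_le (τ t).1 q.1
        rw [norm_sub_rev] at this
        linarith
      have hr : Tendsto (fun t => ‖p.1 - (τ t).1‖ / ‖q.1 - (τ t).1‖) atTop (𝓝 1) := by
        rw [tendsto_iff_norm_sub_tendsto_zero]
        refine squeeze_zero' (Eventually.of_forall fun t => norm_nonneg _) ?_
          (hq.const_div_atTop ‖p.1 - q.1‖)
        filter_upwards [hq.eventually_gt_atTop 0] with t ht
        rw [div_sub_one ht.ne', norm_div, norm_norm]
        gcongr
        refine (abs_norm_sub_norm_le _ _).trans (le_of_eq ?_)
        congr 1; abel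
      have h2 := (Real.continuousAt_log (x := 1) (by norm_num)).tendsto.comp hr
      rw [Real.log_one] at h2
      have h3 := h2.const_mul 2
      rw [mul_zero] at h3
      refine h3.congr' ?_
      have hp : ∀ᶠ t in atTop, 0 < ‖p.1 - (τ t).1‖ := by
        filter_upwards [hr.eventually_const_lt zero_lt_one, hq.eventually_gt_atTop 0] with t h h'
        by_contra! h0
        rw [le_antisymm h0 (norm_nonneg _)] at h
        simp at h
      filter_upwards [hq.eventually_gt_atTop 0, hp] with t ht ht'
      simp only [Function.comp]
      rw [Real.log_div ht'.ne' ht.ne', Real.log_pow, Real.log_pow]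
      push_cast
      ring
    | some b =>
      have hτ' : Tendsto (fun t => (τ t).1) atTop (𝓝 b.1) := hτ
      have h : ∀ p : HSpace n, Tendsto (fun t => Real.log (‖p.1 - (τ t).1‖ ^ 2)) atTop
          (𝓝 (Real.log (‖p.1 - b.1‖ ^ 2))) := by
        intro p
        have h0 := norm_sub_ideal_pos p b.2
        refine (Real.continuousAt_log (by positivity)).tendsto.comp ?_
        exact ((tendsto_const_nhds.sub hτ').norm).pow 2
      have := (h p).sub (h q)
      convert this using 2
      simp only [lev]
      ring
  have hB := ((hA.sub (tendsto_const_nhds (x := Real.log (height p)))).add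
    (tendsto_const_nhds (x := Real.log (height q)))).sub (((hlog p).sub (hlog q)).const_mul 2)
  have hfin : ∀ᶠ t in atTop, p ≠ τ t ∧ q ≠ τ t := by
    filter_upwards [(hinf p).eventually_gt_atTop 0, (hinf q).eventually_gt_atTop 0] with t h1 h2
    refine ⟨?_, ?_⟩ <;> rintro rfl <;> simp at *
  have hlim : lev e q - lev e p + Real.log (height p) - Real.log (height q) - Real.log (height p) +
      Real.log (height q) - 2 * (0 - 0) = lev e q - lev e p := by ring
  rw [hlim] at hB
  refine hB.congr' ?_
  filter_upwards [hfin] with t ht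
  have e1 := hdist_eq_log ht.1
  have e2 := hdist_eq_log ht.2
  linarith

lemma IsGeodesicRay.tendsto_hdist {τ : ℝ → HSpace n} (hτ : IsGeodesicRay τ) (p : HSpace n) :
    Tendsto (fun t => hdist p (τ t)) atTop atTop := by
  refine tendsto_atTop_mono' _ ?_ (tendsto_atTop_add_const_right _ (-hdist p (τ 0)) tendsto_id)
  filter_upwards [eventually_ge_atTop 0] with t ht
  have h1 := hdist_triangle (τ 0) p (τ t)
  rw [hτ 0 t le_rfl ht, zero_sub, abs_neg, abs_of_nonneg ht, hdist_comm (τ 0) p] at h1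
  simp only [id]
  linarith

lemma IsGeodesicRay.tendsto_busemann {τ : ℝ → HSpace n} (hτ : IsGeodesicRay τ) (p : HSpace n) :
    Tendsto (fun s => s - hdist p (τ s)) atTop (𝓝 (busemann τ p)) := by
  refine tendsto_nhds_limUnder ?_
  -- Clamping at zero, as the ray is constrained only at nonnegative times; `g` is monotone and
  -- bounded above by the triangle inequality.
  set g : ℝ → ℝ := fun s => max s 0 - hdist p (τ (max s 0))
  have hmono : Monotone g := by
    intro s t hst
    have h1 : max s 0 ≤ max t 0 := max_le_max_right 0 hst
    have h2 := hdist_triangle p (τ (max s 0)) (τ (max t 0))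
    rw [hτ _ _ (le_max_right _ _) (le_max_right _ _), abs_sub_comm,
      abs_of_nonneg (by linarith)] at h2
    simp only [g]
    linarith
  have hbdd : BddAbove (Set.range g) := by
    refine ⟨hdist p (τ 0), ?_⟩
    rintro _ ⟨s, rfl⟩
    have h2 := hdist_triangle (τ 0) p (τ (max s 0))
    rw [hτ _ _ le_rfl (le_max_right _ _), zero_sub, abs_neg, abs_of_nonneg (le_max_right _ _),
      hdist_comm (τ 0) p] at h2
    simp only [g]
    linarith
  refine ⟨_, (tendsto_atTop_ciSup hmono hbdd).congr' ?_⟩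
  filter_upwards [eventually_ge_atTop 0] with s hs
  simp only [g, max_eq_left hs]

lemma busemann_sub {e : IdealPoint n} {τ : ℝ → HSpace n} (hτ : IsGeodesicRay τ)
    (hτe : TendsToIdeal τ e) (p q : HSpace n) :
    busemann τ q - busemann τ p = lev e q - lev e p := by
  have h1 := (hτ.tendsto_busemann q).sub (hτ.tendsto_busemann p)
  have h2 := tendsto_hdist_sub hτe hτ.tendsto_hdist p q
  refine tendsto_nhds_unique h1 (h2.congr fun t => ?_)
  ring

/-- A vertical geodesic ray tending to `e`. -/
def idealRay : IdealPoint n → ℝ → HSpace n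
  | none => fun t => vline 0 zero_last t
  | some b => fun t => vline b.1 b.2 (-t)

lemma isGeodesicRay_idealRay (e : IdealPoint n) : IsGeodesicRay (idealRay e) := by
  intro s t _ _
  cases e with
  | none => exact hdist_vline _ _ _ _
  | some b =>
    refine (hdist_vline _ _ _ _).trans ?_
    rw [← abs_neg]
    congr 1
    ring

lemma tendsToIdeal_idealRay (e : IdealPoint n) : TendsToIdeal (idealRay e) e := by
  cases e with
  | none =>
    show Tendsto (fun t => ‖(0 : EuclideanSpace ℝ (Fin (n + 1))) + Real.exp t • vert n‖) atTop atTop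
    refine Real.tendsto_exp_atTop.congr fun t => ?_
    rw [zero_add, norm_smul, norm_vert, mul_one, Real.norm_eq_abs, abs_of_pos (Real.exp_pos t)]
  | some b =>
    show Tendsto (fun t => b.1 + Real.exp (-t) • vert n) atTop (𝓝 b.1)
    have h : Tendsto (fun t : ℝ => Real.exp (-t)) atTop (𝓝 0) :=
      Real.tendsto_exp_atBot.comp tendsto_neg_atTop_atBot
    simpa using tendsto_const_nhds.add (h.smul_const (vert n))

/-- By `busemann_sub` all rays tending to `e` give the same differences. The explicit vertical ray
ensures that the quantifier over rays in `horoball` is not vacuous. -/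
lemma horoball_eq (e : IdealPoint n) (y : HSpace n) : horoball e y = {z | lev e y ≤ lev e z} := by
  ext z
  constructor
  · intro hz
    have h1 := hz _ (isGeodesicRay_idealRay e) (tendsToIdeal_idealRay e)
    have h2 := busemann_sub (isGeodesicRay_idealRay e) (tendsToIdeal_idealRay e) y z
    show lev e y ≤ lev e z
    linarith
  · intro hz τ h1 h2
    have h3 := busemann_sub h1 h2 y z
    have h4 : lev e y ≤ lev e z := hz
    linarith

lemma measurableSet_horoball (e : IdealPoint n) (y : HSpace n) :
    MeasurableSet (horoball e y) := by
  rw [horoball_eq]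
  exact measurableSet_le measurable_const (measurable_lev e)

/-- The link between the two structures: off a common horosphere, the radial order seen from a
centre far out on the ray is the Busemann order. -/
lemma eventually_hdist_idealRay_lt_iff (e : IdealPoint n) {p q : HSpace n}
    (h : lev e p ≠ lev e q) :
    ∀ᶠ t in atTop, (-hdist (idealRay e t) p < -hdist (idealRay e t) q ↔ lev e p < lev e q) := by
  have hlim := tendsto_hdist_sub (tendsToIdeal_idealRay e)
    (isGeodesicRay_idealRay e).tendsto_hdist p q
  rcases lt_or_gt_of_ne h with h | h
  · filter_upwards [hlim.eventually_const_lt (sub_pos.2 h)] with t ht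
    rw [hdist_comm _ p, hdist_comm _ q]
    exact iff_of_true (by linarith) h
  · filter_upwards [hlim.eventually_lt_const (sub_neg.2 h)] with t ht
    rw [hdist_comm _ p, hdist_comm _ q]
    exact iff_of_false (by linarith) h.not_gt

/-! ### The space of configurations -/

/-- Configurations, with the `σ`-field generated by the void events. -/
def Config (n : ℕ) : Type := Set (HSpace n)

/-- The event that there is no point in `B`. -/
def voidSet (B : Set (HSpace n)) : Set (Config n) := {ξ : Set (HSpace n) | Disjoint ξ B}

/-- The void events. -/
def voids (n : ℕ) : Set (Set (Config n)) := {S | ∃ B, MeasurableSet B ∧ S = voidSet B}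

instance : MeasurableSpace (Config n) := MeasurableSpace.generateFrom (voids n)

lemma voidSet_inter (B C : Set (HSpace n)) : voidSet B ∩ voidSet C = voidSet (B ∪ C) := by
  ext ξ
  exact Set.disjoint_union_right.symm

lemma voidSet_empty : voidSet (∅ : Set (HSpace n)) = Set.univ :=
  Set.eq_univ_of_forall fun _ => Set.disjoint_empty _

lemma measurableSet_voidSet {B : Set (HSpace n)} (hB : MeasurableSet B) :
    MeasurableSet (voidSet B) := MeasurableSpace.measurableSet_generateFrom ⟨B, hB, rfl⟩

/-- Being absent from two sets is being absent from their union. Hence finite measures on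
configurations are determined by void events, as used for the Mecke formulas. -/
lemma isPiSystem_voids : IsPiSystem (voids n) := by
  rintro _ ⟨B, hB, rfl⟩ _ ⟨C, hC, rfl⟩ -
  exact ⟨B ∪ C, hB.union hC, voidSet_inter B C⟩

lemma univ_mem_voids : Set.univ ∈ voids n := ⟨∅, MeasurableSet.empty, voidSet_empty.symm⟩

lemma isCountablySpanning_of_univ_mem {α : Type*} {C : Set (Set α)} (h : Set.univ ∈ C) :
    IsCountablySpanning C := ⟨fun _ => Set.univ, fun _ => h, Set.iUnion_const _⟩

/-- Rectangles over void events. -/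
def rects (n : ℕ) : Set (Set (HSpace n × Config n)) :=
  Set.image2 (· ×ˢ ·) {A | MeasurableSet A} (voids n)

/-- Rectangles with two measurable sides over void events. -/
def rects₂ (n : ℕ) : Set (Set (HSpace n × HSpace n × Config n)) :=
  Set.image2 (· ×ˢ ·) {A | MeasurableSet A} (rects n)

lemma univ_mem_measurable : Set.univ ∈ {A : Set (HSpace n) | MeasurableSet A} := by simp

lemma univ_mem_rects : Set.univ ∈ rects n :=
  ⟨Set.univ, univ_mem_measurable, _, univ_mem_voids, Set.univ_prod_univ⟩

lemma isPiSystem_rects : IsPiSystem (rects n) :=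
  MeasurableSpace.isPiSystem_measurableSet.prod isPiSystem_voids

lemma isPiSystem_rects₂ : IsPiSystem (rects₂ n) :=
  MeasurableSpace.isPiSystem_measurableSet.prod isPiSystem_rects

lemma generateFrom_rects :
    (inferInstance : MeasurableSpace (HSpace n × Config n)) =
      MeasurableSpace.generateFrom (rects n) := by
  rw [rects, ← generateFrom_prod_eq (isCountablySpanning_of_univ_mem univ_mem_measurable)
    (isCountablySpanning_of_univ_mem univ_mem_voids), MeasurableSpace.generateFrom_measurableSet]

lemma generateFrom_rects₂ :
    (inferInstance : MeasurableSpace (HSpace n × HSpace n × Config n)) =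
      MeasurableSpace.generateFrom (rects₂ n) := by
  rw [rects₂, ← generateFrom_prod_eq (isCountablySpanning_of_univ_mem univ_mem_measurable)
    (isCountablySpanning_of_univ_mem univ_mem_rects), MeasurableSpace.generateFrom_measurableSet,
    ← generateFrom_rects]

/-- Configurations with a random point added. -/
def addPoint (x : HSpace n) (ξ : Config n) : Config n := (insert x ξ : Set (HSpace n))

lemma addPoint_mem_voidSet {x : HSpace n} {ξ : Config n} {B : Set (HSpace n)} :
    addPoint x ξ ∈ voidSet B ↔ x ∉ B ∧ ξ ∈ voidSet B := Set.disjoint_insert_left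

lemma measurable_config {α : Type*} [MeasurableSpace α] {f : α → Config n}
    (h : ∀ B, MeasurableSet B → MeasurableSet (f ⁻¹' voidSet B)) : Measurable f := by
  refine measurable_generateFrom ?_
  rintro _ ⟨B, hB, rfl⟩
  exact h B hB

lemma measurable_addPoint : Measurable fun p : HSpace n × Config n => addPoint p.1 p.2 := by
  refine measurable_config fun B hB => ?_
  have : (fun p : HSpace n × Config n => addPoint p.1 p.2) ⁻¹' voidSet B = Bᶜ ×ˢ voidSet B := by
    ext p
    exact addPoint_mem_voidSet
  rw [this]
  exact hB.compl.prod (measurableSet_voidSet hB)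

/-! ### Moments of Poisson counts -/

lemma hasSum_poisson_mean (r : NNReal) :
    HasSum (fun k : ℕ => Real.exp (-r) * r ^ k / (k.factorial : ℝ) * k) r := by
  refine (hasSum_nat_add_iff' 1).1 ?_
  have h := (hasSum_one_poissonMeasure r).mul_left (r : ℝ)
  have e : (fun k : ℕ => Real.exp (-r) * r ^ (k + 1) / ((k + 1).factorial : ℝ) * ((k + 1 : ℕ) : ℝ))
      = fun k : ℕ => (r : ℝ) * (Real.exp (-r) * r ^ k / (k.factorial : ℝ)) := by
    funext k
    rw [Nat.factorial_succ]
    push_cast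
    field_simp
    ring
  rw [e]
  simpa using h

lemma hasSum_poisson_sq (r : NNReal) :
    HasSum (fun k : ℕ => Real.exp (-r) * r ^ k / (k.factorial : ℝ) * (k * k)) (r + r * r) := by
  refine (hasSum_nat_add_iff' 1).1 ?_
  have h := ((hasSum_one_poissonMeasure r).add (hasSum_poisson_mean r)).mul_left (r : ℝ)
  have e : (fun k : ℕ => Real.exp (-r) * r ^ (k + 1) / ((k + 1).factorial : ℝ) *
      (((k + 1 : ℕ) : ℝ) * ((k + 1 : ℕ) : ℝ))) = fun k : ℕ => (r : ℝ) *
        (Real.exp (-r) * r ^ k / (k.factorial : ℝ) +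
          Real.exp (-r) * r ^ k / (k.factorial : ℝ) * k) := by
    funext k
    rw [Nat.factorial_succ]
    push_cast
    field_simp
    ring
  rw [e]
  simpa [mul_add] using h

lemma lintegral_poissonLaw {m : ℝ≥0∞} (hm : m ≠ ∞) (g : ℕ∞ → ℝ≥0∞) :
    ∫⁻ k, g k ∂poissonLaw m = ∑' k : ℕ,
      ENNReal.ofReal (Real.exp (-m.toNNReal) * m.toNNReal ^ k / (k.factorial : ℝ)) * g k := by
  rw [poissonLaw, if_neg hm, lintegral_map (measurable_of_countable _) (measurable_of_countable _),
    poissonMeasure, lintegral_sum_measure]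
  simp [lintegral_smul_measure]

lemma lintegral_poissonLaw_id {m : ℝ≥0∞} (hm : m ≠ ∞) :
    ∫⁻ k, (k : ℝ≥0∞) ∂poissonLaw m = m := by
  rw [lintegral_poissonLaw hm]
  have h := hasSum_poisson_mean m.toNNReal
  have h2 : ∀ k : ℕ, ENNReal.ofReal (Real.exp (-m.toNNReal) * m.toNNReal ^ k / (k.factorial : ℝ)) *
      ((k : ℕ∞) : ℝ≥0∞) = ENNReal.ofReal
        (Real.exp (-m.toNNReal) * m.toNNReal ^ k / (k.factorial : ℝ) * k) := by
    intro k
    rw [ENNReal.ofReal_mul (by positivity)]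
    simp
  rw [tsum_congr h2, ← ENNReal.ofReal_tsum_of_nonneg (fun k => by positivity) h.summable,
    h.tsum_eq]
  simp [ENNReal.coe_toNNReal hm]

lemma lintegral_poissonLaw_sq {m : ℝ≥0∞} (hm : m ≠ ∞) :
    ∫⁻ k, (k : ℝ≥0∞) * k ∂poissonLaw m = m + m * m := by
  rw [lintegral_poissonLaw hm]
  have h := hasSum_poisson_sq m.toNNReal
  have h2 : ∀ k : ℕ, ENNReal.ofReal (Real.exp (-m.toNNReal) * m.toNNReal ^ k / (k.factorial : ℝ)) *
      (((k : ℕ∞) : ℝ≥0∞) * ((k : ℕ∞) : ℝ≥0∞)) = ENNReal.ofReal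
        (Real.exp (-m.toNNReal) * m.toNNReal ^ k / (k.factorial : ℝ) * (k * k)) := by
    intro k
    rw [ENNReal.ofReal_mul (by positivity), ENNReal.ofReal_mul (by positivity)]
    simp
  rw [tsum_congr h2, ← ENNReal.ofReal_tsum_of_nonneg (fun k => by positivity) h.summable,
    h.tsum_eq, ENNReal.ofReal_add (by positivity) (by positivity),
    ENNReal.ofReal_mul (by positivity)]
  simp [ENNReal.coe_toNNReal hm]

lemma poissonLaw_zero {m : ℝ≥0∞} (hm : m ≠ ∞) :
    poissonLaw m {0} = ENNReal.ofReal (Real.exp (-m.toReal)) := by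
  rw [poissonLaw, if_neg hm, Measure.map_apply (measurable_of_countable _) (by measurability)]
  have : (Nat.cast : ℕ → ℕ∞) ⁻¹' {0} = {0} := by ext k; simp
  rw [this, poissonMeasure_singleton]
  simp [ENNReal.coe_toNNReal_eq_toReal]

lemma poissonLaw_top_zero : poissonLaw ∞ {0} = 0 := by
  simp [poissonLaw]

/-! ### The Mecke formula -/

section Mecke

variable {Ω : Type*} [MeasurableSpace Ω] {P : Measure Ω}
  {η : Ω → Set (HSpace n)} {μ : Measure (HSpace n)}

/-- The process as a map into the space of configurations. -/
def toConfig (η : Ω → Set (HSpace n)) (ω : Ω) : Config n := η ω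

lemma IsPoissonProcess.measurable_toConfig (hη : IsPoissonProcess P η μ) :
    Measurable (toConfig η) := by
  refine measurable_config fun B hB => ?_
  have : toConfig η ⁻¹' voidSet B = (fun ω => (η ω ∩ B).encard) ⁻¹' {0} := by
    ext ω
    simp only [Set.mem_preimage, Set.mem_singleton_iff, Set.encard_eq_zero,
      ← Set.disjoint_iff_inter_eq_empty]
    rfl
  rw [this]
  exact hη.measurable_count B hB (measurableSet_singleton 0)

lemma IsPoissonProcess.void_eq (hη : IsPoissonProcess P η μ) {B : Set (HSpace n)}
    (hB : MeasurableSet B) : P {ω | Disjoint (η ω) B} = poissonLaw (μ B) {0} := by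
  rw [← hη.map_count B hB,
    Measure.map_apply (hη.measurable_count B hB) (measurableSet_singleton 0)]
  congr 1
  ext ω
  simp [Set.disjoint_iff_inter_eq_empty]

lemma measurable_encard (hη : IsPoissonProcess P η μ) {B : Set (HSpace n)} (hB : MeasurableSet B) :
    Measurable fun ω => ((η ω ∩ B).encard : ℝ≥0∞) :=
  (measurable_of_countable (fun k : ℕ∞ => (k : ℝ≥0∞))).comp (hη.measurable_count B hB)

lemma lintegral_encard (hη : IsPoissonProcess P η μ) {B : Set (HSpace n)} (hB : MeasurableSet B)
    (hfin : μ B ≠ ∞) : ∫⁻ ω, ((η ω ∩ B).encard : ℝ≥0∞) ∂P = μ B := by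
  rw [← lintegral_poissonLaw_id hfin, ← hη.map_count B hB,
    lintegral_map (measurable_of_countable _) (hη.measurable_count B hB)]

lemma lintegral_encard_sq (hη : IsPoissonProcess P η μ) {B : Set (HSpace n)} (hB : MeasurableSet B)
    (hfin : μ B ≠ ∞) :
    ∫⁻ ω, ((η ω ∩ B).encard : ℝ≥0∞) * (η ω ∩ B).encard ∂P = μ B + μ B * μ B := by
  rw [← lintegral_poissonLaw_sq hfin, ← hη.map_count B hB,
    lintegral_map (measurable_of_countable _) (hη.measurable_count B hB)]

lemma lintegral_prod_counts (hη : IsPoissonProcess P η μ) {k : ℕ} (B : Fin k → Set (HSpace n))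
    (hB : ∀ i, MeasurableSet (B i)) (hd : Pairwise fun i j => Disjoint (B i) (B j))
    (g : Fin k → ℕ∞ → ℝ≥0∞) :
    ∫⁻ ω, ∏ i, g i (η ω ∩ B i).encard ∂P = ∏ i, ∫⁻ ω, g i (η ω ∩ B i).encard ∂P := by
  have h := (hη.indep_count k B hB hd).comp g fun i => measurable_of_countable _
  exact lintegral_prod_eq_prod_lintegral_of_indepFun Finset.univ _ h
    fun i => (measurable_of_countable (g i)).comp (hη.measurable_count _ (hB i))

/-- The indicator of the count being zero. -/
def zeroInd (k : ℕ∞) : ℝ≥0∞ := if k = 0 then 1 else 0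

lemma zeroInd_encard {Ω : Type*} {η : Ω → Set (HSpace n)} (ω : Ω) (B : Set (HSpace n)) :
    zeroInd (η ω ∩ B).encard = {ω | Disjoint (η ω) B}.indicator 1 ω := by
  have h0 : (η ω ∩ B).encard = 0 ↔ Disjoint (η ω) B := by
    rw [Set.encard_eq_zero, Set.disjoint_iff_inter_eq_empty]
  unfold zeroInd
  by_cases h : Disjoint (η ω) B
  · rw [if_pos (h0.2 h), Set.indicator_of_mem (show ω ∈ {ω | Disjoint (η ω) B} from h), Pi.one_apply]
  · rw [if_neg (fun h' => h (h0.1 h')), Set.indicator_of_notMem (show ω ∉ {ω | Disjoint (η ω) B} from h)]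

lemma measurableSet_void (hη : IsPoissonProcess P η μ) {B : Set (HSpace n)}
    (hB : MeasurableSet B) : MeasurableSet {ω | Disjoint (η ω) B} :=
  hη.measurable_toConfig (measurableSet_voidSet hB)

lemma lintegral_zeroInd (hη : IsPoissonProcess P η μ) {B : Set (HSpace n)}
    (hB : MeasurableSet B) :
    ∫⁻ ω, zeroInd (η ω ∩ B).encard ∂P = P {ω | Disjoint (η ω) B} := by
  simp_rw [zeroInd_encard]
  exact lintegral_indicator_one (measurableSet_void hη hB)

lemma encard_inter_of_disjoint {S A B : Set (HSpace n)} (h : Disjoint S B) :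
    (S ∩ A).encard = (S ∩ (A \ B)).encard := by
  congr 1
  ext z
  have : z ∈ S → z ∉ B := fun h1 h2 => Set.disjoint_left.1 h h1 h2
  simp only [Set.mem_inter_iff, Set.mem_sdiff]
  tauto

/-- When `B` is empty of points, the points in `A` are those in `A \ B`, whose number is independent
of the process in `B`. -/
lemma lintegral_encard_mul_void (hη : IsPoissonProcess P η μ) {A B : Set (HSpace n)}
    (hA : MeasurableSet A) (hB : MeasurableSet B) (hfin : μ A ≠ ∞) :
    ∫⁻ ω, ((η ω ∩ A).encard : ℝ≥0∞) * {ω | Disjoint (η ω) B}.indicator 1 ω ∂P =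
      μ (A \ B) * P {ω | Disjoint (η ω) B} := by
  have h := lintegral_prod_counts hη ![A \ B, B]
    (by intro i; fin_cases i; exacts [hA.diff hB, hB])
    (by
      intro i j hij
      fin_cases i <;> fin_cases j
      · exact absurd rfl hij
      · exact Set.disjoint_sdiff_left
      · exact Set.disjoint_sdiff_right
      · exact absurd rfl hij)
    ![fun k => (k : ℝ≥0∞), zeroInd]
  simp only [Fin.prod_univ_two, Matrix.cons_val_zero, Matrix.cons_val_one] at h
  rw [lintegral_encard hη (hA.diff hB) (measure_ne_top_of_subset Set.sdiff_subset hfin),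
    lintegral_zeroInd hη hB] at h
  rw [← h]
  refine lintegral_congr fun ω => ?_
  rw [zeroInd_encard]
  by_cases hω : Disjoint (η ω) B
  · rw [encard_inter_of_disjoint hω]
  · simp [hω]

/-- Outside `B` the sets split into the common part `C` and the remainders `D`, `D'`, with
independent counts. The second moment of the count in `C` exceeds the squared mean by `μ C`, which
is the diagonal contribution. -/
lemma lintegral_encard_mul_encard_mul_void [IsProbabilityMeasure P]
    (hη : IsPoissonProcess P η μ) {A A' B : Set (HSpace n)}
    (hA : MeasurableSet A) (hA' : MeasurableSet A') (hB : MeasurableSet B) (hfin : μ A ≠ ∞)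
    (hfin' : μ A' ≠ ∞) :
    ∫⁻ ω, ((η ω ∩ A).encard : ℝ≥0∞) * (η ω ∩ A').encard *
        {ω | Disjoint (η ω) B}.indicator 1 ω ∂P =
      (μ (A \ B) * μ (A' \ B) + μ ((A ∩ A') \ B)) * P {ω | Disjoint (η ω) B} := by
  set C := (A ∩ A') \ B with hC
  set D := (A \ A') \ B with hD
  set D' := (A' \ A) \ B with hD'
  have mC : MeasurableSet C := (hA.inter hA').diff hB
  have mD : MeasurableSet D := (hA.diff hA').diff hB
  have mD' : MeasurableSet D' := (hA'.diff hA).diff hB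
  have fC : μ C ≠ ∞ :=
    measure_ne_top_of_subset (Set.sdiff_subset.trans Set.inter_subset_left) hfin
  have fD : μ D ≠ ∞ := measure_ne_top_of_subset (Set.sdiff_subset.trans Set.sdiff_subset) hfin
  have fD' : μ D' ≠ ∞ := measure_ne_top_of_subset (Set.sdiff_subset.trans Set.sdiff_subset) hfin'
  have dCD : Disjoint C D := by
    rw [Set.disjoint_left]; rintro z ⟨⟨_, h1⟩, _⟩ ⟨⟨_, h2⟩, _⟩; exact h2 h1
  have dCD' : Disjoint C D' := by
    rw [Set.disjoint_left]; rintro z ⟨⟨h1, _⟩, _⟩ ⟨⟨_, h2⟩, _⟩; exact h2 h1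
  have dDD' : Disjoint D D' := by
    rw [Set.disjoint_left]; rintro z ⟨⟨h1, _⟩, _⟩ ⟨⟨_, h2⟩, _⟩; exact h2 h1
  have dC : Disjoint C B := Set.disjoint_sdiff_left
  have dD : Disjoint D B := Set.disjoint_sdiff_left
  have dD' : Disjoint D' B := Set.disjoint_sdiff_left
  have eA : A \ B = C ∪ D := by
    ext z; simp only [hC, hD, Set.mem_sdiff, Set.mem_union, Set.mem_inter_iff]; tauto
  have eA' : A' \ B = C ∪ D' := by
    ext z; simp only [hC, hD', Set.mem_sdiff, Set.mem_union, Set.mem_inter_iff]; tauto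
  have key : ∀ g : Fin 4 → ℕ∞ → ℝ≥0∞, ∫⁻ ω, g 0 (η ω ∩ C).encard * g 1 (η ω ∩ D).encard *
      g 2 (η ω ∩ D').encard * g 3 (η ω ∩ B).encard ∂P =
      (∫⁻ ω, g 0 (η ω ∩ C).encard ∂P) * (∫⁻ ω, g 1 (η ω ∩ D).encard ∂P) *
      (∫⁻ ω, g 2 (η ω ∩ D').encard ∂P) * (∫⁻ ω, g 3 (η ω ∩ B).encard ∂P) := by
    intro g
    have h := lintegral_prod_counts hη ![C, D, D', B]
      (by intro i; fin_cases i; exacts [mC, mD, mD', hB])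
      (by
        intro i j hij
        fin_cases i <;> fin_cases j <;> first
          | exact absurd rfl hij
          | exact dCD | exact dCD' | exact dDD' | exact dC | exact dD | exact dD'
          | exact dCD.symm | exact dCD'.symm | exact dDD'.symm | exact dC.symm | exact dD.symm
          | exact dD'.symm)
      g
    simpa [Fin.prod_univ_four] using h
  let c : ℕ∞ → ℝ≥0∞ := fun k => (k : ℝ≥0∞)
  -- The four terms of the expansion of `(C + D) * (C + D')`.
  have k1 := key ![fun k => c k * c k, 1, 1, zeroInd]
  have k2 := key ![c, 1, c, zeroInd]
  have k3 := key ![c, c, 1, zeroInd]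
  have k4 := key ![1, c, c, zeroInd]
  simp only [Matrix.cons_val_zero, Matrix.cons_val_one, Matrix.cons_val, Pi.one_apply,
    lintegral_const, measure_univ, mul_one, one_mul, lintegral_zeroInd hη hB, c,
    lintegral_encard hη mC fC, lintegral_encard hη mD fD, lintegral_encard hη mD' fD',
    lintegral_encard_sq hη mC fC] at k1 k2 k3 k4
  have hz : Measurable fun ω => zeroInd (η ω ∩ B).encard :=
    (measurable_of_countable zeroInd).comp (hη.measurable_count B hB)
  have nC := measurable_encard hη mC
  have nD := measurable_encard hη mD
  have nD' := measurable_encard hη mD'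
  calc _ = ∫⁻ ω, (((η ω ∩ C).encard : ℝ≥0∞) * (η ω ∩ C).encard * zeroInd (η ω ∩ B).encard +
        ((η ω ∩ C).encard : ℝ≥0∞) * (η ω ∩ D').encard * zeroInd (η ω ∩ B).encard) +
        (((η ω ∩ C).encard : ℝ≥0∞) * (η ω ∩ D).encard * zeroInd (η ω ∩ B).encard +
        ((η ω ∩ D).encard : ℝ≥0∞) * (η ω ∩ D').encard * zeroInd (η ω ∩ B).encard) ∂P := by
        refine lintegral_congr fun ω => ?_
        rw [zeroInd_encard]
        by_cases hω : Disjoint (η ω) B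
        · rw [encard_inter_of_disjoint hω, encard_inter_of_disjoint (A := A') hω, eA, eA',
            Set.inter_union_distrib_left, Set.inter_union_distrib_left,
            Set.encard_union_eq (dCD.mono Set.inter_subset_right Set.inter_subset_right),
            Set.encard_union_eq (dCD'.mono Set.inter_subset_right Set.inter_subset_right)]
          simp only [Set.indicator_of_mem (show ω ∈ {ω | Disjoint (η ω) B} from hω), Pi.one_apply,
            mul_one, ENat.toENNReal_add]
          ring
        · simp [hω]
    _ = _ := by
        rw [lintegral_add_left (by fun_prop), lintegral_add_left (by fun_prop),
          lintegral_add_left (by fun_prop), k1, k2, k3, k4, eA, eA', measure_union dCD mD,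
          measure_union dCD' mD']
        ring

/-! ### Empirical measures of points and of pairs, and the Mecke formulas. -/

variable {o : HSpace n} {R : ℝ}

/-- The points of the process in the ball `B(o, R)`. -/
def IsPoissonProcess.pts (hη : IsPoissonProcess P η μ) (o : HSpace n) (R : ℝ) (ω : Ω) :
    Finset (HSpace n) := (hη.locallyFinite ω o R).toFinset

lemma sum_pts_indicator (hη : IsPoissonProcess P η μ) (A : Set (HSpace n)) (ω : Ω) :
    ∑ x ∈ hη.pts o R ω, A.indicator (1 : HSpace n → ℝ≥0∞) x =
      ((η ω ∩ (hball o R ∩ A)).encard : ℝ≥0∞) := by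
  classical
  have h1 : ∑ x ∈ hη.pts o R ω, A.indicator (1 : HSpace n → ℝ≥0∞) x =
      (((hη.pts o R ω).filter (· ∈ A)).card : ℝ≥0∞) := by
    rw [Finset.card_filter]
    push_cast
    exact Finset.sum_congr rfl fun x _ => by simp [Set.indicator_apply]
  have h2 : η ω ∩ (hball o R ∩ A) = (((hη.pts o R ω).filter (· ∈ A)) : Set (HSpace n)) := by
    ext x
    simp [IsPoissonProcess.pts, and_assoc]
    tauto
  rw [h1, h2, Set.encard_coe_eq_coe_finsetCard]
  simp

/-- The empirical measure of the points together with the configuration. -/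
def empOne (hη : IsPoissonProcess P η μ) (o : HSpace n) (R : ℝ) (ω : Ω) :
    Measure (HSpace n × Config n) := ∑ x ∈ hη.pts o R ω, Measure.dirac (x, toConfig η ω)

/-- The empirical measure of the pairs of points together with the configuration. -/
def empTwo (hη : IsPoissonProcess P η μ) (o : HSpace n) (R : ℝ) (ω : Ω) :
    Measure (HSpace n × HSpace n × Config n) :=
  ∑ x ∈ hη.pts o R ω, ∑ y ∈ hη.pts o R ω, Measure.dirac (x, y, toConfig η ω)

instance (hη : IsPoissonProcess P η μ) (ω : Ω) : IsFiniteMeasure (empOne hη o R ω) := by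
  unfold empOne; infer_instance

instance (hη : IsPoissonProcess P η μ) (ω : Ω) : IsFiniteMeasure (empTwo hη o R ω) := by
  unfold empTwo; infer_instance

lemma empOne_rect (hη : IsPoissonProcess P η μ) {A B : Set (HSpace n)} (hA : MeasurableSet A)
    (hB : MeasurableSet B) (ω : Ω) :
    empOne hη o R ω (A ×ˢ voidSet B) = ((η ω ∩ (hball o R ∩ A)).encard : ℝ≥0∞) *
      {ω | Disjoint (η ω) B}.indicator 1 ω := by
  rw [empOne, Measure.finsetSum_apply, ← sum_pts_indicator hη, Finset.sum_mul]
  refine Finset.sum_congr rfl fun x _ => ?_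
  rw [Measure.dirac_apply' _ (hA.prod (measurableSet_voidSet hB)), ← Set.indicator_prod_one]
  rfl

lemma empTwo_rect (hη : IsPoissonProcess P η μ) {A A' B : Set (HSpace n)} (hA : MeasurableSet A)
    (hA' : MeasurableSet A') (hB : MeasurableSet B) (ω : Ω) :
    empTwo hη o R ω (A ×ˢ A' ×ˢ voidSet B) = ((η ω ∩ (hball o R ∩ A)).encard : ℝ≥0∞) *
      (η ω ∩ (hball o R ∩ A')).encard * {ω | Disjoint (η ω) B}.indicator 1 ω := by
  rw [empTwo, Measure.finsetSum_apply, ← sum_pts_indicator hη, ← sum_pts_indicator hη,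
    Finset.sum_mul_sum, Finset.sum_mul]
  refine Finset.sum_congr rfl fun x _ => ?_
  rw [Measure.finsetSum_apply, Finset.sum_mul]
  refine Finset.sum_congr rfl fun y _ => ?_
  rw [Measure.dirac_apply' _ (hA.prod (hA'.prod (measurableSet_voidSet hB))),
    mul_assoc, ← Set.indicator_prod_one, ← Set.indicator_prod_one]
  rfl

lemma measurable_empOne (hη : IsPoissonProcess P η μ) : Measurable (empOne hη o R) := by
  have hb : ∀ s ∈ rects n, Measurable fun ω => empOne hη o R ω s := by
    rintro _ ⟨A, hA, _, ⟨B, hB, rfl⟩, rfl⟩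
    simp_rw [empOne_rect hη hA hB]
    exact (measurable_encard hη ((measurableSet_hball o R).inter hA)).mul
      (measurable_one.indicator (measurableSet_void hη hB))
  exact Measurable.measure_of_isPiSystem generateFrom_rects isPiSystem_rects hb
    (hb _ univ_mem_rects)

lemma univ_mem_rects₂ : Set.univ ∈ rects₂ n :=
  ⟨Set.univ, univ_mem_measurable, _, univ_mem_rects, Set.univ_prod_univ⟩

lemma measurable_empTwo (hη : IsPoissonProcess P η μ) : Measurable (empTwo hη o R) := by
  have hb : ∀ s ∈ rects₂ n, Measurable fun ω => empTwo hη o R ω s := by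
    rintro _ ⟨A, hA, _, ⟨A', hA', _, ⟨B, hB, rfl⟩, rfl⟩, rfl⟩
    simp_rw [empTwo_rect hη hA hA' hB]
    exact ((measurable_encard hη ((measurableSet_hball o R).inter hA)).mul
      (measurable_encard hη ((measurableSet_hball o R).inter hA'))).mul
      (measurable_one.indicator (measurableSet_void hη hB))
  exact Measurable.measure_of_isPiSystem generateFrom_rects₂ isPiSystem_rects₂ hb
    (hb _ univ_mem_rects₂)

lemma lintegral_empOne (hη : IsPoissonProcess P η μ) {g : HSpace n × Config n → ℝ≥0∞}
    (hg : Measurable g) (ω : Ω) :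
    ∫⁻ p, g p ∂empOne hη o R ω = ∑ x ∈ hη.pts o R ω, g (x, toConfig η ω) := by
  rw [empOne, lintegral_finsetSum_measure]
  exact Finset.sum_congr rfl fun x _ => lintegral_dirac' _ hg

lemma lintegral_empTwo (hη : IsPoissonProcess P η μ) {g : HSpace n × HSpace n × Config n → ℝ≥0∞}
    (hg : Measurable g) (ω : Ω) :
    ∫⁻ p, g p ∂empTwo hη o R ω =
      ∑ x ∈ hη.pts o R ω, ∑ y ∈ hη.pts o R ω, g (x, y, toConfig η ω) := by
  rw [empTwo, lintegral_finsetSum_measure]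
  refine Finset.sum_congr rfl fun x _ => ?_
  rw [lintegral_finsetSum_measure]
  exact Finset.sum_congr rfl fun y _ => lintegral_dirac' _ hg

lemma measurable_add_one (hη : IsPoissonProcess P η μ) :
    Measurable fun p : HSpace n × Ω => (p.1, addPoint p.1 (toConfig η p.2)) :=
  measurable_fst.prodMk (measurable_addPoint.comp
    (measurable_fst.prodMk (hη.measurable_toConfig.comp measurable_snd)))

lemma measurable_add_two (hη : IsPoissonProcess P η μ) :
    Measurable fun p : HSpace n × HSpace n × Ω =>
      (p.1, p.2.1, addPoint p.1 (addPoint p.2.1 (toConfig η p.2.2))) := by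
  refine measurable_fst.prodMk ((measurable_fst.comp measurable_snd).prodMk ?_)
  have h1 : Measurable fun p : HSpace n × HSpace n × Ω => addPoint p.2.1 (toConfig η p.2.2) :=
    measurable_addPoint.comp ((measurable_fst.comp measurable_snd).prodMk
      (hη.measurable_toConfig.comp (measurable_snd.comp measurable_snd)))
  exact measurable_addPoint.comp (measurable_fst.prodMk h1)

/-- The Mecke formula. -/
theorem mecke_one [IsProbabilityMeasure P] (hη : IsPoissonProcess P η μ) [SFinite μ] (hfin : μ (hball o R) ≠ ∞)
    {g : HSpace n × Config n → ℝ≥0∞} (hg : Measurable g) :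
    ∫⁻ ω, ∑ x ∈ hη.pts o R ω, g (x, toConfig η ω) ∂P =
      ∫⁻ x in hball o R, ∫⁻ ω, g (x, addPoint x (toConfig η ω)) ∂P ∂μ := by
  have hmeas := measurable_empOne (o := o) (R := R) hη
  have hK := measurableSet_hball o R
  -- Both sides are finite measures on points and configurations, compared on the generating
  -- rectangles `A ×ˢ voidSet B`; adding `x` leaves `B` empty iff it was empty and `x ∉ B`.
  have heq : P.bind (empOne hη o R) = ((μ.restrict (hball o R)).prod P).map
      fun p : HSpace n × Ω => (p.1, addPoint p.1 (toConfig η p.2)) := by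
    have hb : ∀ s ∈ rects n, P.bind (empOne hη o R) s = ((μ.restrict (hball o R)).prod P).map
        (fun p : HSpace n × Ω => (p.1, addPoint p.1 (toConfig η p.2))) s := by
      rintro _ ⟨A, hA, _, ⟨B, hB, rfl⟩, rfl⟩
      have hA : MeasurableSet A := hA
      rw [Measure.bind_apply (hA.prod (measurableSet_voidSet hB)) hmeas.aemeasurable,
        Measure.map_apply (measurable_add_one hη) (hA.prod (measurableSet_voidSet hB))]
      simp_rw [empOne_rect hη hA hB]
      rw [lintegral_encard_mul_void hη (hK.inter hA) hB
        (measure_ne_top_of_subset Set.inter_subset_left hfin)]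
      have : (fun p : HSpace n × Ω => (p.1, addPoint p.1 (toConfig η p.2))) ⁻¹' (A ×ˢ voidSet B) =
          (A \ B) ×ˢ {ω | Disjoint (η ω) B} := by
        ext p
        show p.1 ∈ A ∧ addPoint p.1 (toConfig η p.2) ∈ voidSet B ↔ _
        rw [addPoint_mem_voidSet, ← and_assoc]
        rfl
      rw [this, Measure.prod_prod, Measure.restrict_apply (hA.diff hB)]
      congr 2
      ext z
      simp only [Set.mem_sdiff, Set.mem_inter_iff]
      tauto
    have : IsFiniteMeasure (P.bind (empOne hη o R)) := by
      refine ⟨?_⟩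
      rw [hb _ univ_mem_rects, Measure.map_apply (measurable_add_one hη) MeasurableSet.univ,
        Set.preimage_univ, ← Set.univ_prod_univ, Measure.prod_prod]
      simpa using hfin.lt_top
    exact ext_of_generate_finite _ generateFrom_rects isPiSystem_rects hb (hb _ univ_mem_rects)
  have h := Measure.lintegral_bind (m := P) hmeas.aemeasurable hg.aemeasurable
  simp_rw [lintegral_empOne hη hg] at h
  rw [← h, heq, lintegral_map hg (measurable_add_one hη)]
  exact lintegral_prod _ (hg.comp (measurable_add_one hη)).aemeasurable

/-- The bivariate Mecke formula, including the diagonal. -/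
theorem mecke_two [IsProbabilityMeasure P] (hη : IsPoissonProcess P η μ) [SFinite μ] (hfin : μ (hball o R) ≠ ∞)
    {g : HSpace n × HSpace n × Config n → ℝ≥0∞} (hg : Measurable g) :
    ∫⁻ ω, ∑ x ∈ hη.pts o R ω, ∑ y ∈ hη.pts o R ω, g (x, y, toConfig η ω) ∂P =
      (∫⁻ x in hball o R, ∫⁻ y in hball o R,
        ∫⁻ ω, g (x, y, addPoint x (addPoint y (toConfig η ω))) ∂P ∂μ ∂μ) +
      ∫⁻ x in hball o R, ∫⁻ ω, g (x, x, addPoint x (toConfig η ω)) ∂P ∂μ := by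
  have hmeas := measurable_empTwo (o := o) (R := R) hη
  have hK := measurableSet_hball o R
  have hone := measurable_add_one hη
  have htwo := measurable_add_two hη
  have hdiag : Measurable fun p : HSpace n × Ω => (p.1, p.1, addPoint p.1 (toConfig η p.2)) :=
    measurable_fst.prodMk hone
  set ν := μ.restrict (hball o R) with hν
  have heq : P.bind (empTwo hη o R) = (ν.prod (ν.prod P)).map
      (fun p : HSpace n × HSpace n × Ω =>
        (p.1, p.2.1, addPoint p.1 (addPoint p.2.1 (toConfig η p.2.2)))) +
      (ν.prod P).map fun p : HSpace n × Ω => (p.1, p.1, addPoint p.1 (toConfig η p.2)) := by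
    have hb : ∀ s ∈ rects₂ n, P.bind (empTwo hη o R) s = ((ν.prod (ν.prod P)).map
      (fun p : HSpace n × HSpace n × Ω =>
        (p.1, p.2.1, addPoint p.1 (addPoint p.2.1 (toConfig η p.2.2)))) +
      (ν.prod P).map fun p : HSpace n × Ω => (p.1, p.1, addPoint p.1 (toConfig η p.2))) s := by
      rintro _ ⟨A, hA, _, ⟨A', hA', _, ⟨B, hB, rfl⟩, rfl⟩, rfl⟩
      have hA : MeasurableSet A := hA
      have hA' : MeasurableSet A' := hA'
      have hS := hA.prod (hA'.prod (measurableSet_voidSet hB))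
      rw [Measure.bind_apply hS hmeas.aemeasurable, Measure.add_apply,
        Measure.map_apply htwo hS, Measure.map_apply hdiag hS]
      simp_rw [empTwo_rect hη hA hA' hB]
      rw [lintegral_encard_mul_encard_mul_void hη (hK.inter hA) (hK.inter hA') hB
        (measure_ne_top_of_subset Set.inter_subset_left hfin)
        (measure_ne_top_of_subset Set.inter_subset_left hfin)]
      have e1 : (fun p : HSpace n × HSpace n × Ω =>
          (p.1, p.2.1, addPoint p.1 (addPoint p.2.1 (toConfig η p.2.2)))) ⁻¹'
          (A ×ˢ A' ×ˢ voidSet B) = (A \ B) ×ˢ (A' \ B) ×ˢ {ω | Disjoint (η ω) B} := by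
        ext p
        show p.1 ∈ A ∧ p.2.1 ∈ A' ∧ addPoint p.1 (addPoint p.2.1 (toConfig η p.2.2)) ∈ voidSet B ↔
          (p.1 ∈ A ∧ p.1 ∉ B) ∧ (p.2.1 ∈ A' ∧ p.2.1 ∉ B) ∧ toConfig η p.2.2 ∈ voidSet B
        rw [addPoint_mem_voidSet, addPoint_mem_voidSet]
        tauto
      have e2 : (fun p : HSpace n × Ω => (p.1, p.1, addPoint p.1 (toConfig η p.2))) ⁻¹'
          (A ×ˢ A' ×ˢ voidSet B) = ((A ∩ A') \ B) ×ˢ {ω | Disjoint (η ω) B} := by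
        ext p
        show p.1 ∈ A ∧ p.1 ∈ A' ∧ addPoint p.1 (toConfig η p.2) ∈ voidSet B ↔
          ((p.1 ∈ A ∧ p.1 ∈ A') ∧ p.1 ∉ B) ∧ toConfig η p.2 ∈ voidSet B
        rw [addPoint_mem_voidSet]
        tauto
      have e3 : ∀ S, MeasurableSet S → ν (S \ B) = μ ((hball o R ∩ S) \ B) := by
        intro S hS
        rw [hν, Measure.restrict_apply (hS.diff hB)]
        congr 1
        ext z
        simp only [Set.mem_sdiff, Set.mem_inter_iff]
        tauto
      rw [e1, e2, Measure.prod_prod, Measure.prod_prod, Measure.prod_prod, e3 A hA, e3 A' hA',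
        e3 _ (hA.inter hA'), ← Set.inter_inter_distrib_left]
      ring
    have : IsFiniteMeasure (P.bind (empTwo hη o R)) := by
      have hνf : IsFiniteMeasure ν := ⟨by simpa [hν] using hfin.lt_top⟩
      refine ⟨?_⟩
      rw [hb _ univ_mem_rects₂]
      exact measure_lt_top _ _
    exact ext_of_generate_finite _ generateFrom_rects₂ isPiSystem_rects₂ hb (hb _ univ_mem_rects₂)
  have h := Measure.lintegral_bind (m := P) hmeas.aemeasurable hg.aemeasurable
  simp_rw [lintegral_empTwo hη hg] at h
  rw [← h, heq, lintegral_add_measure, lintegral_map hg htwo, lintegral_map hg hdiag]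
  congr 1
  · refine (lintegral_prod _ (hg.comp htwo).aemeasurable).trans (lintegral_congr fun x => ?_)
    exact lintegral_prod _ ((hg.comp htwo).comp measurable_prodMk_left).aemeasurable
  · exact lintegral_prod _ (hg.comp hdiag).aemeasurable

end Mecke

/-! ### The measure with distribution function `s ^ β` -/

/-- The measure `β s^(β-1) ds` on `(0, ∞)`. -/
def lam (β : ℝ) : Measure ℝ :=
  (volume.restrict (Set.Ioi 0)).withDensity fun s => ENNReal.ofReal (β * s ^ (β - 1))

instance (β : ℝ) : SFinite (lam β) := by unfold lam; infer_instance

lemma ae_lam_pos (β : ℝ) : ∀ᵐ s ∂lam β, 0 < s :=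
  (withDensity_absolutelyContinuous _ _).ae_le (ae_restrict_mem measurableSet_Ioi)

lemma ae_lam_prod_pos (β : ℝ) : ∀ᵐ p ∂(lam β).prod (lam β), 0 < p.1 ∧ 0 < p.2 := by
  have h1 := Measure.quasiMeasurePreserving_fst (μ := lam β) (ν := lam β) |>.ae (ae_lam_pos β)
  have h2 := Measure.quasiMeasurePreserving_snd (μ := lam β) (ν := lam β) |>.ae (ae_lam_pos β)
  filter_upwards [h1, h2] with p hp hp' using ⟨hp, hp'⟩

lemma lam_Iic {β a : ℝ} (hβ : 0 < β) (ha : 0 ≤ a) : lam β (Set.Iic a) = ENNReal.ofReal (a ^ β) := by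
  have hint : IntervalIntegrable (fun s : ℝ => β * s ^ (β - 1)) volume 0 a :=
    (intervalIntegral.intervalIntegrable_rpow' (by linarith)).const_mul β
  rw [lam, withDensity_apply _ measurableSet_Iic, Measure.restrict_restrict measurableSet_Iic,
    Set.Iic_inter_Ioi, ← ofReal_integral_eq_lintegral_ofReal
      ((intervalIntegrable_iff_integrableOn_Ioc_of_le ha).1 hint)
      ((ae_restrict_mem measurableSet_Ioc).mono fun s hs =>
        mul_nonneg hβ.le (Real.rpow_nonneg hs.1.le _)),
    ← intervalIntegral.integral_of_le ha, intervalIntegral.integral_const_mul,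
    integral_rpow (Or.inl (by linarith))]
  congr 1
  rw [sub_add_cancel, Real.zero_rpow hβ.ne', sub_zero]
  field_simp

/-- Layer cake: `f ω ^ β` is the `lam β`-mass of the levels `s ≤ f ω`. For edge lengths the events
on the right are void events. -/
lemma lintegral_rpow_eq {Ω : Type*} [MeasurableSpace Ω] {P : Measure Ω} [SFinite P] {f : Ω → ℝ}
    (hf : Measurable f) (hf0 : ∀ ω, 0 ≤ f ω) {β : ℝ} (hβ : 0 < β) :
    ∫⁻ ω, ENNReal.ofReal (f ω ^ β) ∂P = ∫⁻ s, P {ω | s ≤ f ω} ∂lam β := by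
  have hS : MeasurableSet {p : Ω × ℝ | p.2 ≤ f p.1} :=
    measurableSet_le measurable_snd (hf.comp measurable_fst)
  calc _ = ∫⁻ ω, lam β (Prod.mk ω ⁻¹' {p : Ω × ℝ | p.2 ≤ f p.1}) ∂P :=
        lintegral_congr fun ω => (lam_Iic hβ (hf0 ω)).symm
    _ = _ := by rw [← Measure.prod_apply hS, Measure.prod_apply_symm hS]; rfl

lemma lintegral_rpow_mul_rpow_eq {Ω : Type*} [MeasurableSpace Ω] {P : Measure Ω} [SFinite P]
    {f g : Ω → ℝ} (hf : Measurable f) (hf0 : ∀ ω, 0 ≤ f ω) (hg : Measurable g)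
    (hg0 : ∀ ω, 0 ≤ g ω) {β : ℝ} (hβ : 0 < β) :
    ∫⁻ ω, ENNReal.ofReal (f ω ^ β) * ENNReal.ofReal (g ω ^ β) ∂P =
      ∫⁻ p, P {ω | p.1 ≤ f ω ∧ p.2 ≤ g ω} ∂(lam β).prod (lam β) := by
  have hS : MeasurableSet {q : Ω × ℝ × ℝ | q.2.1 ≤ f q.1 ∧ q.2.2 ≤ g q.1} :=
    (measurableSet_le (measurable_fst.comp measurable_snd) (hf.comp measurable_fst)).inter
      (measurableSet_le (measurable_snd.comp measurable_snd) (hg.comp measurable_fst))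
  calc _ = ∫⁻ ω, (lam β).prod (lam β)
        (Prod.mk ω ⁻¹' {q : Ω × ℝ × ℝ | q.2.1 ≤ f q.1 ∧ q.2.2 ≤ g q.1}) ∂P := by
        refine lintegral_congr fun ω => ?_
        rw [← lam_Iic hβ (hf0 ω), ← lam_Iic hβ (hg0 ω), ← Measure.prod_prod]
        rfl
    _ = _ := by rw [← Measure.prod_apply hS, Measure.prod_apply_symm hS]; rfl

/-! ### Void probabilities -/

/-- The points at distance less than `s` from `x` at a higher level of `b`. -/
def region (b : HSpace n → ℝ) (x : HSpace n) (s : ℝ) : Set (HSpace n) :=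
  {z | b x < b z ∧ hdist x z < s}

/-- The probability that neither `F` nor a Poisson process of intensity `γ` meets `A`. -/
def voidP (γ : ℝ) (F A : Set (HSpace n)) : ℝ≥0∞ :=
  open Classical in
  if Disjoint F A then ENNReal.ofReal (Real.exp (-γ * (hvol n A).toReal)) else 0

/-- The moment of order `β` of the edge length at `x`. -/
def momOne (γ β : ℝ) (b : HSpace n → ℝ) (F : Set (HSpace n)) (x : HSpace n) : ℝ≥0∞ :=
  ∫⁻ s, voidP γ F (region b x s) ∂lam β

/-- The mixed moment of the edge lengths at `x` and `y`. -/
def momTwo (γ α : ℝ) (b : HSpace n → ℝ) (F : Set (HSpace n)) (x y : HSpace n) : ℝ≥0∞ :=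
  ∫⁻ p, voidP γ (F ∪ {x, y}) (region b x p.1 ∪ region b y p.2) ∂(lam α).prod (lam α)

/-- The covariance of the edge lengths at `x` and `y`. -/
def covKer (γ α : ℝ) (b : HSpace n → ℝ) (F : Set (HSpace n)) (x y : HSpace n) : ℝ :=
  (momTwo γ α b F x y).toReal - (momOne γ α b F x).toReal * (momOne γ α b F y).toReal

lemma region_subset_hball (b : HSpace n → ℝ) (x : HSpace n) (s : ℝ) :
    region b x s ⊆ hball x s := fun _ hz => hz.2

lemma notMem_region_self (b : HSpace n → ℝ) (x : HSpace n) (s : ℝ) : x ∉ region b x s :=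
  fun h => lt_irrefl _ h.1

lemma hvol_region_lt_top (b : HSpace n → ℝ) (x : HSpace n) (s : ℝ) : hvol n (region b x s) < ∞ :=
  (measure_mono (region_subset_hball b x s)).trans_lt (hvol_hball_lt_top x s)

lemma hvol_region_union_lt_top (b : HSpace n → ℝ) (x y : HSpace n) (s t : ℝ) :
    hvol n (region b x s ∪ region b y t) < ∞ :=
  measure_union_lt_top (hvol_region_lt_top b x s) (hvol_region_lt_top b y t)

lemma measurableSet_region {b : HSpace n → ℝ} (hb : Measurable b) (x : HSpace n) (s : ℝ) :
    MeasurableSet (region b x s) :=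
  (measurableSet_lt measurable_const hb).inter (measurableSet_hball x s)

lemma voidP_le_one {γ : ℝ} (hγ : 0 < γ) (F A : Set (HSpace n)) : voidP γ F A ≤ 1 := by
  unfold voidP
  split_ifs
  · rw [← ENNReal.ofReal_one]
    refine ENNReal.ofReal_le_ofReal (Real.exp_le_one_iff.2 ?_)
    have : 0 ≤ (hvol n A).toReal := ENNReal.toReal_nonneg
    nlinarith
  · exact zero_le_one

lemma voidP_anti {γ : ℝ} (hγ : 0 < γ) {F F' A A' : Set (HSpace n)} (hF : F ⊆ F') (hA : A ⊆ A')
    (hfin : hvol n A' < ∞) : voidP γ F' A' ≤ voidP γ F A := by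
  unfold voidP
  by_cases h : Disjoint F' A'
  · rw [if_pos h, if_pos (h.mono hF hA)]
    refine ENNReal.ofReal_le_ofReal (Real.exp_le_exp.2 ?_)
    have := ENNReal.toReal_mono hfin.ne (measure_mono hA)
    nlinarith
  · rw [if_neg h]
    exact zero_le

/-- The tail bound for the edge length at `x`. -/
def TailBound (γ : ℝ) (b : HSpace n → ℝ) (F : Set (HSpace n)) (x : HSpace n) : Prop :=
  ∀ s, 0 < s → voidP γ F (region b x s) ≤ ENNReal.ofReal (Real.exp (-γ * ballVol n (s / 2)))

/-- The reduced tail function. -/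
def tailFun (n : ℕ) (γ s : ℝ) : ℝ≥0∞ := ENNReal.ofReal (Real.exp (-(γ / 4) * ballVol n (s / 2)))

/-- The integral of the reduced tail function. -/
def tailInt (n : ℕ) (γ β : ℝ) : ℝ≥0∞ := ∫⁻ s, tailFun n γ s ∂lam β

/-- The decay function of the covariance. -/
def covDecay (n : ℕ) (γ d : ℝ) : ℝ := Real.exp (-(γ / 2) * ballVol n (d / 4))

lemma covDecay_nonneg (γ d : ℝ) : 0 ≤ covDecay n γ d := (Real.exp_pos _).le

lemma measurable_ballVol : Measurable (ballVol n) := ballVol_mono.measurable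

lemma measurable_tailFun (γ : ℝ) : Measurable (tailFun n γ) := by
  unfold tailFun
  have : Measurable fun s : ℝ => ballVol n (s / 2) :=
    measurable_ballVol.comp (measurable_id.div_const 2)
  fun_prop

lemma measurable_covDecay (γ : ℝ) : Measurable (covDecay n γ) := by
  unfold covDecay
  have : Measurable fun s : ℝ => ballVol n (s / 4) :=
    measurable_ballVol.comp (measurable_id.div_const 4)
  fun_prop

/-- The linear lower bound on ball volumes reduces this to a Gamma integral with rate `k`. -/
lemma tailInt_lt_top {γ β : ℝ} (hγ : 0 < γ) (hβ : 0 < β) : tailInt n γ β < ∞ := by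
  set v := ballVol n 1 with hv
  have hv0 : 0 < v := ballVol_pos one_pos
  set k := γ / 4 * (v / 4) with hk
  have hk0 : 0 < k := by positivity
  set C := Real.exp (γ / 4 * (v / 2)) with hC
  have hint := integrableOn_rpow_mul_exp_neg_mul_rpow (p := 1) (s := β - 1) (b := k)
    (by linarith) one_pos hk0
  have hint' : IntegrableOn (fun s : ℝ => β * C * (s ^ (β - 1) * Real.exp (-k * s ^ (1 : ℝ))))
    (Set.Ioi 0) := hint.const_mul (β * C)
  unfold tailInt lam
  rw [lintegral_withDensity_eq_lintegral_mul _ (by fun_prop) (measurable_tailFun γ)]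
  refine lt_of_le_of_lt (setLIntegral_mono' measurableSet_Ioi fun s hs => ?_)
    hint'.setLIntegral_lt_top
  have hs0 : 0 < s := hs
  simp only [Pi.mul_apply, tailFun]
  rw [← ENNReal.ofReal_mul (by positivity)]
  refine ENNReal.ofReal_le_ofReal ?_
  have h1 : Real.exp (-(γ / 4) * ballVol n (s / 2)) ≤ C * Real.exp (-k * s ^ (1 : ℝ)) := by
    rw [hC, ← Real.exp_add, Real.rpow_one]
    refine Real.exp_le_exp.2 ?_
    have := ballVol_linear (n := n) (s / 2)
    rw [← hv] at this
    nlinarith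
  calc β * s ^ (β - 1) * Real.exp (-(γ / 4) * ballVol n (s / 2)) ≤
        β * s ^ (β - 1) * (C * Real.exp (-k * s ^ (1 : ℝ))) := by gcongr
    _ = _ := by ring

lemma TailBound.le_tailFun {γ : ℝ} (hγ : 0 < γ) {b : HSpace n → ℝ} {F : Set (HSpace n)}
    {x : HSpace n} (h : TailBound γ b F x) {s : ℝ} (hs : 0 < s) :
    voidP γ F (region b x s) ≤ tailFun n γ s := by
  refine (h s hs).trans (ENNReal.ofReal_le_ofReal (Real.exp_le_exp.2 ?_))
  have := ballVol_nonneg (n := n) (s / 2)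
  nlinarith

lemma TailBound.momOne_le {γ β : ℝ} (hγ : 0 < γ) {b : HSpace n → ℝ} {F : Set (HSpace n)}
    {x : HSpace n} (h : TailBound γ b F x) : momOne γ β b F x ≤ tailInt n γ β :=
  lintegral_mono_ae ((ae_lam_pos β).mono fun _ hs => h.le_tailFun hγ hs)

lemma TailBound.momOne_lt_top {γ β : ℝ} (hγ : 0 < γ) (hβ : 0 < β) {b : HSpace n → ℝ}
    {F : Set (HSpace n)} {x : HSpace n} (h : TailBound γ b F x) : momOne γ β b F x < ∞ :=
  (h.momOne_le hγ).trans_lt (tailInt_lt_top hγ hβ)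

/-- Since `max s t > d / 2`, the exponent `γ V(max s t / 2)` can be shared out: one half pays for
the decay in `d`, one quarter each for the tails in `s` and `t`. -/
lemma voidP_le_of_lt {γ : ℝ} (hγ : 0 < γ) {d s t : ℝ} (hst : d < s + t) {v : ℝ≥0∞}
    (h1 : v ≤ ENNReal.ofReal (Real.exp (-γ * ballVol n (s / 2))))
    (h2 : v ≤ ENNReal.ofReal (Real.exp (-γ * ballVol n (t / 2)))) :
    v ≤ ENNReal.ofReal (covDecay n γ d) * (tailFun n γ s * tailFun n γ t) := by
  have h : v ≤ ENNReal.ofReal (Real.exp (-γ * ballVol n (max s t / 2))) := by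
    rcases max_choice s t with h | h <;> rw [h] <;> assumption
  refine h.trans ?_
  unfold covDecay tailFun
  rw [← ENNReal.ofReal_mul (Real.exp_pos _).le, ← ENNReal.ofReal_mul (Real.exp_pos _).le,
    ← Real.exp_add, ← Real.exp_add]
  refine ENNReal.ofReal_le_ofReal (Real.exp_le_exp.2 ?_)
  have l1 := le_max_left s t
  have l2 := le_max_right s t
  have m1 := ballVol_mono (n := n) (show s / 2 ≤ max s t / 2 by linarith)
  have m2 := ballVol_mono (n := n) (show t / 2 ≤ max s t / 2 by linarith)
  have m3 := ballVol_mono (n := n) (show d / 4 ≤ max s t / 2 by linarith)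
  nlinarith

/-- The regions lie in disjoint balls, so their volumes add, and neither contains `x` or `y`, so the
added points do not matter. -/
lemma voidP_pair_eq {γ : ℝ} {b : HSpace n → ℝ} (hb : Measurable b)
    (F : Set (HSpace n)) {x y : HSpace n} {s t : ℝ} (hs : 0 < s) (ht : 0 < t)
    (hst : s + t ≤ hdist x y) :
    voidP γ (F ∪ {x, y}) (region b x s ∪ region b y t) =
      voidP γ F (region b x s) * voidP γ F (region b y t) := by
  have hy : y ∉ region b x s := fun h => by
    have : hdist x y < s := h.2
    linarith
  have hx : x ∉ region b y t := fun h => by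
    have : hdist y x < t := h.2
    rw [hdist_comm] at this
    linarith
  have hdis : Disjoint (F ∪ {x, y}) (region b x s ∪ region b y t) ↔
      Disjoint F (region b x s) ∧ Disjoint F (region b y t) := by
    have : Disjoint ({x, y} : Set (HSpace n)) (region b x s ∪ region b y t) := by
      simp [Set.disjoint_insert_left, hx, hy, notMem_region_self]
    rw [Set.disjoint_union_left, Set.disjoint_union_right]
    simp [this]
  have hvol : (hvol n (region b x s ∪ region b y t)).toReal =
      (hvol n (region b x s)).toReal + (hvol n (region b y t)).toReal := by
    rw [measure_union ((disjoint_hball hst).mono (region_subset_hball _ _ _)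
      (region_subset_hball _ _ _)) (measurableSet_region hb y t),
      ENNReal.toReal_add (hvol_region_lt_top _ _ _).ne (hvol_region_lt_top _ _ _).ne]
  unfold voidP
  by_cases h1 : Disjoint F (region b x s)
  · by_cases h2 : Disjoint F (region b y t)
    · rw [if_pos (hdis.2 ⟨h1, h2⟩), if_pos h1, if_pos h2, hvol, mul_add, Real.exp_add,
        ENNReal.ofReal_mul (Real.exp_pos _).le]
    · rw [if_neg fun h => h2 (hdis.1 h).2, if_neg h2, mul_zero]
  · rw [if_neg fun h => h1 (hdis.1 h).1, if_neg h1, zero_mul]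

/-- Equality for `s + t ≤ d(x, y)`; otherwise both quantities are separately below the error term.
Two one-sided bounds avoid the truncated subtraction of `ℝ≥0∞`. -/
lemma voidP_pair_bounds {γ : ℝ} (hγ : 0 < γ) {b : HSpace n → ℝ} (hb : Measurable b)
    {F : Set (HSpace n)} {x y : HSpace n} (hx : TailBound γ b F x) (hy : TailBound γ b F y)
    {s t : ℝ} (hs : 0 < s) (ht : 0 < t) :
    voidP γ (F ∪ {x, y}) (region b x s ∪ region b y t) ≤
      voidP γ F (region b x s) * voidP γ F (region b y t) +
        ENNReal.ofReal (covDecay n γ (hdist x y)) * (tailFun n γ s * tailFun n γ t) ∧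
    voidP γ F (region b x s) * voidP γ F (region b y t) ≤
      voidP γ (F ∪ {x, y}) (region b x s ∪ region b y t) +
        ENNReal.ofReal (covDecay n γ (hdist x y)) * (tailFun n γ s * tailFun n γ t) := by
  rcases le_or_gt (s + t) (hdist x y) with h | h
  · rw [voidP_pair_eq hb F hs ht h]
    exact ⟨le_self_add, le_self_add⟩
  · have hfin := hvol_region_union_lt_top b x y s t
    constructor
    · refine le_trans (voidP_le_of_lt hγ h ?_ ?_) le_add_self
      · exact (voidP_anti hγ Set.subset_union_left Set.subset_union_left hfin).trans (hx s hs)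
      · exact (voidP_anti hγ Set.subset_union_left Set.subset_union_right hfin).trans (hy t ht)
    · refine le_trans (voidP_le_of_lt hγ h ?_ ?_) le_add_self
      · exact (mul_le_of_le_one_right zero_le (voidP_le_one hγ _ _)).trans (hx s hs)
      · exact (mul_le_of_le_one_left zero_le (voidP_le_one hγ _ _)).trans (hy t ht)

/-! ### Measurability -/

lemma measurable_voidP {T : Type*} [MeasurableSpace T] (γ : ℝ) {G A : T → Set (HSpace n)}
    (hA : MeasurableSet {p : T × HSpace n | p.2 ∈ A p.1})
    (hG : MeasurableSet {t | Disjoint (G t) (A t)}) : Measurable fun t => voidP γ (G t) (A t) := by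
  unfold voidP
  refine Measurable.ite hG ?_ measurable_const
  have h : Measurable fun t => hvol n (A t) := measurable_measure_prodMk_left hA
  have := h.ennreal_toReal
  fun_prop

lemma measurableSet_mem_region {T : Type*} [MeasurableSpace T] {b : HSpace n → ℝ}
    (hb : Measurable b) {x z : T → HSpace n} {s : T → ℝ} (hx : Measurable x) (hz : Measurable z)
    (hs : Measurable s) : MeasurableSet {p | z p ∈ region b (x p) (s p)} :=
  (measurableSet_lt (hb.comp hx) (hb.comp hz)).inter
    (measurableSet_lt (measurable_hdist.comp (hx.prodMk hz)) hs)

lemma measurable_voidP_region (γ : ℝ) {b : HSpace n → ℝ} (hb : Measurable b)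
    {F : Set (HSpace n)} (hF : F.Countable) :
    Measurable fun q : HSpace n × ℝ => voidP γ F (region b q.1 q.2) := by
  refine measurable_voidP γ (G := fun _ => F) ?_ ?_
  · exact measurableSet_mem_region hb (measurable_fst.comp measurable_fst) measurable_snd
      (measurable_snd.comp measurable_fst)
  · have : {q : HSpace n × ℝ | Disjoint F (region b q.1 q.2)} =
        ⋂ z ∈ F, {q : HSpace n × ℝ | z ∈ region b q.1 q.2}ᶜ := by
      ext q
      simp [Set.disjoint_left]
    rw [this]
    exact MeasurableSet.biInter hF fun z _ =>
      (measurableSet_mem_region hb measurable_fst measurable_const measurable_snd).compl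

lemma measurable_voidP_pair (γ : ℝ) {b : HSpace n → ℝ} (hb : Measurable b)
    {F : Set (HSpace n)} (hF : F.Countable) :
    Measurable fun q : (HSpace n × HSpace n) × ℝ × ℝ =>
      voidP γ (F ∪ {q.1.1, q.1.2}) (region b q.1.1 q.2.1 ∪ region b q.1.2 q.2.2) := by
  have key : ∀ z : (HSpace n × HSpace n) × ℝ × ℝ → HSpace n, Measurable z →
      MeasurableSet {q : (HSpace n × HSpace n) × ℝ × ℝ |
        z q ∈ region b q.1.1 q.2.1 ∪ region b q.1.2 q.2.2} := fun z hz =>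
    (measurableSet_mem_region hb (by fun_prop) hz (by fun_prop)).union
      (measurableSet_mem_region hb (by fun_prop) hz (by fun_prop))
  refine measurable_voidP γ (G := fun q : (HSpace n × HSpace n) × ℝ × ℝ => F ∪ {q.1.1, q.1.2})
    ?_ ?_
  · exact (measurableSet_mem_region hb (by fun_prop) measurable_snd (by fun_prop)).union
      (measurableSet_mem_region hb (by fun_prop) measurable_snd (by fun_prop))
  · have : {q : (HSpace n × HSpace n) × ℝ × ℝ | Disjoint (F ∪ {q.1.1, q.1.2})
        (region b q.1.1 q.2.1 ∪ region b q.1.2 q.2.2)} =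
        (⋂ z ∈ F, {q : (HSpace n × HSpace n) × ℝ × ℝ |
          z ∈ region b q.1.1 q.2.1 ∪ region b q.1.2 q.2.2}ᶜ) ∩
        ({q : (HSpace n × HSpace n) × ℝ × ℝ |
          q.1.1 ∈ region b q.1.1 q.2.1 ∪ region b q.1.2 q.2.2}ᶜ ∩
        {q : (HSpace n × HSpace n) × ℝ × ℝ |
          q.1.2 ∈ region b q.1.1 q.2.1 ∪ region b q.1.2 q.2.2}ᶜ) := by
      ext q
      rw [Set.mem_ofPred_eq, Set.disjoint_union_left, Set.disjoint_insert_left,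
        Set.disjoint_singleton_left, Set.disjoint_left]
      simp
    rw [this]
    exact (MeasurableSet.biInter hF fun z _ => (key _ measurable_const).compl).inter
      ((key _ (by fun_prop)).compl.inter (key _ (by fun_prop)).compl)

lemma measurable_voidP_region_right (γ : ℝ) {b : HSpace n → ℝ} (hb : Measurable b)
    {F : Set (HSpace n)} (hF : F.Countable) (x : HSpace n) :
    Measurable fun s => voidP γ F (region b x s) :=
  (measurable_voidP_region γ hb hF).comp measurable_prodMk_left

lemma measurable_voidP_pair_right (γ : ℝ) {b : HSpace n → ℝ} (hb : Measurable b)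
    {F : Set (HSpace n)} (hF : F.Countable) (x y : HSpace n) :
    Measurable fun p : ℝ × ℝ => voidP γ (F ∪ {x, y}) (region b x p.1 ∪ region b y p.2) :=
  (measurable_voidP_pair γ hb hF).comp (measurable_prodMk_left (x := (x, y)))

lemma measurable_momOne (γ β : ℝ) {b : HSpace n → ℝ} (hb : Measurable b)
    {F : Set (HSpace n)} (hF : F.Countable) : Measurable (momOne γ β b F) :=
  (measurable_voidP_region γ hb hF).lintegral_prod_right'

lemma measurable_momTwo (γ α : ℝ) {b : HSpace n → ℝ} (hb : Measurable b)
    {F : Set (HSpace n)} (hF : F.Countable) :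
    Measurable fun q : HSpace n × HSpace n => momTwo γ α b F q.1 q.2 :=
  (measurable_voidP_pair γ hb hF).lintegral_prod_right'

lemma measurable_covKer (γ α : ℝ) {b : HSpace n → ℝ} (hb : Measurable b)
    {F : Set (HSpace n)} (hF : F.Countable) :
    Measurable fun q : HSpace n × HSpace n => covKer γ α b F q.1 q.2 := by
  have h1 := (measurable_momTwo γ α hb hF).ennreal_toReal
  have h2 := (measurable_momOne γ α hb hF).ennreal_toReal
  exact h1.sub ((h2.comp measurable_fst).mul (h2.comp measurable_snd))

/-! ### Decay of the covariance -/

lemma momTwo_bounds {γ α : ℝ} (hγ : 0 < γ) {b : HSpace n → ℝ} (hb : Measurable b)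
    {F : Set (HSpace n)} (hF : F.Countable) {x y : HSpace n} (hx : TailBound γ b F x)
    (hy : TailBound γ b F y) :
    momTwo γ α b F x y ≤ momOne γ α b F x * momOne γ α b F y +
      ENNReal.ofReal (covDecay n γ (hdist x y)) * (tailInt n γ α * tailInt n γ α) ∧
    momOne γ α b F x * momOne γ α b F y ≤ momTwo γ α b F x y +
      ENNReal.ofReal (covDecay n γ (hdist x y)) * (tailInt n γ α * tailInt n γ α) := by
  have mx := measurable_voidP_region_right γ hb hF x
  have my := measurable_voidP_region_right γ hb hF y
  have mt := measurable_tailFun (n := n) γ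
  have e1 : momOne γ α b F x * momOne γ α b F y = ∫⁻ p, voidP γ F (region b x p.1) *
      voidP γ F (region b y p.2) ∂(lam α).prod (lam α) :=
    (lintegral_prod_mul mx.aemeasurable my.aemeasurable).symm
  have mtt : Measurable fun p : ℝ × ℝ => tailFun n γ p.1 * tailFun n γ p.2 :=
    (mt.comp measurable_fst).mul (mt.comp measurable_snd)
  have e2 : ENNReal.ofReal (covDecay n γ (hdist x y)) * (tailInt n γ α * tailInt n γ α) =
      ∫⁻ p, ENNReal.ofReal (covDecay n γ (hdist x y)) * (tailFun n γ p.1 * tailFun n γ p.2)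
        ∂(lam α).prod (lam α) := by
    rw [lintegral_const_mul _ mtt]
    congr 1
    exact (lintegral_prod_mul mt.aemeasurable mt.aemeasurable).symm
  rw [e1, e2, momTwo, ← lintegral_add_right _ (mtt.const_mul _),
    ← lintegral_add_right _ (mtt.const_mul _)]
  exact ⟨lintegral_mono_ae ((ae_lam_prod_pos α).mono fun p hp =>
      (voidP_pair_bounds hγ hb hx hy hp.1 hp.2).1),
    lintegral_mono_ae ((ae_lam_prod_pos α).mono fun p hp =>
      (voidP_pair_bounds hγ hb hx hy hp.1 hp.2).2)⟩

lemma momTwo_lt_top {γ α : ℝ} (hγ : 0 < γ) (hα : 0 < α) {b : HSpace n → ℝ} (hb : Measurable b)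
    {F : Set (HSpace n)} (hF : F.Countable) {x y : HSpace n} (hx : TailBound γ b F x)
    (hy : TailBound γ b F y) : momTwo γ α b F x y < ∞ := by
  have ht := tailInt_lt_top (n := n) hγ hα
  refine (momTwo_bounds hγ hb hF hx hy).1.trans_lt (ENNReal.add_lt_top.2 ⟨?_, ?_⟩)
  · exact ENNReal.mul_lt_top (hx.momOne_lt_top hγ hα) (hy.momOne_lt_top hγ hα)
  · exact ENNReal.mul_lt_top ENNReal.ofReal_lt_top (ENNReal.mul_lt_top ht ht)

/-- The bound does not involve `b` or `F`, so it serves as dominating function while the centre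
moves to infinity, and again for the directed forest. -/
lemma abs_covKer_le {γ α : ℝ} (hγ : 0 < γ) (hα : 0 < α) {b : HSpace n → ℝ} (hb : Measurable b)
    {F : Set (HSpace n)} (hF : F.Countable) {x y : HSpace n} (hx : TailBound γ b F x)
    (hy : TailBound γ b F y) :
    |covKer γ α b F x y| ≤ (tailInt n γ α).toReal ^ 2 * covDecay n γ (hdist x y) := by
  have ht := (tailInt_lt_top (n := n) hγ hα).ne
  have h2 := (momTwo_lt_top hγ hα hb hF hx hy).ne
  have hx' := (hx.momOne_lt_top hγ hα).ne
  have hy' := (hy.momOne_lt_top hγ hα).ne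
  obtain ⟨b1, b2⟩ := momTwo_bounds (α := α) hγ hb hF hx hy
  have hc : 0 ≤ covDecay n γ (hdist x y) := (Real.exp_pos _).le
  have fin : ENNReal.ofReal (covDecay n γ (hdist x y)) * (tailInt n γ α * tailInt n γ α) ≠ ∞ :=
    ENNReal.mul_ne_top ENNReal.ofReal_ne_top (ENNReal.mul_ne_top ht ht)
  have c1 := ENNReal.toReal_mono (ENNReal.add_ne_top.2 ⟨ENNReal.mul_ne_top hx' hy', fin⟩) b1
  have c2 := ENNReal.toReal_mono (ENNReal.add_ne_top.2 ⟨h2, fin⟩) b2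
  rw [ENNReal.toReal_add (ENNReal.mul_ne_top hx' hy') fin] at c1
  rw [ENNReal.toReal_add h2 fin] at c2
  simp only [ENNReal.toReal_mul, ENNReal.toReal_ofReal hc] at c1 c2
  unfold covKer
  rw [abs_le]
  constructor <;> nlinarith

lemma integrable_covDecay {γ : ℝ} (hγ : 0 < γ) (x : HSpace n) :
    Integrable (fun y => covDecay n γ (hdist x y)) (hvol n) := by
  refine ⟨((measurable_covDecay γ).comp
    (continuous_hdist_right x).measurable).aestronglyMeasurable, ?_⟩
  rw [hasFiniteIntegral_iff_ofReal
    (Eventually.of_forall fun y => covDecay_nonneg γ (hdist x y))]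
  exact lintegral_exp_neg_ballVol_lt_top x (half_pos hγ)

lemma momTwo_comm (γ α : ℝ) {b : HSpace n → ℝ} (hb : Measurable b) {F : Set (HSpace n)}
    (hF : F.Countable) (x y : HSpace n) : momTwo γ α b F x y = momTwo γ α b F y x := by
  unfold momTwo
  have m := measurable_voidP_pair_right γ hb hF x y
  have h := lintegral_map (μ := (lam α).prod (lam α)) m measurable_swap
  rw [Measure.prod_swap] at h
  rw [h]
  refine lintegral_congr fun p => ?_
  rw [Set.pair_comm, Set.union_comm (region b x _)]
  rfl

lemma covKer_comm (γ α : ℝ) {b : HSpace n → ℝ} (hb : Measurable b) {F : Set (HSpace n)}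
    (hF : F.Countable) (x y : HSpace n) : covKer γ α b F x y = covKer γ α b F y x := by
  unfold covKer
  rw [momTwo_comm γ α hb hF, mul_comm]

/-! ### Invariance under isometries -/

/-- The level function of the radial structure with centre `c`. -/
def radLev (c : HSpace n) (z : HSpace n) : ℝ := -hdist c z

lemma measurable_radLev (c : HSpace n) : Measurable (radLev c) :=
  (continuous_hdist_right c).measurable.neg

lemma radLev_lt {c x y : HSpace n} : radLev c x < radLev c y ↔ hdist c y < hdist c x :=
  neg_lt_neg_iff

lemma IsIsom.preimage_region {φ : HSpace n ≃ᵐ HSpace n} (hφ : IsIsom φ) (c x : HSpace n) (s : ℝ) :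
    φ ⁻¹' region (radLev (φ c)) (φ x) s = region (radLev c) x s := by
  ext z
  simp [region, radLev, hφ.hdist_map]

lemma IsIsom.voidP_preimage {φ : HSpace n ≃ᵐ HSpace n} (hφ : IsIsom φ) (γ : ℝ)
    (F A : Set (HSpace n)) : voidP γ (φ '' F) A = voidP γ F (φ ⁻¹' A) := by
  unfold voidP
  rw [hφ.hvol_preimage, Set.disjoint_image_left]

lemma IsIsom.momOne_eq {φ : HSpace n ≃ᵐ HSpace n} (hφ : IsIsom φ) (γ β : ℝ) (c x : HSpace n) :
    momOne γ β (radLev (φ c)) {φ c} (φ x) = momOne γ β (radLev c) {c} x := by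
  unfold momOne
  simp_rw [← Set.image_singleton, hφ.voidP_preimage, hφ.preimage_region]

lemma IsIsom.momTwo_eq {φ : HSpace n ≃ᵐ HSpace n} (hφ : IsIsom φ) (γ α : ℝ) (c x y : HSpace n) :
    momTwo γ α (radLev (φ c)) {φ c} (φ x) (φ y) = momTwo γ α (radLev c) {c} x y := by
  unfold momTwo
  have : ({φ c} ∪ {φ x, φ y} : Set (HSpace n)) = φ '' ({c} ∪ {x, y}) := by
    simp [Set.image_insert_eq]
  simp_rw [this, hφ.voidP_preimage, Set.preimage_union, hφ.preimage_region]

lemma IsIsom.covKer_eq {φ : HSpace n ≃ᵐ HSpace n} (hφ : IsIsom φ) (γ α : ℝ) (c x y : HSpace n) :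
    covKer γ α (radLev (φ c)) {φ c} (φ x) (φ y) = covKer γ α (radLev c) {c} x y := by
  unfold covKer
  rw [hφ.momTwo_eq, hφ.momOne_eq, hφ.momOne_eq]

/-- The integrated covariance of the edge length at `x` with those at higher levels. -/
def covInt (γ α : ℝ) (b : HSpace n → ℝ) (F : Set (HSpace n)) (x : HSpace n) : ℝ :=
  ∫ y in {y | b x < b y}, covKer γ α b F x y ∂hvol n

lemma IsIsom.covInt_eq {φ : HSpace n ≃ᵐ HSpace n} (hφ : IsIsom φ) (γ α : ℝ) (c x : HSpace n) :
    covInt γ α (radLev (φ c)) {φ c} (φ x) = covInt γ α (radLev c) {c} x := by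
  unfold covInt
  rw [← hφ.measurePreserving.setIntegral_preimage_emb φ.measurableEmbedding]
  simp_rw [hφ.covKer_eq]
  congr 2
  ext z
  simp [radLev, hφ.hdist_map]

/-! ### From radial to directed structures -/

/-- For `s > d(c, x)` the root itself lies in the region and the void probability is zero; for
smaller `s` the region is a lens containing a ball of radius `s / 2`. -/
lemma tailBound_radLev {γ : ℝ} (hγ : 0 < γ) {c x : HSpace n} (hx : x ≠ c) :
    TailBound γ (radLev c) {c} x := by
  intro s hs
  unfold voidP
  split_ifs with h
  · have hs' : s ≤ hdist c x := by
      by_contra! hlt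
      refine Set.disjoint_singleton_left.1 h ⟨?_, by rwa [hdist_comm]⟩
      rw [radLev_lt, hdist_self]
      exact hdist_pos hx.symm
    refine ENNReal.ofReal_le_ofReal (Real.exp_le_exp.2 ?_)
    have h1 : ENNReal.ofReal (ballVol n (s / 2)) ≤ hvol n (region (radLev c) x s) := by
      refine (ballVol_le_lens hs.le hs').trans (measure_mono fun z hz => ⟨radLev_lt.2 hz.1, hz.2⟩)
    have h2 := ENNReal.toReal_mono (hvol_region_lt_top (radLev c) x s).ne h1
    rw [ENNReal.toReal_ofReal (ballVol_nonneg _)] at h2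
    nlinarith
  · exact zero_le

section Limit

variable (e : IdealPoint n)

lemma ae_lev_ne (x : HSpace n) : ∀ᵐ z ∂hvol n, lev e x ≠ lev e z := by
  have h := hvol_lev_eq_zero e (lev e x)
  rw [ae_iff]
  refine measure_mono_null (fun z hz => ?_) h
  simpa using (not_not.1 hz).symm

lemma eventually_mem_region_iff {x z : HSpace n} (h : lev e x ≠ lev e z) (s : ℝ) :
    ∀ᶠ t in atTop, (z ∈ region (radLev (idealRay e t)) x s ↔ z ∈ region (lev e) x s) := by
  filter_upwards [eventually_hdist_idealRay_lt_iff e h] with t ht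
  exact and_congr_left' ht

lemma tendsto_hdist_idealRay (x : HSpace n) :
    Tendsto (fun t => hdist x (idealRay e t)) atTop atTop :=
  (isGeodesicRay_idealRay e).tendsto_hdist x

lemma eventually_idealRay_notMem_region (x : HSpace n) (s : ℝ) :
    ∀ᶠ t in atTop, idealRay e t ∉ region (radLev (idealRay e t)) x s := by
  filter_upwards [(tendsto_hdist_idealRay e x).eventually_ge_atTop s] with t ht h
  have : hdist x (idealRay e t) < s := h.2
  linarith

lemma eventually_idealRay_ne (x : HSpace n) : ∀ᶠ t in atTop, x ≠ idealRay e t := by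
  filter_upwards [(tendsto_hdist_idealRay e x).eventually_gt_atTop 0] with t ht h
  rw [← h, hdist_self] at ht
  exact lt_irrefl _ ht

/-- Indicators converge off the horospheres through `x` and `y`, which are null, and all regions
stay in two fixed balls. -/
lemma tendsto_hvol_region_union (x y : HSpace n) (s t : ℝ) :
    Tendsto (fun r => hvol n (region (radLev (idealRay e r)) x s ∪
      region (radLev (idealRay e r)) y t)) atTop
      (𝓝 (hvol n (region (lev e) x s ∪ region (lev e) y t))) := by
  refine tendsto_measure_of_ae_tendsto_indicator atTop
    ((measurableSet_region (measurable_lev e) x s).union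
      (measurableSet_region (measurable_lev e) y t))
    (fun r => (measurableSet_region (measurable_radLev _) x s).union
      (measurableSet_region (measurable_radLev _) y t))
    ((measurableSet_hball x s).union (measurableSet_hball y t))
    (measure_union_lt_top (hvol_hball_lt_top x s) (hvol_hball_lt_top y t)).ne
    (Eventually.of_forall fun r => Set.union_subset_union (region_subset_hball _ _ _)
      (region_subset_hball _ _ _)) ?_
  filter_upwards [ae_lev_ne e x, ae_lev_ne e y] with z hx hy
  filter_upwards [eventually_mem_region_iff e hx s, eventually_mem_region_iff e hy t] with r h1 h2
  exact or_congr h1 h2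

lemma tendsto_hvol_region (x : HSpace n) (s : ℝ) :
    Tendsto (fun r => hvol n (region (radLev (idealRay e r)) x s)) atTop
      (𝓝 (hvol n (region (lev e) x s))) := by
  simpa using tendsto_hvol_region_union e x x s s

lemma tendsto_voidP {γ : ℝ} {G A : ℝ → Set (HSpace n)} {G' A' : Set (HSpace n)}
    (hfin : hvol n A' < ∞) (hA : Tendsto (fun r => hvol n (A r)) atTop (𝓝 (hvol n A')))
    (hG : ∀ᶠ r in atTop, (Disjoint (G r) (A r) ↔ Disjoint G' A')) :
    Tendsto (fun r => voidP γ (G r) (A r)) atTop (𝓝 (voidP γ G' A')) := by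
  unfold voidP
  by_cases h : Disjoint G' A'
  · rw [if_pos h]
    have h1 := (ENNReal.tendsto_toReal hfin.ne).comp hA
    have h2 := ENNReal.tendsto_ofReal ((Real.continuous_exp.tendsto _).comp (h1.const_mul (-γ)))
    refine h2.congr' ?_
    filter_upwards [hG] with r hr
    rw [if_pos (hr.2 h)]
    rfl
  · rw [if_neg h]
    refine tendsto_const_nhds.congr' ?_
    filter_upwards [hG] with r hr
    rw [if_neg fun h' => h (hr.1 h')]

lemma tendsto_voidP_region (γ : ℝ) (x : HSpace n) (s : ℝ) :
    Tendsto (fun r => voidP γ {idealRay e r} (region (radLev (idealRay e r)) x s)) atTop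
      (𝓝 (voidP γ ∅ (region (lev e) x s))) := by
  refine tendsto_voidP (hvol_region_lt_top _ _ _) (tendsto_hvol_region e x s) ?_
  filter_upwards [eventually_idealRay_notMem_region e x s] with r hr
  simp [hr]

/-- Inherited from the radial bound in the limit, so that no separate geometry of horoballs is
needed. -/
lemma tailBound_lev {γ : ℝ} (hγ : 0 < γ) (x : HSpace n) : TailBound γ (lev e) ∅ x := by
  intro s hs
  refine le_of_tendsto (tendsto_voidP_region e γ x s) ?_
  filter_upwards [eventually_idealRay_ne e x] with r hr
  exact tailBound_radLev hγ hr s hs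

/-- The volume estimate is recovered from the tail bound with `γ = 1` by comparing exponents. -/
lemma ballVol_le_region_lev (x : HSpace n) {s : ℝ} (hs : 0 < s) :
    ENNReal.ofReal (ballVol n (s / 2)) ≤ hvol n (region (lev e) x s) := by
  have h := tailBound_lev e one_pos x s hs
  unfold voidP at h
  rw [if_pos (Set.empty_disjoint _), ENNReal.ofReal_le_ofReal_iff (Real.exp_pos _).le,
    Real.exp_le_exp] at h
  rw [ENNReal.ofReal_le_iff_le_toReal (hvol_region_lt_top _ _ _).ne]
  linarith

/-- Infinite volume is what guarantees almost surely a directed neighbour. -/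
lemma hvol_upper_eq_top (x : HSpace n) : hvol n {z | lev e x < lev e z} = ∞ := by
  have h1 : Tendsto (fun s : ℝ => ENNReal.ofReal (ballVol n (s / 2))) atTop (𝓝 ∞) :=
    ENNReal.tendsto_ofReal_nhds_top.2
      (tendsto_ballVol.comp (tendsto_id.atTop_div_const (by norm_num)))
  refine top_le_iff.1 (le_of_tendsto h1 ?_)
  filter_upwards [eventually_gt_atTop 0] with s hs
  exact (ballVol_le_region_lev e x hs).trans (measure_mono fun z hz => hz.1)

lemma tendsto_voidP_pair (γ : ℝ) {x y : HSpace n} (hxy : lev e x ≠ lev e y) (s t : ℝ) :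
    Tendsto (fun r => voidP γ ({idealRay e r} ∪ {x, y}) (region (radLev (idealRay e r)) x s ∪
      region (radLev (idealRay e r)) y t)) atTop
      (𝓝 (voidP γ (∅ ∪ {x, y}) (region (lev e) x s ∪ region (lev e) y t))) := by
  refine tendsto_voidP (hvol_region_union_lt_top _ _ _ _ _) (tendsto_hvol_region_union e x y s t) ?_
  filter_upwards [eventually_idealRay_notMem_region e x s, eventually_idealRay_notMem_region e y t,
    eventually_mem_region_iff e hxy s, eventually_mem_region_iff e hxy.symm t] with r h1 h2 h3 h4
  simp [Set.disjoint_insert_left, h1, h2, h3, h4, notMem_region_self]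

lemma tendsto_momOne {γ β : ℝ} (hγ : 0 < γ) (hβ : 0 < β) (x : HSpace n) :
    Tendsto (fun r => momOne γ β (radLev (idealRay e r)) {idealRay e r} x) atTop
      (𝓝 (momOne γ β (lev e) ∅ x)) := by
  have hm : ∀ r, Measurable fun s =>
      voidP γ {idealRay e r} (region (radLev (idealRay e r)) x s) := fun r =>
    measurable_voidP_region_right γ (measurable_radLev (idealRay e r))
      (Set.countable_singleton (idealRay e r)) x
  refine tendsto_lintegral_filter_of_dominated_convergence (tailFun n γ)
    (Eventually.of_forall hm) ?_ (tailInt_lt_top hγ hβ).ne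
    (Eventually.of_forall fun s => tendsto_voidP_region e γ x s)
  filter_upwards [eventually_idealRay_ne e x] with r hr
  filter_upwards [ae_lam_pos β] with s hs
  exact (tailBound_radLev hγ hr).le_tailFun hγ hs

lemma voidP_pair_le {γ : ℝ} (hγ : 0 < γ) {b : HSpace n → ℝ} {F : Set (HSpace n)} {x y : HSpace n}
    (hx : TailBound γ b F x) (hy : TailBound γ b F y) {s t : ℝ} (hs : 0 < s) (ht : 0 < t) :
    voidP γ (F ∪ {x, y}) (region b x s ∪ region b y t) ≤ tailFun n γ s * tailFun n γ t := by
  have hfin := hvol_region_union_lt_top b x y s t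
  refine (voidP_le_of_lt hγ (d := 0) (add_pos hs ht)
    ((voidP_anti hγ Set.subset_union_left Set.subset_union_left hfin).trans (hx s hs))
    ((voidP_anti hγ Set.subset_union_left Set.subset_union_right hfin).trans (hy t ht))).trans ?_
  refine mul_le_of_le_one_left zero_le ?_
  rw [← ENNReal.ofReal_one]
  refine ENNReal.ofReal_le_ofReal (Real.exp_le_one_iff.2 ?_)
  have := ballVol_nonneg (n := n) (0 / 4)
  nlinarith

lemma tendsto_momTwo {γ α : ℝ} (hγ : 0 < γ) (hα : 0 < α) {x y : HSpace n}
    (hxy : lev e x ≠ lev e y) :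
    Tendsto (fun r => momTwo γ α (radLev (idealRay e r)) {idealRay e r} x y) atTop
      (𝓝 (momTwo γ α (lev e) ∅ x y)) := by
  have mt := measurable_tailFun (n := n) γ
  have hm : ∀ r, Measurable fun p : ℝ × ℝ => voidP γ ({idealRay e r} ∪ {x, y})
      (region (radLev (idealRay e r)) x p.1 ∪ region (radLev (idealRay e r)) y p.2) := fun r =>
    measurable_voidP_pair_right γ (measurable_radLev (idealRay e r))
      (Set.countable_singleton (idealRay e r)) x y
  refine tendsto_lintegral_filter_of_dominated_convergence
    (fun p : ℝ × ℝ => tailFun n γ p.1 * tailFun n γ p.2)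
    (Eventually.of_forall hm) ?_ ?_
    (Eventually.of_forall fun p => tendsto_voidP_pair e γ hxy p.1 p.2)
  · filter_upwards [eventually_idealRay_ne e x, eventually_idealRay_ne e y] with r hx hy
    filter_upwards [ae_lam_prod_pos α] with p hp
    exact voidP_pair_le hγ (tailBound_radLev hγ hx) (tailBound_radLev hγ hy) hp.1 hp.2
  · rw [lintegral_prod_mul mt.aemeasurable mt.aemeasurable]
    exact (ENNReal.mul_lt_top (tailInt_lt_top hγ hα) (tailInt_lt_top hγ hα)).ne

lemma tendsto_covKer {γ α : ℝ} (hγ : 0 < γ) (hα : 0 < α) {x y : HSpace n}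
    (hxy : lev e x ≠ lev e y) :
    Tendsto (fun r => covKer γ α (radLev (idealRay e r)) {idealRay e r} x y) atTop
      (𝓝 (covKer γ α (lev e) ∅ x y)) := by
  have hx := tailBound_lev e hγ x
  have hy := tailBound_lev e hγ y
  have h1 := (ENNReal.tendsto_toReal (momTwo_lt_top hγ hα (measurable_lev e)
    Set.countable_empty hx hy).ne).comp (tendsto_momTwo e hγ hα hxy)
  have h2 := (ENNReal.tendsto_toReal (hx.momOne_lt_top hγ hα).ne).comp (tendsto_momOne e hγ hα x)
  have h3 := (ENNReal.tendsto_toReal (hy.momOne_lt_top hγ hα).ne).comp (tendsto_momOne e hγ hα y)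
  exact h1.sub (h2.mul h3)

/-- Dominated convergence: the decay bound is centred at the fixed point `x`, and for almost every
`y` both the kernel and the indicator of the higher levels converge. -/
lemma tendsto_covInt {γ α : ℝ} (hγ : 0 < γ) (hα : 0 < α) (x : HSpace n) :
    Tendsto (fun r => covInt γ α (radLev (idealRay e r)) {idealRay e r} x) atTop
      (𝓝 (covInt γ α (lev e) ∅ x)) := by
  have ms : ∀ r, MeasurableSet {y | radLev (idealRay e r) x < radLev (idealRay e r) y} :=
    fun r => measurableSet_lt measurable_const (measurable_radLev _)
  have me : MeasurableSet {y | lev e x < lev e y} :=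
    measurableSet_lt measurable_const (measurable_lev e)
  unfold covInt
  simp_rw [← integral_indicator (ms _), ← integral_indicator me]
  refine tendsto_integral_filter_of_dominated_convergence
    (fun y => (tailInt n γ α).toReal ^ 2 * covDecay n γ (hdist x y))
    (Eventually.of_forall fun r => ?_) ?_ ((integrable_covDecay hγ x).const_mul _) ?_
  · exact (((measurable_covKer γ α (measurable_radLev _) (Set.countable_singleton _)).comp
      measurable_prodMk_left).indicator (ms r)).aestronglyMeasurable
  · filter_upwards [eventually_idealRay_ne e x] with r hr
    have hne : ∀ᵐ y ∂hvol n, y ≠ idealRay e r := by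
      rw [ae_iff]
      simp
    filter_upwards [hne] with y hy
    refine (norm_indicator_le_norm_self _ _).trans ?_
    exact abs_covKer_le hγ hα (measurable_radLev _) (Set.countable_singleton _)
      (tailBound_radLev hγ hr) (tailBound_radLev hγ hy)
  · filter_upwards [ae_lev_ne e x] with y hy
    by_cases h : lev e x < lev e y
    · rw [Set.indicator_of_mem (show y ∈ {y | lev e x < lev e y} from h)]
      refine (tendsto_covKer e hγ hα hy).congr' ?_
      filter_upwards [eventually_hdist_idealRay_lt_iff e hy] with r hr
      rw [Set.indicator_of_mem (show y ∈ {y | radLev (idealRay e r) x < radLev (idealRay e r) y}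
        from hr.2 h)]
    · rw [Set.indicator_of_notMem (show y ∉ {y | lev e x < lev e y} from h)]
      refine tendsto_const_nhds.congr' ?_
      filter_upwards [eventually_hdist_idealRay_lt_iff e hy] with r hr
      rw [Set.indicator_of_notMem (show y ∉ {y | radLev (idealRay e r) x < radLev (idealRay e r) y}
        from fun h' => h (hr.1 h'))]

/-- Isotropy: the one-point functions of the radial structure converge far from the centre, to
those of the directed structure toward any ideal point. -/
lemma tendsto_of_isom_invariant {Φ : HSpace n → HSpace n → ℝ}
    (hinv : ∀ φ : HSpace n ≃ᵐ HSpace n, IsIsom φ → ∀ c x, Φ (φ c) (φ x) = Φ c x) (o : HSpace n)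
    {L : ℝ} (hlim : Tendsto (fun r => Φ (idealRay e r) o) atTop (𝓝 L)) :
    Tendsto (Φ o) (comap (hdist o) atTop) (𝓝 L) := by
  rw [Metric.tendsto_nhds] at hlim ⊢
  intro ε hε
  obtain ⟨T, hT⟩ := eventually_atTop.1 (hlim ε hε)
  rw [eventually_comap]
  have hτ := isGeodesicRay_idealRay e
  set d := hdist o (idealRay e 0)
  have hcont : Continuous fun t => hdist o (idealRay e t) := by
    refine (continuous_hdist_right o).comp ?_
    cases e with
    | none =>
      refine Continuous.subtype_mk ?_ _
      exact continuous_const.add (Real.continuous_exp.smul continuous_const)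
    | some b =>
      refine Continuous.subtype_mk ?_ _
      exact continuous_const.add ((Real.continuous_exp.comp continuous_neg).smul continuous_const)
  filter_upwards [eventually_ge_atTop (max d (T + d))] with r hr x hx
  have hr1 : d ≤ r := (le_max_left _ _).trans hr
  have hr2 : T + d ≤ r := (le_max_right _ _).trans hr
  -- The ray need not start at `o`, so a point of it at distance `r` from `o` comes from the
  -- intermediate value theorem, which requires `r ≥ d`.
  obtain ⟨t, ht, htr⟩ : ∃ t, 0 ≤ t ∧ hdist o (idealRay e t) = r := by
    obtain ⟨t₁, h1, h0⟩ := (((tendsto_hdist_idealRay e o).eventually_ge_atTop r).and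
      (eventually_ge_atTop 0)).exists
    obtain ⟨t, ht, htr⟩ := intermediate_value_Icc h0 hcont.continuousOn ⟨hr1, h1⟩
    exact ⟨t, ht.1, htr⟩
  have htT : T ≤ t := by
    have h1 := hdist_triangle o (idealRay e 0) (idealRay e t)
    rw [hτ 0 t le_rfl ht, zero_sub, abs_neg, abs_of_nonneg ht] at h1
    linarith
  -- The isometry takes the centre `o` out to the ray and brings `x` back to `o`.
  obtain ⟨φ, hφ, e1, e2⟩ := exists_isom_of_hdist_eq (a := o) (b := x) (a' := idealRay e t)
    (b' := o) (by rw [hx, hdist_comm, htr])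
  rw [← hinv φ hφ, e1, e2]
  exact hT t htT

end Limit

/-! ### Nearest points -/

lemma nearestDist_nonneg (x : HSpace n) (S : Set (HSpace n)) : 0 ≤ nearestDist x S := by
  refine Real.sInf_nonneg ?_
  rintro _ ⟨z, -, rfl⟩
  exact hdist_nonneg x z

/-- The infimum over the empty set is `0`, hence the non-emptiness clause. -/
lemma le_nearestDist_iff {x : HSpace n} {S : Set (HSpace n)} {s : ℝ} (hs : 0 < s) :
    s ≤ nearestDist x S ↔ S.Nonempty ∧ Disjoint S (hball x s) := by
  unfold nearestDist
  rcases S.eq_empty_or_nonempty with rfl | hS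
  · simp [hs]
  · have hbdd : BddBelow (hdist x '' S) := by
      refine ⟨0, ?_⟩
      rintro _ ⟨z, -, rfl⟩
      exact hdist_nonneg x z
    rw [le_csInf_iff hbdd (hS.image _), Set.disjoint_left]
    simp only [hS, true_and, Set.forall_mem_image, mem_hball, not_lt]

lemma nearestDist_anti {x : HSpace n} {S S' : Set (HSpace n)} (h : S ⊆ S') (hS : S.Nonempty) :
    nearestDist x S' ≤ nearestDist x S := by
  refine csInf_le_csInf ⟨0, ?_⟩ (hS.image _) (Set.image_mono h)
  rintro _ ⟨z, -, rfl⟩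
  exact hdist_nonneg x z

lemma radialLength_nonneg (o : HSpace n) (ξ : Set (HSpace n)) (x : HSpace n) :
    0 ≤ radialLength o ξ x := nearestDist_nonneg _ _

lemma radialLength_self (o : HSpace n) (ξ : Set (HSpace n)) : radialLength o ξ o = 0 := by
  have : {y | y ∈ ξ ∪ {o} ∧ hdist o y < hdist o o} = ∅ := by
    ext y
    simp [(hdist_nonneg o y).not_gt]
  rw [radialLength, this]
  simp [nearestDist]

/-- The root is always a candidate when `x ≠ o`, so the length is a genuine minimum distance and its
tail event is a void event. -/
lemma le_radialLength_iff {o x : HSpace n} (hx : x ≠ o) {s : ℝ} (hs : 0 < s)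
    (ξ : Set (HSpace n)) :
    s ≤ radialLength o ξ x ↔ Disjoint (ξ ∪ {o}) (region (radLev o) x s) := by
  rw [radialLength, le_nearestDist_iff hs, and_iff_right]
  · simp only [Set.disjoint_left, mem_hball, region, radLev_lt, Set.mem_ofPred_eq]
    constructor
    · intro h z hz hz'
      exact h ⟨hz, hz'.1⟩ hz'.2
    · intro h z hz hz'
      exact h hz.1 ⟨hz.2, hz'⟩
  · exact ⟨o, Or.inr rfl, by rw [hdist_self]; exact hdist_pos hx.symm⟩

/-- As `le_radialLength_iff`, without excluding the root. -/
lemma le_radialLength_iff_hdist (o x : HSpace n) {s : ℝ} (hs : 0 < s) (ξ : Set (HSpace n)) :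
    s ≤ radialLength o ξ x ↔ s ≤ hdist o x ∧ Disjoint ξ (region (radLev o) x s) := by
  by_cases hx : x = o
  · subst hx
    rw [radialLength_self, hdist_self]
    constructor
    · intro h; linarith
    · intro h; linarith [h.1]
  · rw [le_radialLength_iff hx hs, Set.disjoint_union_left, and_comm,
      Set.disjoint_singleton_left]
    refine and_congr_left' ?_
    simp only [region, radLev_lt, Set.mem_ofPred_eq, hdist_self, not_and, not_lt,
      hdist_comm x o]
    exact ⟨fun h => h (hdist_pos (Ne.symm hx)), fun h _ => h⟩

/-- Hitting an open relation is a measurable event. -/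
lemma measurableSet_hits {U : Set (HSpace n × HSpace n)} (hU : IsOpen U) :
    MeasurableSet {p : HSpace n × Config n | p.2 ∈ voidSet {z | (p.1, z) ∈ U}} := by
  set 𝓑 := TopologicalSpace.countableBasis (HSpace n)
  have hB := TopologicalSpace.isBasis_countableBasis (HSpace n)
  -- `U` is a countable union of products of basic open sets, and each product contributes a
  -- measurable rectangle.
  have key : {p : HSpace n × Config n | p.2 ∈ voidSet {z | (p.1, z) ∈ U}} =
      ⋂ q ∈ {q : Set (HSpace n) × Set (HSpace n) | q ∈ 𝓑 ×ˢ 𝓑 ∧ q.1 ×ˢ q.2 ⊆ U},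
        (q.1 ×ˢ (voidSet q.2)ᶜ)ᶜ := by
    ext ⟨x, ξ⟩
    simp only [Set.mem_iInter]
    constructor
    · rintro h ⟨A, B⟩ ⟨-, hAB⟩ ⟨hx, hξ⟩
      refine hξ ?_
      refine Set.disjoint_left.2 fun z hz hzB => Set.disjoint_left.1 h hz ?_
      exact hAB ⟨hx, hzB⟩
    · intro h
      refine Set.disjoint_left.2 fun z hz (hzU : (x, z) ∈ U) => ?_
      obtain ⟨u, hu, v, hv, hxu, hzv, huv⟩ : ∃ u ∈ 𝓑, ∃ v ∈ 𝓑, x ∈ u ∧ z ∈ v ∧ u ×ˢ v ⊆ U := by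
        obtain ⟨u, v, hu, hv, hxu, hzv, huv⟩ := isOpen_prod_iff.1 hU x z hzU
        obtain ⟨u', hu', hxu', hsu⟩ := hB.exists_subset_of_mem_open hxu hu
        obtain ⟨v', hv', hzv', hsv⟩ := hB.exists_subset_of_mem_open hzv hv
        exact ⟨u', hu', v', hv', hxu', hzv', (Set.prod_mono hsu hsv).trans huv⟩
      refine h (u, v) ⟨⟨hu, hv⟩, huv⟩ ⟨hxu, fun hvoid => ?_⟩
      exact Set.disjoint_left.1 hvoid hz hzv
  rw [key]
  have hc : (𝓑 ×ˢ 𝓑).Countable := (TopologicalSpace.countable_countableBasis _).prod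
    (TopologicalSpace.countable_countableBasis _)
  refine MeasurableSet.biInter (hc.mono fun q hq => hq.1) fun q hq => ?_
  have h1 : MeasurableSet q.1 := (hB.isOpen hq.1.1).measurableSet
  have h2 : MeasurableSet q.2 := (hB.isOpen hq.1.2).measurableSet
  exact (h1.prod (measurableSet_voidSet h2).compl).compl

lemma measurable_radialLength (o : HSpace n) :
    Measurable fun p : HSpace n × Config n => radialLength o p.2 p.1 := by
  refine measurable_of_Ici fun s => ?_
  rcases le_or_gt s 0 with hs | hs
  · convert MeasurableSet.univ
    exact Set.eq_univ_of_forall fun p => hs.trans (radialLength_nonneg _ _ _)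
  · have hU : IsOpen {q : HSpace n × HSpace n | radLev o q.1 < radLev o q.2 ∧ hdist q.1 q.2 < s} := by
      have h : Continuous (radLev o) := (continuous_hdist_right o).neg
      exact (isOpen_lt (h.comp continuous_fst) (h.comp continuous_snd)).inter
        (isOpen_lt continuous_hdist continuous_const)
    have key : (fun p : HSpace n × Config n => radialLength o p.2 p.1) ⁻¹' Set.Ici s =
        {p : HSpace n × Config n | s ≤ hdist o p.1} ∩
        {p : HSpace n × Config n | p.2 ∈ voidSet
          {z | (p.1, z) ∈ {q : HSpace n × HSpace n |
            radLev o q.1 < radLev o q.2 ∧ hdist q.1 q.2 < s}}} := by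
      ext ⟨x, ξ⟩
      exact le_radialLength_iff_hdist o x hs ξ
    rw [key]
    refine MeasurableSet.inter ?_ (measurableSet_hits hU)
    exact measurableSet_le measurable_const
      ((continuous_hdist_right o).measurable.comp measurable_fst)

/-! ### Moments of the edge lengths -/

section Moments

variable {Ω : Type*} [MeasurableSpace Ω] {P : Measure Ω}
  {γ : ℝ} {η : Ω → Set (HSpace n)}

lemma prob_void (hγ : 0 < γ) (hη : IsPoissonProcess P η (ENNReal.ofReal γ • hvol n))
    (F : Set (HSpace n)) {A : Set (HSpace n)} (hA : MeasurableSet A) (hfin : hvol n A < ∞) :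
    P {ω | Disjoint (η ω ∪ F) A} = voidP γ F A := by
  unfold voidP
  by_cases h : Disjoint F A
  · simp only [Set.disjoint_union_left, h, and_true, if_true]
    have hm : (ENNReal.ofReal γ • hvol n) A = ENNReal.ofReal γ * hvol n A := rfl
    rw [hη.void_eq hA, hm, poissonLaw_zero (ENNReal.mul_ne_top ENNReal.ofReal_ne_top hfin.ne),
      ENNReal.toReal_mul, ENNReal.toReal_ofReal hγ.le, neg_mul]
  · simp [Set.disjoint_union_left, h]

lemma measurable_radialLength_insert (hη : IsPoissonProcess P η (ENNReal.ofReal γ • hvol n))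
    (o x : HSpace n) : Measurable fun ω => radialLength o (insert x (η ω)) x := by
  have ha : Measurable fun ω => addPoint x (toConfig η ω) :=
    measurable_addPoint.comp (measurable_const.prodMk hη.measurable_toConfig)
  have hp : Measurable fun ω => ((x, addPoint x (toConfig η ω)) : HSpace n × Config n) :=
    measurable_const.prodMk ha
  have h := (measurable_radialLength o).comp hp
  exact h

lemma measurable_radialLength_insert_insert
    (hη : IsPoissonProcess P η (ENNReal.ofReal γ • hvol n)) (o x y z : HSpace n) :
    Measurable fun ω => radialLength o (insert x (insert y (η ω))) z := by
  have hb : Measurable fun ω => addPoint y (toConfig η ω) :=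
    measurable_addPoint.comp (measurable_const.prodMk hη.measurable_toConfig)
  have ha : Measurable fun ω => addPoint x (addPoint y (toConfig η ω)) :=
    measurable_addPoint.comp (measurable_const.prodMk hb)
  have hp : Measurable fun ω =>
      ((z, addPoint x (addPoint y (toConfig η ω))) : HSpace n × Config n) :=
    measurable_const.prodMk ha
  have h := (measurable_radialLength o).comp hp
  exact h

lemma lintegral_radialLength_rpow [IsProbabilityMeasure P] (hγ : 0 < γ)
    (hη : IsPoissonProcess P η (ENNReal.ofReal γ • hvol n)) {β : ℝ} (hβ : 0 < β) {o x : HSpace n}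
    (hx : x ≠ o) :
    ∫⁻ ω, ENNReal.ofReal (radialLength o (insert x (η ω)) x ^ β) ∂P =
      momOne γ β (radLev o) {o} x := by
  rw [lintegral_rpow_eq (measurable_radialLength_insert hη o x)
    (fun ω => radialLength_nonneg _ _ _) hβ]
  refine lintegral_congr_ae ((ae_lam_pos β).mono fun s (hs : 0 < s) => ?_)
  simp only
  rw [← prob_void hγ hη {o} (measurableSet_region (measurable_radLev o) x s)
    (hvol_region_lt_top _ _ _)]
  congr 1
  ext ω
  show s ≤ radialLength o (insert x (η ω)) x ↔ Disjoint (η ω ∪ {o}) (region (radLev o) x s)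
  rw [le_radialLength_iff hx hs, Set.insert_union, Set.disjoint_insert_left]
  exact and_iff_right (notMem_region_self _ _ _)

lemma lintegral_radialLength_mul [IsProbabilityMeasure P] (hγ : 0 < γ)
    (hη : IsPoissonProcess P η (ENNReal.ofReal γ • hvol n)) {α : ℝ} (hα : 0 < α) {o x y : HSpace n}
    (hx : x ≠ o) (hy : y ≠ o) :
    ∫⁻ ω, ENNReal.ofReal (radialLength o (insert x (insert y (η ω))) x ^ α) *
        ENNReal.ofReal (radialLength o (insert x (insert y (η ω))) y ^ α) ∂P =
      momTwo γ α (radLev o) {o} x y := by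
  rw [lintegral_rpow_mul_rpow_eq (measurable_radialLength_insert_insert hη o x y x)
    (fun ω => radialLength_nonneg _ _ _) (measurable_radialLength_insert_insert hη o x y y)
    (fun ω => radialLength_nonneg _ _ _) hα]
  refine lintegral_congr_ae ((ae_lam_prod_pos α).mono fun p hp => ?_)
  simp only
  rw [← prob_void hγ hη _ ((measurableSet_region (measurable_radLev o) x p.1).union
    (measurableSet_region (measurable_radLev o) y p.2)) (hvol_region_union_lt_top _ _ _ _ _)]
  congr 1
  ext ω
  have : insert x (insert y (η ω)) ∪ {o} = η ω ∪ ({o} ∪ {x, y}) := by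
    ext z
    simp only [Set.mem_union, Set.mem_insert_iff, Set.mem_singleton_iff]
    tauto
  show p.1 ≤ radialLength o (insert x (insert y (η ω))) x ∧
    p.2 ≤ radialLength o (insert x (insert y (η ω))) y ↔
    Disjoint (η ω ∪ ({o} ∪ {x, y})) (region (radLev o) x p.1 ∪ region (radLev o) y p.2)
  rw [le_radialLength_iff hx hp.1, le_radialLength_iff hy hp.2, ← Set.disjoint_union_right, this]

/-! ### Moments in the directed spanning forest. -/

/-- The candidates for the end of the edge at `y` in the directed structure toward `e`. -/
def dirReg (e : IdealPoint n) (y : HSpace n) : Set (HSpace n) := {z | z ≠ y ∧ z ∈ horoball e y}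

lemma measurableSet_dirReg (e : IdealPoint n) (y : HSpace n) : MeasurableSet (dirReg e y) :=
  (measurableSet_singleton y).compl.inter (measurableSet_horoball e y)

lemma directedLength_eq (e : IdealPoint n) (ξ : Set (HSpace n)) (y : HSpace n) :
    directedLength e ξ y = nearestDist y (ξ ∩ dirReg e y) := rfl

/-- Closed horoballs and strict levels differ only on the horosphere through `y`, which is null. -/
lemma mem_dirReg_inter_iff {e : IdealPoint n} {y z : HSpace n} (h : lev e y ≠ lev e z) (s : ℝ) :
    z ∈ dirReg e y ∩ hball y s ↔ z ∈ region (lev e) y s := by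
  rw [dirReg, horoball_eq]
  constructor
  · rintro ⟨⟨-, h1⟩, h2⟩
    exact ⟨lt_of_le_of_ne h1 h, h2⟩
  · rintro ⟨h1, h2⟩
    exact ⟨⟨fun h' => h (by rw [h']), h1.le⟩, h2⟩

lemma dirReg_inter_ae_eq (e : IdealPoint n) (y : HSpace n) (s : ℝ) :
    (dirReg e y ∩ hball y s : Set (HSpace n)) =ᵐ[hvol n] region (lev e) y s := by
  filter_upwards [ae_lev_ne e y] with z hz
  exact propext (mem_dirReg_inter_iff hz s)

lemma hvol_dirReg (e : IdealPoint n) (y : HSpace n) : hvol n (dirReg e y) = ∞ := by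
  refine top_le_iff.1 ((hvol_upper_eq_top e y).ge.trans (measure_mono fun z hz => ?_))
  have hz' : lev e y < lev e z := hz
  refine ⟨fun h => ?_, ?_⟩
  · rw [h] at hz'
    exact lt_irrefl _ hz'
  · rw [horoball_eq]
    exact hz'.le

lemma ae_inter_dirReg_nonempty (hγ : 0 < γ)
    (hη : IsPoissonProcess P η (ENNReal.ofReal γ • hvol n)) (e : IdealPoint n) (y : HSpace n) :
    ∀ᵐ ω ∂P, (η ω ∩ dirReg e y).Nonempty := by
  have h := hη.void_eq (measurableSet_dirReg e y)
  have h2 : (ENNReal.ofReal γ • hvol n) (dirReg e y) = ∞ := by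
    show ENNReal.ofReal γ * hvol n (dirReg e y) = ∞
    rw [hvol_dirReg, ENNReal.mul_top (by simpa using hγ)]
  rw [h2, poissonLaw_top_zero] at h
  rw [ae_iff]
  refine (congrArg P ?_).trans h
  ext ω
  show ¬ (η ω ∩ dirReg e y).Nonempty ↔ Disjoint (η ω) (dirReg e y)
  rw [Set.not_nonempty_iff_eq_empty, Set.disjoint_iff_inter_eq_empty]

lemma measurable_nearestDist {μ : Measure (HSpace n)} (hη : IsPoissonProcess P η μ)
    (G : Set (HSpace n)) {D : Set (HSpace n)} (hD : MeasurableSet D) (x : HSpace n) :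
    Measurable fun ω => nearestDist x ((η ω ∪ G) ∩ D) := by
  have hvoid : ∀ A, MeasurableSet A → MeasurableSet {ω | Disjoint (η ω ∪ G) A} := by
    intro A hA
    by_cases h : Disjoint G A
    · simp only [Set.disjoint_union_left, h, and_true]
      exact measurableSet_void hη hA
    · simp [Set.disjoint_union_left, h]
  refine measurable_of_Ici fun s => ?_
  rcases le_or_gt s 0 with hs | hs
  · convert MeasurableSet.univ
    exact Set.eq_univ_of_forall fun ω => hs.trans (nearestDist_nonneg _ _)
  · have : (fun ω => nearestDist x ((η ω ∪ G) ∩ D)) ⁻¹' Set.Ici s =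
        {ω | Disjoint (η ω ∪ G) D}ᶜ ∩ {ω | Disjoint (η ω ∪ G) (D ∩ hball x s)} := by
      ext ω
      show s ≤ nearestDist x ((η ω ∪ G) ∩ D) ↔
        ¬Disjoint (η ω ∪ G) D ∧ Disjoint (η ω ∪ G) (D ∩ hball x s)
      rw [le_nearestDist_iff hs, Set.not_disjoint_iff_nonempty_inter,
        Set.disjoint_iff_inter_eq_empty (t := hball x s), Set.inter_assoc,
        ← Set.disjoint_iff_inter_eq_empty]
    rw [this]
    exact (hvoid D hD).compl.inter (hvoid _ (hD.inter (measurableSet_hball x s)))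

lemma measurable_ell {μ : Measure (HSpace n)} (hη : IsPoissonProcess P η μ) (e : IdealPoint n)
    (y : HSpace n) : Measurable fun ω => ell e (η ω) y :=
  measurable_nearestDist hη {y} (measurableSet_dirReg e y) y

lemma measurable_ellWith {μ : Measure (HSpace n)} (hη : IsPoissonProcess P η μ) (e : IdealPoint n)
    (x y : HSpace n) : Measurable fun ω => ellWith e (η ω) x y :=
  measurable_nearestDist hη {y, x} (measurableSet_dirReg e y) y

lemma ell_nonneg (e : IdealPoint n) (ξ : Set (HSpace n)) (y : HSpace n) : 0 ≤ ell e ξ y :=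
  nearestDist_nonneg _ _

lemma ellWith_nonneg (e : IdealPoint n) (ξ : Set (HSpace n)) (x y : HSpace n) :
    0 ≤ ellWith e ξ x y := nearestDist_nonneg _ _

/-- Only almost sure, since without a candidate the length takes the default value `0`. -/
lemma ae_le_directedLength_iff (hγ : 0 < γ)
    (hη : IsPoissonProcess P η (ENNReal.ofReal γ • hvol n)) (e : IdealPoint n) (G : Set (HSpace n))
    (y : HSpace n) {s : ℝ} (hs : 0 < s) :
    ∀ᵐ ω ∂P, (s ≤ directedLength e (η ω ∪ G) y ↔
      Disjoint (η ω ∪ G) (dirReg e y ∩ hball y s)) := by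
  filter_upwards [ae_inter_dirReg_nonempty hγ hη e y] with ω hω
  have hne : ((η ω ∪ G) ∩ dirReg e y).Nonempty :=
    hω.mono (Set.inter_subset_inter_left _ Set.subset_union_left)
  rw [directedLength_eq, le_nearestDist_iff hs, and_iff_right hne,
    Set.disjoint_iff_inter_eq_empty, Set.inter_assoc, ← Set.disjoint_iff_inter_eq_empty]

lemma lintegral_ell_rpow [IsProbabilityMeasure P] (hγ : 0 < γ)
    (hη : IsPoissonProcess P η (ENNReal.ofReal γ • hvol n)) {β : ℝ} (hβ : 0 < β)
    (e : IdealPoint n) (y : HSpace n) :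
    ∫⁻ ω, ENNReal.ofReal (ell e (η ω) y ^ β) ∂P = momOne γ β (lev e) ∅ y := by
  rw [lintegral_rpow_eq (measurable_ell hη e y) (fun ω => ell_nonneg _ _ _) hβ]
  refine lintegral_congr_ae ((ae_lam_pos β).mono fun s hs => ?_)
  simp only
  have hvol_eq := measure_congr (dirReg_inter_ae_eq e y s)
  have hfin : hvol n (dirReg e y ∩ hball y s) < ∞ := by
    rw [hvol_eq]; exact hvol_region_lt_top _ _ _
  have h1 : P {ω | s ≤ ell e (η ω) y} = P {ω | Disjoint (η ω ∪ {y}) (dirReg e y ∩ hball y s)} := by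
    refine measure_congr ?_
    filter_upwards [ae_le_directedLength_iff hγ hη e {y} y hs] with ω hω
    exact propext hω
  rw [h1, prob_void hγ hη {y} ((measurableSet_dirReg e y).inter (measurableSet_hball y s)) hfin]
  unfold voidP
  rw [if_pos (Set.disjoint_singleton_left.2 fun h => h.1.1 rfl), if_pos (Set.empty_disjoint _),
    hvol_eq]

/-- The levels must differ: on a common horosphere `x` and `y` are candidates for each other in the
closed horoballs but not in the strict regions. -/
lemma lintegral_ellWith_mul [IsProbabilityMeasure P] (hγ : 0 < γ)
    (hη : IsPoissonProcess P η (ENNReal.ofReal γ • hvol n)) {α : ℝ} (hα : 0 < α)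
    (e : IdealPoint n) {x y : HSpace n} (hxy : lev e x ≠ lev e y) :
    ∫⁻ ω, ENNReal.ofReal (ellWith e (η ω) y x ^ α) * ENNReal.ofReal (ellWith e (η ω) x y ^ α) ∂P =
      momTwo γ α (lev e) ∅ x y := by
  rw [lintegral_rpow_mul_rpow_eq (measurable_ellWith hη e y x) (fun ω => ellWith_nonneg _ _ _ _)
    (measurable_ellWith hη e x y) (fun ω => ellWith_nonneg _ _ _ _) hα]
  refine lintegral_congr_ae ((ae_lam_prod_pos α).mono fun p hp => ?_)
  simp only
  have hvol_eq : hvol n (dirReg e x ∩ hball x p.1 ∪ dirReg e y ∩ hball y p.2) =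
      hvol n (region (lev e) x p.1 ∪ region (lev e) y p.2) :=
    measure_congr ((dirReg_inter_ae_eq e x p.1).union (dirReg_inter_ae_eq e y p.2))
  have hfin : hvol n (dirReg e x ∩ hball x p.1 ∪ dirReg e y ∩ hball y p.2) < ∞ := by
    rw [hvol_eq]; exact hvol_region_union_lt_top _ _ _ _ _
  have h1 : P {ω | p.1 ≤ ellWith e (η ω) y x ∧ p.2 ≤ ellWith e (η ω) x y} =
      P {ω | Disjoint (η ω ∪ {x, y}) (dirReg e x ∩ hball x p.1 ∪ dirReg e y ∩ hball y p.2)} := by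
    refine measure_congr ?_
    filter_upwards [ae_le_directedLength_iff hγ hη e {x, y} x hp.1,
      ae_le_directedLength_iff hγ hη e {y, x} y hp.2] with ω h1 h2
    refine propext ?_
    show (p.1 ≤ directedLength e (η ω ∪ {x, y}) x ∧ p.2 ≤ directedLength e (η ω ∪ {y, x}) y) ↔
      Disjoint (η ω ∪ {x, y}) (dirReg e x ∩ hball x p.1 ∪ dirReg e y ∩ hball y p.2)
    rw [h1, h2, Set.pair_comm y x, Set.disjoint_union_right]
  rw [h1, prob_void hγ hη {x, y} (((measurableSet_dirReg e x).inter (measurableSet_hball x p.1)).union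
    ((measurableSet_dirReg e y).inter (measurableSet_hball y p.2))) hfin]
  unfold voidP
  rw [hvol_eq, Set.empty_union]
  have hdis : Disjoint ({x, y} : Set (HSpace n))
      (dirReg e x ∩ hball x p.1 ∪ dirReg e y ∩ hball y p.2) ↔
      Disjoint ({x, y} : Set (HSpace n)) (region (lev e) x p.1 ∪ region (lev e) y p.2) := by
    have a1 := mem_dirReg_inter_iff hxy p.1
    have a2 := mem_dirReg_inter_iff hxy.symm p.2
    have a3 : x ∉ dirReg e x ∩ hball x p.1 := fun h => h.1.1 rfl
    have a4 : y ∉ dirReg e y ∩ hball y p.2 := fun h => h.1.1 rfl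
    have a5 := notMem_region_self (lev e) x p.1
    have a6 := notMem_region_self (lev e) y p.2
    rw [Set.disjoint_insert_left, Set.disjoint_insert_left, Set.disjoint_singleton_left,
      Set.disjoint_singleton_left]
    simp only [Set.mem_union]
    tauto
  by_cases h : Disjoint ({x, y} : Set (HSpace n)) (region (lev e) x p.1 ∪ region (lev e) y p.2)
  · rw [if_pos (hdis.2 h), if_pos h]
  · rw [if_neg (mt hdis.1 h), if_neg h]

lemma integrable_of_lintegral_ofReal_lt_top {f : Ω → ℝ} (hf : Measurable f) (hf0 : ∀ ω, 0 ≤ f ω)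
    (h : ∫⁻ ω, ENNReal.ofReal (f ω) ∂P < ∞) : Integrable f P := by
  refine ⟨hf.aestronglyMeasurable, ?_⟩
  rwa [hasFiniteIntegral_iff_ofReal (Eventually.of_forall hf0)]

lemma integrable_ell_rpow [IsProbabilityMeasure P] (hγ : 0 < γ)
    (hη : IsPoissonProcess P η (ENNReal.ofReal γ • hvol n)) {β : ℝ} (hβ : 0 < β)
    (e : IdealPoint n) (y : HSpace n) : Integrable (fun ω => ell e (η ω) y ^ β) P := by
  refine integrable_of_lintegral_ofReal_lt_top ((measurable_ell hη e y).pow_const β)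
    (fun ω => Real.rpow_nonneg (ell_nonneg _ _ _) _) ?_
  rw [lintegral_ell_rpow hγ hη hβ]
  exact (tailBound_lev e hγ y).momOne_lt_top hγ hβ

lemma integral_ell_rpow [IsProbabilityMeasure P] (hγ : 0 < γ)
    (hη : IsPoissonProcess P η (ENNReal.ofReal γ • hvol n)) {β : ℝ} (hβ : 0 < β)
    (e : IdealPoint n) (y : HSpace n) :
    ∫ ω, ell e (η ω) y ^ β ∂P = (momOne γ β (lev e) ∅ y).toReal := by
  rw [integral_eq_lintegral_of_nonneg_ae
    (Eventually.of_forall fun ω => Real.rpow_nonneg (ell_nonneg _ _ _) _)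
    (integrable_ell_rpow hγ hη hβ e y).aestronglyMeasurable, lintegral_ell_rpow hγ hη hβ]

lemma ae_ellWith_le_ell (hγ : 0 < γ) (hη : IsPoissonProcess P η (ENNReal.ofReal γ • hvol n))
    (e : IdealPoint n) (x y : HSpace n) : ∀ᵐ ω ∂P, ellWith e (η ω) x y ≤ ell e (η ω) y := by
  filter_upwards [ae_inter_dirReg_nonempty hγ hη e y] with ω hω
  refine nearestDist_anti (S := (η ω ∪ {y}) ∩ dirReg e y) (S' := (η ω ∪ {y, x}) ∩ dirReg e y) ?_ ?_
  · refine Set.inter_subset_inter_left _ (Set.union_subset_union_right _ ?_)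
    simp
  · exact hω.mono (Set.inter_subset_inter_left _ Set.subset_union_left)

/-- Adding a point only shortens edges, so the product is dominated through `a b ≤ a² + b²`. This
also covers pairs on a common horosphere. -/
lemma integrable_ellWith_mul [IsProbabilityMeasure P] (hγ : 0 < γ)
    (hη : IsPoissonProcess P η (ENNReal.ofReal γ • hvol n)) {α : ℝ} (hα : 0 < α)
    (e : IdealPoint n) (x y : HSpace n) :
    Integrable (fun ω => ellWith e (η ω) y x ^ α * ellWith e (η ω) x y ^ α) P := by
  refine Integrable.mono' ((integrable_ell_rpow hγ hη (β := 2 * α) (by positivity) e x).add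
    (integrable_ell_rpow hγ hη (β := 2 * α) (by positivity) e y))
    (((measurable_ellWith hη e y x).pow_const α).mul
      ((measurable_ellWith hη e x y).pow_const α)).aestronglyMeasurable ?_
  filter_upwards [ae_ellWith_le_ell hγ hη e y x, ae_ellWith_le_ell hγ hη e x y] with ω h1 h2
  have n1 := ellWith_nonneg e (η ω) y x
  have n2 := ellWith_nonneg e (η ω) x y
  have r1 := Real.rpow_le_rpow n1 h1 hα.le
  have r2 := Real.rpow_le_rpow n2 h2 hα.le
  have p1 := Real.rpow_nonneg n1 α
  have p2 := Real.rpow_nonneg n2 α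
  rw [Real.norm_of_nonneg (mul_nonneg p1 p2)]
  simp only [Pi.add_apply]
  have e1 : ∀ a : ℝ, 0 ≤ a → a ^ (2 * α) = (a ^ α) ^ 2 := fun a ha => by
    rw [mul_comm, Real.rpow_mul ha, Real.rpow_two]
  rw [e1 _ (ell_nonneg _ _ _), e1 _ (ell_nonneg _ _ _)]
  nlinarith [sq_nonneg (ell e (η ω) x ^ α - ell e (η ω) y ^ α), mul_le_mul r1 r2 p2 (p1.trans r1)]

lemma covTerm_eq [IsProbabilityMeasure P] (hγ : 0 < γ)
    (hη : IsPoissonProcess P η (ENNReal.ofReal γ • hvol n)) {α : ℝ} (hα : 0 < α)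
    (e : IdealPoint n) {x y : HSpace n} (hxy : lev e x ≠ lev e y) :
    covTerm P η e α x y = covKer γ α (lev e) ∅ x y := by
  have h : ∫ ω, ellWith e (η ω) y x ^ α * ellWith e (η ω) x y ^ α ∂P =
      (momTwo γ α (lev e) ∅ x y).toReal := by
    rw [integral_eq_lintegral_of_nonneg_ae (Eventually.of_forall fun ω =>
      mul_nonneg (Real.rpow_nonneg (ellWith_nonneg _ _ _ _) _)
        (Real.rpow_nonneg (ellWith_nonneg _ _ _ _) _))
      (integrable_ellWith_mul hγ hη hα e x y).aestronglyMeasurable,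
      ← lintegral_ellWith_mul hγ hη hα e hxy]
    congr 1
    exact lintegral_congr fun ω =>
      ENNReal.ofReal_mul (Real.rpow_nonneg (ellWith_nonneg _ _ _ _) _)
  rw [covTerm, covKer, h, integral_ell_rpow hγ hη hα, integral_ell_rpow hγ hη hα]

end Moments

/-! ### Averages over large balls -/

lemma toReal_hvol_hball (o : HSpace n) (R : ℝ) : (hvol n (hball o R)).toReal = ballVol n R := by
  rw [hvol_hball, ENNReal.toReal_ofReal (ballVol_nonneg _)]

instance isFiniteMeasure_restrict_hball (o : HSpace n) (R : ℝ) :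
    IsFiniteMeasure ((hvol n).restrict (hball o R)) :=
  ⟨by simpa using hvol_hball_lt_top o R⟩

lemma integrable_restrict_hball {f : HSpace n → ℝ} (hf : AEStronglyMeasurable f (hvol n)) {C : ℝ}
    (hC : ∀ᵐ x ∂hvol n, |f x| ≤ C) (o : HSpace n) (R : ℝ) :
    Integrable f ((hvol n).restrict (hball o R)) :=
  Integrable.of_bound hf.restrict C (ae_restrict_of_ae hC)

/-- Ball averages of a bounded function that converges at infinity converge to the same limit. -/
lemma tendsto_ball_average {f : HSpace n → ℝ} (hf : AEStronglyMeasurable f (hvol n)) {C : ℝ}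
    (hC : ∀ᵐ x ∂hvol n, |f x| ≤ C) {o : HSpace n} {L : ℝ}
    (hlim : Tendsto f (comap (hdist o) atTop) (𝓝 L)) :
    Tendsto (fun R => (∫ x in hball o R, f x ∂hvol n) / ballVol n R) atTop (𝓝 L) := by
  rw [Metric.tendsto_nhds] at hlim ⊢
  intro ε hε
  have h1 := hlim (ε / 2) (half_pos hε)
  rw [eventually_comap] at h1
  obtain ⟨R₀, hR₀⟩ := eventually_atTop.1 h1
  set D := |C| + |L|
  have hD : 0 ≤ D := by positivity
  have hV := tendsto_ballVol (n := n)
  -- For such `R` the inner ball, where `f - L` is only known to be bounded by `D`, contributes less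
  -- than `ε / 2` to the average.
  filter_upwards [hV.eventually_gt_atTop (2 * (D * ballVol n R₀) / ε), hV.eventually_gt_atTop 0]
    with R hR hpos
  have hint := integrable_restrict_hball hf hC o R
  have hvolR : ((hvol n).restrict (hball o R)).real Set.univ = ballVol n R := by
    rw [measureReal_restrict_apply_univ, Measure.real, toReal_hvol_hball]
  have e1 : (∫ x in hball o R, f x ∂hvol n) / ballVol n R - L =
      (∫ x in hball o R, (f x - L) ∂hvol n) / ballVol n R := by
    rw [integral_sub hint (integrable_const L), integral_const, hvolR]
    simp only [smul_eq_mul]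
    field_simp
  have hind : Integrable ((hball o R₀).indicator fun _ => D) ((hvol n).restrict (hball o R)) :=
    (integrable_const D).indicator (measurableSet_hball o R₀)
  have e2 : |∫ x in hball o R, (f x - L) ∂hvol n| ≤
      ∫ x in hball o R, ((hball o R₀).indicator (fun _ => D) x + ε / 2) ∂hvol n := by
    refine (abs_integral_le_integral_abs).trans ?_
    refine integral_mono_ae (hint.sub (integrable_const L)).abs
      (hind.add (integrable_const _)) ?_
    filter_upwards [ae_restrict_of_ae hC] with x hx
    show |f x - L| ≤ (hball o R₀).indicator (fun _ => D) x + ε / 2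
    by_cases hxb : x ∈ hball o R₀
    · rw [Set.indicator_of_mem hxb]
      have := abs_sub (f x) L
      have := le_abs_self C
      linarith
    · rw [Set.indicator_of_notMem hxb]
      have h := hR₀ (hdist o x) (not_lt.1 fun h => hxb (mem_hball.2 h)) x rfl
      rw [Real.dist_eq] at h
      linarith
  have e3 : ∫ x in hball o R, ((hball o R₀).indicator (fun _ => D) x + ε / 2) ∂hvol n ≤
      D * ballVol n R₀ + ε / 2 * ballVol n R := by
    rw [integral_add hind (integrable_const _), integral_const, hvolR,
      integral_indicator (measurableSet_hball o R₀), setIntegral_const, smul_eq_mul, smul_eq_mul]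
    have : ((hvol n).restrict (hball o R)).real (hball o R₀) ≤ ballVol n R₀ := by
      rw [← toReal_hvol_hball o R₀]
      exact ENNReal.toReal_mono (hvol_hball_lt_top o R₀).ne (Measure.restrict_apply_le _ _)
    nlinarith
  rw [Real.dist_eq, e1, abs_div, abs_of_pos hpos, div_lt_iff₀ hpos]
  rw [div_lt_iff₀ hε] at hR
  linarith

/-! ### The covariance kernel of the radial structure -/

lemma covDecay_le_one {γ : ℝ} (hγ : 0 < γ) (d : ℝ) : covDecay n γ d ≤ 1 := by
  rw [covDecay, Real.exp_le_one_iff]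
  have := ballVol_nonneg (n := n) (d / 4)
  nlinarith

lemma ae_ne_point (o : HSpace n) : ∀ᵐ x ∂hvol n, x ≠ o :=
  compl_mem_ae_iff.2 (measure_singleton o)

/-- Homogeneity makes the integral independent of the base point, hence the bound on `covInt`
uniform. -/
lemma integral_covDecay_eq (γ : ℝ) (x x' : HSpace n) :
    ∫ y, covDecay n γ (hdist x y) ∂hvol n = ∫ y, covDecay n γ (hdist x' y) ∂hvol n := by
  obtain ⟨φ, hφ, h1, -⟩ := exists_isom_of_hdist_eq (n := n) (a := x) (b := x) (a' := x')
    (b' := x') (by simp [hdist_self])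
  rw [← hφ.measurePreserving.integral_comp φ.measurableEmbedding
    (fun y => covDecay n γ (hdist x' y))]
  refine integral_congr_ae (Eventually.of_forall fun y => ?_)
  show covDecay n γ (hdist x y) = covDecay n γ (hdist x' (φ y))
  rw [← h1, hφ.hdist_map]

lemma abs_covInt_le {γ α : ℝ} (hγ : 0 < γ) (hα : 0 < α) {c x : HSpace n} (hx : x ≠ c) :
    |covInt γ α (radLev c) {c} x| ≤
      (tailInt n γ α).toReal ^ 2 * ∫ y, covDecay n γ (hdist c y) ∂hvol n := by
  have hd := (integrable_covDecay hγ x).const_mul ((tailInt n γ α).toReal ^ 2)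
  have h0 : 0 ≤ᵐ[hvol n] fun y => (tailInt n γ α).toReal ^ 2 * covDecay n γ (hdist x y) :=
    Eventually.of_forall fun y => mul_nonneg (sq_nonneg _) (covDecay_nonneg _ _)
  rw [← integral_covDecay_eq γ x c, ← integral_const_mul]
  refine le_trans ?_ (setIntegral_le_integral (s := {y | radLev c x < radLev c y}) hd h0)
  rw [covInt, ← Real.norm_eq_abs]
  refine norm_integral_le_of_norm_le hd.integrableOn ?_
  filter_upwards [ae_restrict_of_ae (ae_ne_point c)] with y hy
  exact abs_covKer_le hγ hα (measurable_radLev c) (Set.countable_singleton c)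
    (tailBound_radLev hγ hx) (tailBound_radLev hγ hy)

lemma stronglyMeasurable_covInt (γ α : ℝ) {b : HSpace n → ℝ} (hb : Measurable b)
    {F : Set (HSpace n)} (hF : F.Countable) : StronglyMeasurable (covInt γ α b F) := by
  have hS : MeasurableSet {q : HSpace n × HSpace n | b q.1 < b q.2} :=
    measurableSet_lt (hb.comp measurable_fst) (hb.comp measurable_snd)
  have h := ((measurable_covKer γ α hb hF).indicator hS).stronglyMeasurable
  have h2 := StronglyMeasurable.integral_prod_right (ν := hvol n)
    (f := fun x y => {q : HSpace n × HSpace n | b q.1 < b q.2}.indicator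
      (fun q => covKer γ α b F q.1 q.2) (x, y)) h
  convert h2 using 2 with x
  rw [covInt, ← integral_indicator (measurableSet_lt measurable_const hb)]
  rfl

lemma ae_prod_ne_point (o : HSpace n) (R : ℝ) :
    ∀ᵐ q ∂((hvol n).restrict (hball o R)).prod ((hvol n).restrict (hball o R)),
      q.1 ≠ o ∧ q.2 ≠ o := by
  have h := ae_restrict_of_ae (s := hball o R) (ae_ne_point o)
  have h1 := Measure.quasiMeasurePreserving_fst (μ := (hvol n).restrict (hball o R))
    (ν := (hvol n).restrict (hball o R)) |>.ae h
  have h2 := Measure.quasiMeasurePreserving_snd (μ := (hvol n).restrict (hball o R))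
    (ν := (hvol n).restrict (hball o R)) |>.ae h
  filter_upwards [h1, h2] with q hq hq' using ⟨hq, hq'⟩

lemma integrable_covKer_radLev {γ α : ℝ} (hγ : 0 < γ) (hα : 0 < α) (o : HSpace n) (R : ℝ) :
    Integrable (fun q : HSpace n × HSpace n => covKer γ α (radLev o) {o} q.1 q.2)
      (((hvol n).restrict (hball o R)).prod ((hvol n).restrict (hball o R))) := by
  refine Integrable.of_bound (measurable_covKer γ α (measurable_radLev o)
    (Set.countable_singleton o)).aestronglyMeasurable ((tailInt n γ α).toReal ^ 2 * 1) ?_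
  filter_upwards [ae_prod_ne_point o R] with q hq
  refine (abs_covKer_le hγ hα (measurable_radLev o) (Set.countable_singleton o)
    (tailBound_radLev hγ hq.1) (tailBound_radLev hγ hq.2)).trans ?_
  exact mul_le_mul_of_nonneg_left (covDecay_le_one hγ _) (sq_nonneg _)

/-- By symmetry, the double integral of the covariance kernel over a ball is twice the integral over
the pairs in which the second point is closer to the centre. -/
lemma integral_covKer_radLev {γ α : ℝ} (hγ : 0 < γ) (hα : 0 < α) (o : HSpace n) (R : ℝ) :
    ∫ q, covKer γ α (radLev o) {o} q.1 q.2
        ∂((hvol n).restrict (hball o R)).prod ((hvol n).restrict (hball o R)) =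
      2 * ∫ x in hball o R, covInt γ α (radLev o) {o} x ∂hvol n := by
  set ν := (hvol n).restrict (hball o R)
  set S := {q : HSpace n × HSpace n | radLev o q.1 < radLev o q.2}
  set h := fun q : HSpace n × HSpace n => covKer γ α (radLev o) {o} q.1 q.2
  have hm := measurable_radLev o
  have hS : MeasurableSet S := measurableSet_lt (hm.comp measurable_fst) (hm.comp measurable_snd)
  have hint : Integrable h (ν.prod ν) := integrable_covKer_radLev hγ hα o R
  have hcompl : ∫ q in Sᶜ, h q ∂ν.prod ν = ∫ q in S, h q ∂ν.prod ν := by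
    -- The two sets differ only in pairs equidistant from `o`, and spheres are null.
    have hae : (Sᶜ : Set (HSpace n × HSpace n)) =ᵐ[ν.prod ν] Prod.swap ⁻¹' S := by
      have hne : ∀ᵐ q ∂ν.prod ν, radLev o q.1 ≠ radLev o q.2 := by
        have hms : MeasurableSet {q : HSpace n × HSpace n | radLev o q.1 ≠ radLev o q.2} :=
          (measurableSet_eq_fun (hm.comp measurable_fst) (hm.comp measurable_snd)).compl
        rw [Measure.ae_prod_iff_ae_ae hms]
        refine Eventually.of_forall fun x => ae_restrict_of_ae ?_
        refine measure_mono_null (fun y hy => ?_) (hvol_hsphere_eq_zero o (hdist o x))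
        have hy : ¬ (radLev o x ≠ radLev o y) := hy
        simp only [radLev, ne_eq, neg_inj, not_not] at hy
        exact hy.symm
      filter_upwards [hne] with q hq
      refine propext ⟨fun (h1 : ¬ radLev o q.1 < radLev o q.2) => ?_,
        fun (h1 : radLev o q.2 < radLev o q.1) => ?_⟩
      · exact lt_of_le_of_ne (not_lt.1 h1) hq.symm
      · exact not_lt.2 h1.le
    rw [setIntegral_congr_set hae,
      ← (Measure.measurePreserving_swap (μ := ν) (ν := ν)).setIntegral_preimage_emb
        MeasurableEquiv.prodComm.measurableEmbedding h S]
    refine integral_congr_ae (Eventually.of_forall fun q => ?_)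
    exact covKer_comm γ α hm (Set.countable_singleton o) q.1 q.2
  have hmain : ∫ q in S, h q ∂ν.prod ν = ∫ x in hball o R, covInt γ α (radLev o) {o} x ∂hvol n := by
    rw [← integral_indicator hS, integral_prod _ (hint.indicator hS)]
    refine setIntegral_congr_fun (measurableSet_hball o R) fun x hx => ?_
    have hx : hdist o x < R := hx
    -- This removes the restriction to the ball from the inner integral, so that it no longer
    -- depends on `R`.
    have hsub : {y | radLev o x < radLev o y} ⊆ hball o R := fun y hy =>
      mem_hball.2 ((radLev_lt.1 hy).trans hx)
    have hSx : MeasurableSet {y | radLev o x < radLev o y} := measurableSet_lt measurable_const hm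
    show ∫ y, S.indicator h (x, y) ∂ν = covInt γ α (radLev o) {o} x
    rw [covInt, ← Measure.restrict_restrict_of_subset hsub, ← integral_indicator hSx]
    rfl
  rw [← integral_add_compl hS hint, hcompl, hmain]
  ring

/-! ### Moments and variance of the edge-length functional -/

section Variance

variable {Ω : Type*} [MeasurableSpace Ω] {P : Measure Ω}
  {γ : ℝ} {η : Ω → Set (HSpace n)}

lemma edgeLengthFunctional_eq_sum {μ : Measure (HSpace n)} (hη : IsPoissonProcess P η μ)
    (o : HSpace n) (α R : ℝ) (ω : Ω) :
    edgeLengthFunctional o α R (η ω) = ∑ x ∈ hη.pts o R ω, radialLength o (η ω) x ^ α :=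
  finsum_mem_eq_finite_toFinset_sum _ (hη.locallyFinite ω o R)

lemma edgeLengthFunctional_nonneg {μ : Measure (HSpace n)} (hη : IsPoissonProcess P η μ)
    (o : HSpace n) (α R : ℝ) (ω : Ω) : 0 ≤ edgeLengthFunctional o α R (η ω) := by
  rw [edgeLengthFunctional_eq_sum hη]
  exact Finset.sum_nonneg fun x _ => Real.rpow_nonneg (radialLength_nonneg _ _ _) _

lemma ofReal_edgeLengthFunctional {μ : Measure (HSpace n)} (hη : IsPoissonProcess P η μ)
    (o : HSpace n) (α R : ℝ) (ω : Ω) :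
    ENNReal.ofReal (edgeLengthFunctional o α R (η ω)) =
      ∑ x ∈ hη.pts o R ω, ENNReal.ofReal (radialLength o (η ω) x ^ α) := by
  rw [edgeLengthFunctional_eq_sum hη, ENNReal.ofReal_sum_of_nonneg]
  exact fun x _ => Real.rpow_nonneg (radialLength_nonneg _ _ _) _

lemma measurable_radialLength_rpow (o : HSpace n) (α : ℝ) :
    Measurable fun p : HSpace n × Config n => ENNReal.ofReal (radialLength o p.2 p.1 ^ α) :=
  ((measurable_radialLength o).pow_const α).ennreal_ofReal

lemma measurable_edgeLengthFunctional {μ : Measure (HSpace n)} (hη : IsPoissonProcess P η μ)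
    (o : HSpace n) (α R : ℝ) : Measurable fun ω => edgeLengthFunctional o α R (η ω) := by
  have hg := measurable_radialLength_rpow o α
  have h : Measurable fun ω => (∫⁻ p, ENNReal.ofReal (radialLength o p.2 p.1 ^ α)
      ∂empOne hη o R ω).toReal :=
    ((Measure.measurable_lintegral hg).comp (measurable_empOne hη)).ennreal_toReal
  convert h using 2 with ω
  rw [lintegral_empOne hη hg ω]
  refine Eq.trans ?_ (congrArg ENNReal.toReal (ofReal_edgeLengthFunctional hη o α R ω))
  rw [ENNReal.toReal_ofReal (edgeLengthFunctional_nonneg hη o α R ω)]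

lemma intensity_hball_ne_top (γ : ℝ) (o : HSpace n) (R : ℝ) :
    (ENNReal.ofReal γ • hvol n) (hball o R) ≠ ∞ :=
  ENNReal.mul_ne_top ENNReal.ofReal_ne_top (hvol_hball_lt_top o R).ne

lemma lintegral_edgeLengthFunctional [IsProbabilityMeasure P] (hγ : 0 < γ)
    (hη : IsPoissonProcess P η (ENNReal.ofReal γ • hvol n)) {α : ℝ} (hα : 0 < α) (o : HSpace n)
    (R : ℝ) :
    ∫⁻ ω, ENNReal.ofReal (edgeLengthFunctional o α R (η ω)) ∂P =
      ENNReal.ofReal γ * ∫⁻ x in hball o R, momOne γ α (radLev o) {o} x ∂hvol n := by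
  have h := mecke_one hη (intensity_hball_ne_top γ o R) (measurable_radialLength_rpow o α)
  refine (lintegral_congr fun ω => ofReal_edgeLengthFunctional hη o α R ω).trans (h.trans ?_)
  rw [Measure.restrict_smul, lintegral_smul_measure, smul_eq_mul]
  congr 1
  refine lintegral_congr_ae ?_
  filter_upwards [ae_restrict_of_ae (ae_ne_point o)] with x hx
  exact lintegral_radialLength_rpow hγ hη hα hx

lemma ofReal_rpow_mul_self {a : ℝ} (ha : 0 ≤ a) (α : ℝ) :
    ENNReal.ofReal (a ^ α) * ENNReal.ofReal (a ^ α) = ENNReal.ofReal (a ^ (2 * α)) := by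
  rw [← ENNReal.ofReal_mul (Real.rpow_nonneg ha _), mul_comm 2 α, Real.rpow_mul ha, Real.rpow_two,
    sq]

/-- The square of the sum is a double sum over points. In the Mecke formula the off-diagonal pairs
give `momTwo`, and the diagonal gives the moment of order `2 * α`. -/
lemma lintegral_edgeLengthFunctional_sq [IsProbabilityMeasure P] (hγ : 0 < γ)
    (hη : IsPoissonProcess P η (ENNReal.ofReal γ • hvol n)) {α : ℝ} (hα : 0 < α) (o : HSpace n)
    (R : ℝ) :
    ∫⁻ ω, ENNReal.ofReal (edgeLengthFunctional o α R (η ω) ^ 2) ∂P =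
      ENNReal.ofReal γ ^ 2 * (∫⁻ q, momTwo γ α (radLev o) {o} q.1 q.2
        ∂((hvol n).restrict (hball o R)).prod ((hvol n).restrict (hball o R))) +
      ENNReal.ofReal γ * ∫⁻ x in hball o R, momOne γ (2 * α) (radLev o) {o} x ∂hvol n := by
  have hg : Measurable fun p : HSpace n × HSpace n × Config n =>
      ENNReal.ofReal (radialLength o p.2.2 p.1 ^ α) *
        ENNReal.ofReal (radialLength o p.2.2 p.2.1 ^ α) := by
    have h1 := (measurable_radialLength_rpow o α).comp
      ((measurable_fst.prodMk (measurable_snd.comp measurable_snd)) :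
        Measurable fun p : HSpace n × HSpace n × Config n => (p.1, p.2.2))
    have h2 := (measurable_radialLength_rpow o α).comp
      (measurable_snd : Measurable fun p : HSpace n × HSpace n × Config n => p.2)
    exact h1.mul h2
  have h := mecke_two hη (intensity_hball_ne_top γ o R) hg
  have h0 : ∀ ω, ENNReal.ofReal (edgeLengthFunctional o α R (η ω) ^ 2) =
      ∑ x ∈ hη.pts o R ω, ∑ y ∈ hη.pts o R ω, ENNReal.ofReal (radialLength o (η ω) x ^ α) *
        ENNReal.ofReal (radialLength o (η ω) y ^ α) := by
    intro ω
    rw [ENNReal.ofReal_pow (edgeLengthFunctional_nonneg hη o α R ω),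
      ofReal_edgeLengthFunctional hη, sq, Finset.sum_mul_sum]
  refine (lintegral_congr h0).trans (h.trans ?_)
  rw [Measure.restrict_smul, lintegral_smul_measure, lintegral_smul_measure]
  simp_rw [lintegral_smul_measure]
  congr 1
  · rw [lintegral_prod _ (measurable_momTwo γ α (measurable_radLev o)
      (Set.countable_singleton o)).aemeasurable]
    simp only [smul_eq_mul]
    rw [lintegral_const_mul' _ _ ENNReal.ofReal_ne_top, sq, mul_assoc]
    congr 2
    refine lintegral_congr_ae ?_
    filter_upwards [ae_restrict_of_ae (ae_ne_point o)] with x hx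
    refine lintegral_congr_ae ?_
    filter_upwards [ae_restrict_of_ae (ae_ne_point o)] with y hy
    exact lintegral_radialLength_mul hγ hη hα hx hy
  · rw [smul_eq_mul]
    congr 1
    refine lintegral_congr_ae ?_
    filter_upwards [ae_restrict_of_ae (ae_ne_point o)] with x hx
    refine Eq.trans ?_ (lintegral_radialLength_rpow hγ hη (by positivity) hx)
    exact lintegral_congr fun ω => ofReal_rpow_mul_self (radialLength_nonneg _ _ _) α

lemma ae_momOne_radLev_le (hγ : 0 < γ) (β : ℝ) (o : HSpace n) :
    ∀ᵐ x ∂hvol n, momOne γ β (radLev o) {o} x ≤ tailInt n γ β := by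
  filter_upwards [ae_ne_point o] with x hx
  exact (tailBound_radLev hγ hx).momOne_le hγ

lemma lintegral_momOne_radLev_ne_top (hγ : 0 < γ) {β : ℝ} (hβ : 0 < β) (o : HSpace n) (R : ℝ) :
    ∫⁻ x in hball o R, momOne γ β (radLev o) {o} x ∂hvol n ≠ ∞ := by
  refine ((lintegral_mono_ae (ae_restrict_of_ae (ae_momOne_radLev_le hγ β o))).trans_lt ?_).ne
  rw [lintegral_const]
  exact ENNReal.mul_lt_top (tailInt_lt_top hγ hβ) (measure_lt_top _ _)

lemma lintegral_momTwo_radLev_ne_top (hγ : 0 < γ) {α : ℝ} (hα : 0 < α) (o : HSpace n) (R : ℝ) :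
    ∫⁻ q, momTwo γ α (radLev o) {o} q.1 q.2
      ∂((hvol n).restrict (hball o R)).prod ((hvol n).restrict (hball o R)) ≠ ∞ := by
  have ht := tailInt_lt_top (n := n) hγ hα
  have hle : ∀ᵐ q ∂((hvol n).restrict (hball o R)).prod ((hvol n).restrict (hball o R)),
      momTwo γ α (radLev o) {o} q.1 q.2 ≤
        tailInt n γ α * tailInt n γ α + 1 * (tailInt n γ α * tailInt n γ α) := by
    filter_upwards [ae_prod_ne_point o R] with q hq
    have h1 := tailBound_radLev hγ hq.1
    have h2 := tailBound_radLev hγ hq.2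
    refine (momTwo_bounds hγ (measurable_radLev o) (Set.countable_singleton o) h1 h2).1.trans ?_
    gcongr
    · exact h1.momOne_le hγ
    · exact h2.momOne_le hγ
    · exact ENNReal.ofReal_le_one.2 (covDecay_le_one hγ _)
  refine ((lintegral_mono_ae hle).trans_lt ?_).ne
  rw [lintegral_const, one_mul]
  exact ENNReal.mul_lt_top (ENNReal.add_lt_top.2 ⟨ENNReal.mul_lt_top ht ht,
    ENNReal.mul_lt_top ht ht⟩) (measure_lt_top _ _)

lemma memLp_edgeLengthFunctional [IsProbabilityMeasure P] (hγ : 0 < γ)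
    (hη : IsPoissonProcess P η (ENNReal.ofReal γ • hvol n)) {α : ℝ} (hα : 0 < α) (o : HSpace n)
    (R : ℝ) : MemLp (fun ω => edgeLengthFunctional o α R (η ω)) 2 P := by
  have hm := measurable_edgeLengthFunctional hη o α R
  rw [memLp_two_iff_integrable_sq hm.aestronglyMeasurable]
  refine integrable_of_lintegral_ofReal_lt_top (hm.pow_const 2) (fun ω => sq_nonneg _) ?_
  rw [lintegral_edgeLengthFunctional_sq hγ hη hα]
  refine ENNReal.add_lt_top.2 ⟨ENNReal.mul_lt_top (ENNReal.pow_lt_top ENNReal.ofReal_lt_top)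
    (lintegral_momTwo_radLev_ne_top hγ hα o R).lt_top, ENNReal.mul_lt_top ENNReal.ofReal_lt_top
    (lintegral_momOne_radLev_ne_top hγ (by positivity) o R).lt_top⟩

lemma integral_momOne_radLev (hγ : 0 < γ) {β : ℝ} (hβ : 0 < β) (o : HSpace n) (R : ℝ) :
    ∫ x in hball o R, (momOne γ β (radLev o) {o} x).toReal ∂hvol n =
      (∫⁻ x in hball o R, momOne γ β (radLev o) {o} x ∂hvol n).toReal := by
  have hm := measurable_momOne γ β (measurable_radLev o) (Set.countable_singleton o)
  exact integral_toReal hm.aemeasurable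
    (ae_lt_top hm (lintegral_momOne_radLev_ne_top hγ hβ o R))

/-- The contribution of a point at `x` to the variance. -/
def varDensity (γ α : ℝ) (c x : HSpace n) : ℝ :=
  γ * (momOne γ (2 * α) (radLev c) {c} x).toReal + 2 * γ ^ 2 * covInt γ α (radLev c) {c} x

lemma measurable_varDensity (γ α : ℝ) (c : HSpace n) : Measurable (varDensity γ α c) :=
  ((measurable_momOne γ (2 * α) (measurable_radLev c)
    (Set.countable_singleton c)).ennreal_toReal.const_mul γ).add
    ((stronglyMeasurable_covInt γ α (measurable_radLev c)
      (Set.countable_singleton c)).measurable.const_mul _)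

lemma ae_abs_toReal_momOne_le (hγ : 0 < γ) {β : ℝ} (hβ : 0 < β) (o : HSpace n) :
    ∀ᵐ x ∂hvol n, |(momOne γ β (radLev o) {o} x).toReal| ≤ (tailInt n γ β).toReal := by
  filter_upwards [ae_momOne_radLev_le hγ β o] with x hx
  rw [abs_of_nonneg ENNReal.toReal_nonneg]
  exact ENNReal.toReal_mono (tailInt_lt_top hγ hβ).ne hx

lemma ae_abs_covInt_le (hγ : 0 < γ) {α : ℝ} (hα : 0 < α) (o : HSpace n) :
    ∀ᵐ x ∂hvol n, |covInt γ α (radLev o) {o} x| ≤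
      (tailInt n γ α).toReal ^ 2 * ∫ y, covDecay n γ (hdist o y) ∂hvol n :=
  (ae_ne_point o).mono fun _ hx => abs_covInt_le hγ hα hx

lemma exists_ae_abs_varDensity_le (hγ : 0 < γ) {α : ℝ} (hα : 0 < α) (o : HSpace n) :
    ∃ C, ∀ᵐ x ∂hvol n, |varDensity γ α o x| ≤ C := by
  refine ⟨|γ| * (tailInt n γ (2 * α)).toReal +
    |2 * γ ^ 2| * ((tailInt n γ α).toReal ^ 2 * ∫ y, covDecay n γ (hdist o y) ∂hvol n), ?_⟩
  filter_upwards [ae_abs_toReal_momOne_le hγ (by positivity : 0 < 2 * α) o,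
    ae_abs_covInt_le hγ hα o] with x h1 h2
  refine (abs_add_le _ _).trans ?_
  rw [abs_mul, abs_mul (2 * γ ^ 2)]
  gcongr

/-- The variance of the edge-length functional. -/
theorem variance_edgeLengthFunctional [IsProbabilityMeasure P] (hγ : 0 < γ)
    (hη : IsPoissonProcess P η (ENNReal.ofReal γ • hvol n)) {α : ℝ} (hα : 0 < α) (o : HSpace n)
    (R : ℝ) :
    variance (fun ω => edgeLengthFunctional o α R (η ω)) P =
      ∫ x in hball o R, varDensity γ α o x ∂hvol n := by
  have h2α : 0 < 2 * α := by positivity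
  have hm := measurable_edgeLengthFunctional hη o α R
  have hF := Set.countable_singleton o
  have e1 : ∫ ω, edgeLengthFunctional o α R (η ω) ∂P =
      γ * ∫ x in hball o R, (momOne γ α (radLev o) {o} x).toReal ∂hvol n := by
    rw [integral_eq_lintegral_of_nonneg_ae (Eventually.of_forall fun ω =>
      edgeLengthFunctional_nonneg hη o α R ω) hm.aestronglyMeasurable,
      lintegral_edgeLengthFunctional hγ hη hα, ENNReal.toReal_mul, ENNReal.toReal_ofReal hγ.le,
      integral_momOne_radLev hγ hα]
  set ν := (hvol n).restrict (hball o R) with hν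
  have hm2 := measurable_momTwo γ α (measurable_radLev o) hF
  have hfin2 := lintegral_momTwo_radLev_ne_top hγ hα o R
  have e2 : ∫ ω, edgeLengthFunctional o α R (η ω) ^ 2 ∂P =
      γ ^ 2 * (∫ q, (momTwo γ α (radLev o) {o} q.1 q.2).toReal ∂ν.prod ν) +
        γ * ∫ x in hball o R, (momOne γ (2 * α) (radLev o) {o} x).toReal ∂hvol n := by
    rw [integral_eq_lintegral_of_nonneg_ae (Eventually.of_forall fun ω => sq_nonneg _)
      (hm.pow_const 2).aestronglyMeasurable,
      lintegral_edgeLengthFunctional_sq hγ hη hα, ENNReal.toReal_add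
        (ENNReal.mul_ne_top (ENNReal.pow_ne_top ENNReal.ofReal_ne_top) hfin2)
        (ENNReal.mul_ne_top ENNReal.ofReal_ne_top (lintegral_momOne_radLev_ne_top hγ h2α o R)),
      ENNReal.toReal_mul, ENNReal.toReal_mul, ENNReal.toReal_pow, ENNReal.toReal_ofReal hγ.le,
      integral_momOne_radLev hγ h2α, integral_toReal hm2.aemeasurable (ae_lt_top hm2 hfin2)]
  have hm1 := (measurable_momOne γ α (measurable_radLev o) hF).ennreal_toReal
  have i1 : Integrable (fun x => (momOne γ α (radLev o) {o} x).toReal) ν :=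
    integrable_restrict_hball hm1.aestronglyMeasurable (ae_abs_toReal_momOne_le hγ hα o) o R
  -- The product of one-point moments integrates to the square that the squared mean cancels,
  -- leaving only the covariance kernel.
  have e3 : ∫ q, (momTwo γ α (radLev o) {o} q.1 q.2).toReal ∂ν.prod ν =
      (∫ q, covKer γ α (radLev o) {o} q.1 q.2 ∂ν.prod ν) +
        (∫ x, (momOne γ α (radLev o) {o} x).toReal ∂ν) ^ 2 := by
    rw [sq, ← integral_prod_mul, ← integral_add (integrable_covKer_radLev hγ hα o R)
      (i1.mul_prod i1)]
    refine integral_congr_ae (Eventually.of_forall fun q => ?_)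
    simp only [covKer]
    ring
  have i2 : Integrable (fun x => (momOne γ (2 * α) (radLev o) {o} x).toReal) ν :=
    integrable_restrict_hball (measurable_momOne γ (2 * α) (measurable_radLev o)
      hF).ennreal_toReal.aestronglyMeasurable (ae_abs_toReal_momOne_le hγ h2α o) o R
  have i3 : Integrable (covInt γ α (radLev o) {o}) ν :=
    integrable_restrict_hball (stronglyMeasurable_covInt γ α (measurable_radLev o)
      hF).aestronglyMeasurable (ae_abs_covInt_le hγ hα o) o R
  rw [variance_eq_sub (memLp_edgeLengthFunctional hγ hη hα o R)]
  simp only [Pi.pow_apply]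
  rw [e1, e2, e3, integral_covKer_radLev hγ hα]
  have e4 : ∫ x in hball o R, varDensity γ α o x ∂hvol n =
      γ * (∫ x in hball o R, (momOne γ (2 * α) (radLev o) {o} x).toReal ∂hvol n) +
        2 * γ ^ 2 * ∫ x in hball o R, covInt γ α (radLev o) {o} x ∂hvol n := by
    unfold varDensity
    rw [integral_add (i2.const_mul γ) (i3.const_mul _), integral_const_mul, integral_const_mul]
  rw [e4]
  ring

/-- Both ingredients of the density are invariant under isometries, so it is enough to let the
centre escape along the ray to `e`. -/
lemma tendsto_varDensity (e : IdealPoint n) (hγ : 0 < γ) {α : ℝ} (hα : 0 < α) (o : HSpace n) :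
    Tendsto (varDensity γ α o) (comap (hdist o) atTop)
      (𝓝 (γ * (momOne γ (2 * α) (lev e) ∅ o).toReal + 2 * γ ^ 2 * covInt γ α (lev e) ∅ o)) := by
  have h2α : 0 < 2 * α := by positivity
  refine tendsto_of_isom_invariant e (fun φ hφ c x => ?_) o ?_
  · rw [varDensity, hφ.momOne_eq, hφ.covInt_eq, varDensity]
  · refine Tendsto.add (Tendsto.const_mul _ ?_) (Tendsto.const_mul _ (tendsto_covInt e hγ hα o))
    exact (ENNReal.tendsto_toReal ((tailBound_lev e hγ o).momOne_lt_top hγ h2α).ne).comp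
      (tendsto_momOne e hγ h2α o)

lemma horoball_ae_eq (e : IdealPoint n) (x : HSpace n) :
    (horoball e x : Set (HSpace n)) =ᵐ[hvol n] {y | lev e x < lev e y} := by
  rw [horoball_eq]
  filter_upwards [ae_lev_ne e x] with z hz
  exact propext ⟨fun h => lt_of_le_of_ne h hz, fun h => le_of_lt h⟩

lemma ae_covTerm_eq [IsProbabilityMeasure P] (hγ : 0 < γ)
    (hη : IsPoissonProcess P η (ENNReal.ofReal γ • hvol n)) {α : ℝ} (hα : 0 < α)
    (e : IdealPoint n) (x : HSpace n) :
    (fun y => covTerm P η e α x y) =ᵐ[hvol n] fun y => covKer γ α (lev e) ∅ x y :=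
  (ae_lev_ne e x).mono fun _ hy => covTerm_eq hγ hη hα e hy

lemma integrable_covTerm [IsProbabilityMeasure P] (hγ : 0 < γ)
    (hη : IsPoissonProcess P η (ENNReal.ofReal γ • hvol n)) {α : ℝ} (hα : 0 < α)
    (e : IdealPoint n) (x : HSpace n) : Integrable (fun y => covTerm P η e α x y) (hvol n) := by
  refine Integrable.congr ?_ (ae_covTerm_eq hγ hη hα e x).symm
  refine ((integrable_covDecay hγ x).const_mul ((tailInt n γ α).toReal ^ 2)).mono'
    ((measurable_covKer γ α (measurable_lev e) Set.countable_empty).comp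
      measurable_prodMk_left).aestronglyMeasurable (Eventually.of_forall fun y => ?_)
  exact abs_covKer_le hγ hα (measurable_lev e) Set.countable_empty (tailBound_lev e hγ x)
    (tailBound_lev e hγ y)

lemma setIntegral_covTerm [IsProbabilityMeasure P] (hγ : 0 < γ)
    (hη : IsPoissonProcess P η (ENNReal.ofReal γ • hvol n)) {α : ℝ} (hα : 0 < α)
    (e : IdealPoint n) (x : HSpace n) :
    ∫ y in horoball e x, covTerm P η e α x y ∂hvol n = covInt γ α (lev e) ∅ x := by
  rw [covInt, setIntegral_congr_set (horoball_ae_eq e x)]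
  exact integral_congr_ae (ae_restrict_of_ae (ae_covTerm_eq hγ hη hα e x))

end Variance

end HypRST

end

/-! ### The limit of the normalised variance. -/

open HypRST in
theorem proposition7p1 {n : ℕ} {Ω : Type*} [MeasurableSpace Ω] (P : Measure Ω)
    [IsProbabilityMeasure P] (γ : ℝ) (hγ : 0 < γ) (α : ℝ) (hα : 0 < α)
    (η : Ω → Set (HSpace n)) (hη : IsPoissonProcess P η (ENNReal.ofReal γ • hvol n))
    (o : HSpace n) (e : IdealPoint n) :
    -- all moments and integrals that occur are well defined and finite
    (∀ R : ℝ, MemLp (fun ω => edgeLengthFunctional o α R (η ω)) 2 P) ∧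
    (∀ R : ℝ, hvol n (hball o R) < ∞) ∧
    Integrable (fun ω => ell e (η ω) o ^ (2 * α)) P ∧
    (∀ y : HSpace n, Integrable (fun ω => ell e (η ω) y ^ α) P ∧
      Integrable (fun ω => ellWith e (η ω) y o ^ α * ellWith e (η ω) o y ^ α) P) ∧
    IntegrableOn (fun y => covTerm P η e α o y) (horoball e o) (hvol n) ∧
    -- the limit exists and has the stated value
    Tendsto
      (fun R : ℝ =>
        variance (fun ω => edgeLengthFunctional o α R (η ω)) P / (hvol n (hball o R)).toReal)
      atTop
      (𝓝 (γ * (∫ ω, ell e (η ω) o ^ (2 * α) ∂P)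
        + 2 * γ ^ 2 * ∫ y in horoball e o, covTerm P η e α o y ∂(hvol n))) := by

  have h2α : 0 < 2 * α := by positivity
  refine ⟨fun R => memLp_edgeLengthFunctional hγ hη hα o R, fun R => hvol_hball_lt_top o R,
    integrable_ell_rpow hγ hη h2α e o, fun y => ⟨integrable_ell_rpow hγ hη hα e y,
    integrable_ellWith_mul hγ hη hα e o y⟩, (integrable_covTerm hγ hη hα e o).integrableOn, ?_⟩
  obtain ⟨C, hC⟩ := exists_ae_abs_varDensity_le hγ hα o
  -- The normalised variance is the average of `varDensity` over `B(o, R)`.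
  have h := tendsto_ball_average (measurable_varDensity γ α o).aestronglyMeasurable hC
    (tendsto_varDensity e hγ hα o)
  rw [integral_ell_rpow hγ hη h2α, setIntegral_covTerm hγ hη hα]
  refine h.congr fun R => ?_
  rw [variance_edgeLengthFunctional hγ hη hα, toReal_hvol_hball]
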